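/- **Setting.** Let $d\in\{2,3\}$, and let $\Omega\subset\mathbb R^d$ be an open set with $\Omega=\operatorname{int}\overline\Omega$ (for instance a bounded Lipschitz domain) whose closure is the union of a finite family $\mathfrak T_h$ of closed cells, each a nondegenerate simplex or a nondegenerate axis-parallel box. Distinct cells have disjoint interiors, and the cells match face to face: any two faces ($(d-1)$-dimensional) of cells coincide or overlap in a set of $(d-1)$-dimensional measure zero. Let $k$ be a measurable matrix field, symmetric on $\Omega$, with $k_{\min}|\zeta|^2\le \zeta^Tk(x)\zeta\le k_{\max}|\zeta|^2$ for all $x\in\Omega$, $\zeta\in\mathbb R^d$, where $k_{\min}>0$, and let $f\in L^2(\Omega)$. Write $(\cdot,\cdot)_D$ for the $L^2(D)$ inner product, $(\cdot,\cdot)=(\cdot,\cdot)_\Omega$, and $H^0(\mathrm{div},K)=\{v\in H(\mathrm{div},K): v\cdot n_{\partial K}=0\}$. **Multiscale spaces.** $V_h(K)=RT_0(K)$ is the lowest-order Raviart–Thomas space: the fields $x\mapsto a+cx$ ($a\in\mathbb R^d$, $c\in\mathbb R$) on a simplex, the fields $x\mapsto(a_i+c_ix_i)_{i}$ on a box. For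 $\chi\in RT_0(K)$ let $(\eta_\chi^K,\psi_\chi^K,\phi_\chi^K)\in[L^2(K)]^d\times H(\mathrm{div},K)\times L^2(K)/\mathbb R$ be the solution of $$(k\eta_\chi^K,\xi)_K+(\psi_\chi^K,\xi)_K=0\ \ \forall\xi\in[L^2(K)]^d,\qquad(\eta_\chi^K,\tau)_K+(\phi_\chi^K,\operatorname{div}\tau)_K=0\ \ \forall\tau\in H^0(\mathrm{div},K),$$ $$(\operatorname{div}\psi_\chi^K,q)_K=(\operatorname{div}\chi,q)_K\ \ \forall q\in L^2(K),\qquad \psi_\chi^K\cdot n_{\partial K}=\chi\cdot n_{\partial K}\ \text{on }\partial K .$$ Define - $X_{1,h}=\{\theta\in[L^2(\Omega)]^d:\theta|_K\in\operatorname{span}\{\eta^K_\chi\}\ \forall K\in\mathfrak T_h\}$, - $\tilde X_{2,h}=\{u\in[L^2(\Omega)]^d:u|_K\in\operatorname{span}\{\psi^K_\chi\}\ \forall K\in\mathfrak T_h\}$ and $X_{2,h}=\tilde X_{2,h}\cap H(\mathrm{div},\Omega)$, - $Q_h=\{q\in L^2(\Omega): q|_K\text{ is constant }\forall K\in\mathfrak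 T_h\}$, - $\Pi_h$, the space of square-integrable functions $\pi$ on the union of the faces such that $\pi|_e\in X_{2,h}\cdot n_e$ for each interface $e$ of two cells and $\pi|_e=0$ for each face $e\subset\partial\Omega$, - $[C_h\tau,\pi]=\sum_{K\in\mathfrak T_h}(\tau|_K\cdot n_{\partial K},\pi)_{\partial K}$ for $\tau\in\tilde X_{2,h}$, $\pi\in\Pi_h$, where $n_{\partial K}$ is the outward unit normal. **Problem (P), the local expanded mixed MsFEM.** Find $(\theta,u,p)\in X_{1,h}\times X_{2,h}\times Q_h$ such that $$(k\theta,\xi)+(u,\xi)=0\ \ \forall\xi\in X_{1,h},\qquad(\theta,\tau)+(p,\operatorname{div}\tau)=0\ \ \forall\tau\in X_{2,h},\qquad(\operatorname{div}u,q)=(f,q)\ \ \forall q\in Q_h .$$ **Problem (H), its hybridization.** Find $(\bar\theta,\bar u,\bar p,\lambda)\in X_{1,h}\times\tilde X_{2,h}\times Q_h\times\Pi_h$ such that $$(k\bar\theta,\xi)+(\bar u,\xi)=0\ \ \forall\xi\in X_{1,h},\qquad(\bar\theta,\tau)+\sum_K(\bar p,\operatorname{div}\tau)_K=[C_h\tau,\lambda]\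 \ \forall\tau\in\tilde X_{2,h},$$ $$\sum_K(\operatorname{div}\bar u,q)_K=(f,q)\ \ \forall q\in Q_h,\qquad[C_h\bar u,\pi]=0\ \ \forall\pi\in\Pi_h .$$ **Theorem.** Problem (P) has a unique solution $(\theta,u,p)$, Problem (H) has a unique solution $(\bar\theta,\bar u,\bar p,\lambda)$, and $(\bar\theta,\bar u,\bar p)=(\theta,u,p)$. -/

import Mathlib

open MeasureTheory
open scoped ContDiff

noncomputable section

namespace ExpMsFEM

/-- The space `ℝ^d` with its Euclidean norm. -/
abbrev Pt (d : ℕ) : Type := EuclideanSpace ℝ (Fin d)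

/-- `L²(U)`. -/
abbrev L2 {d : ℕ} (U : Set (Pt d)) := Lp ℝ 2 ((volume : Measure (Pt d)).restrict U)

/-- `[L²(U)]^d`. -/
abbrev L2V {d : ℕ} (U : Set (Pt d)) := Lp (Pt d) 2 ((volume : Measure (Pt d)).restrict U)

/-! ### The space `H(div, U)` and normal traces, for an open set `U` -/

/-- `g` is the weak divergence of `v` on the open set `U`:
`∫_U v · ∇φ = - ∫_U g φ` for all `φ ∈ C_c^∞(U)`. -/
def HasWeakDiv {d : ℕ} (U : Set (Pt d)) (v : Pt d → Pt d) (g : L2 U) : Prop :=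
  ∀ φ : Pt d → ℝ, ContDiff ℝ ∞ φ → HasCompactSupport φ → tsupport φ ⊆ U →
    ∫ x in U, inner ℝ (v x) (gradient φ x) = - ∫ x in U, g x * φ x

/-- `v ∈ H(div, U)`. -/
def MemHDiv {d : ℕ} (U : Set (Pt d)) (v : Pt d → Pt d) : Prop :=
  MemLp v 2 ((volume : Measure (Pt d)).restrict U) ∧ ∃ g : L2 U, HasWeakDiv U v g

open Classical in
/-- The weak divergence of `v` on `U` (and `0` if there is none in `L²(U)`). -/
def weakDiv {d : ℕ} (U : Set (Pt d)) (v : Pt d → Pt d) : L2 U :=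
  if h : ∃ g : L2 U, HasWeakDiv U v g then h.choose else 0

/-- `v ∈ H⁰(div, U)`: `v ∈ H(div, U)` and `v · n = 0` on `∂U`, where the normal trace is the
functional of Green's formula, `φ ↦ ∫_U v · ∇φ + ∫_U (div v) φ`. -/
def MemH0Div {d : ℕ} (U : Set (Pt d)) (v : Pt d → Pt d) : Prop :=
  MemHDiv U v ∧ ∀ φ : Pt d → ℝ, ContDiff ℝ ∞ φ → HasCompactSupport φ →
    (∫ x in U, inner ℝ (v x) (gradient φ x)) + (∫ x in U, weakDiv U v x * φ x) = 0

/-- The surface measure ((d-1)-dimensional Euclidean Hausdorff measure) on the set `A`. -/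
def surf {d : ℕ} (A : Set (Pt d)) : Measure (Pt d) :=
  (Measure.euclideanHausdorffMeasure (d - 1) : Measure (Pt d)).restrict A

/-- `γ ∈ L²(∂U)` is the normal trace `v · n_{∂U}` (`n_{∂U}` the outward unit normal) of
`v ∈ H(div, U)`, through Green's formula
`∫_U v · ∇φ + ∫_U (div v) φ = ∫_{∂U} γ φ`. -/
def IsNormalTrace {d : ℕ} (U : Set (Pt d)) (v : Pt d → Pt d)
    (γ : Lp ℝ 2 (surf (frontier U))) : Prop :=
  MemHDiv U v ∧ ∀ φ : Pt d → ℝ, ContDiff ℝ ∞ φ → HasCompactSupport φ →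
    (∫ x in U, inner ℝ (v x) (gradient φ x)) + (∫ x in U, weakDiv U v x * φ x)
      = ∫ x, γ x * φ x ∂(surf (frontier U))

open Classical in
/-- The normal trace `v · n_{∂U}` in `L²(∂U)` (and `0` if there is none). -/
def normalTrace {d : ℕ} (U : Set (Pt d)) (v : Pt d → Pt d) : Lp ℝ 2 (surf (frontier U)) :=
  if h : ∃ γ : Lp ℝ 2 (surf (frontier U)), IsNormalTrace U v γ then h.choose else 0

/-! ### Cells and meshes -/

/-- The cells of a coarse mesh: nondegenerate simplices and nondegenerate axis-parallel boxes. -/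
inductive Cell (d : ℕ) : Type
  | simplex (s : Affine.Simplex ℝ (Pt d) d) : Cell d
  | box (a b : Fin d → ℝ) (h : ∀ i, a i < b i) : Cell d

namespace Cell

/-- The closed cell. -/
def carrier {d : ℕ} : Cell d → Set (Pt d)
  | simplex s => convexHull ℝ (Set.range s.points)
  | box a b _ => {x | ∀ i, a i ≤ x i ∧ x i ≤ b i}

/-- The open cell. -/
def dom {d : ℕ} (K : Cell d) : Set (Pt d) := interior K.carrier

/-- The (closed, (d-1)-dimensional) faces of a cell. -/
def faces {d : ℕ} : Cell d → Set (Set (Pt d))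
  | simplex s => {e | ∃ i, e = convexHull ℝ (s.points '' {i}ᶜ)}
  | box a b h => {e | ∃ i, e = {x | x ∈ (box a b h).carrier ∧ x i = a i} ∨
      e = {x | x ∈ (box a b h).carrier ∧ x i = b i}}

/-- The lowest-order Raviart-Thomas space `V_h(K) = RT₀(K)`: the fields `x ↦ a + c x` on a simplex,
the fields `x ↦ (a_i + c_i x_i)_i` on a box. -/
def RT0 {d : ℕ} : Cell d → Set (Pt d → Pt d)
  | simplex _ => {χ | ∃ (a : Pt d) (c : ℝ), ∀ x, χ x = a + c • x}
  | box _ _ _ => {χ | ∃ a c : Fin d → ℝ, ∀ x i, χ x i = a i + c i * x i}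

end Cell

/-- A finite partition of `Ω` into cells, matching face to face: two faces of cells coincide or
overlap in a set of (d-1)-dimensional measure zero. -/
structure Mesh {d : ℕ} (Ω : Set (Pt d)) where
  cells : Finset (Cell d)
  cover : closure Ω = ⋃ K ∈ cells, K.carrier
  disjoint : ∀ K ∈ cells, ∀ L ∈ cells, K ≠ L → Disjoint K.dom L.dom
  conforming : ∀ K ∈ cells, ∀ L ∈ cells, ∀ e ∈ K.faces, ∀ e' ∈ L.faces, e ≠ e' →
    (Measure.euclideanHausdorffMeasure (d - 1) : Measure (Pt d)) (e ∩ e') = 0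

/-! ### Multiscale basis functions -/

/-- `((η, ψ), φ)` solves the weak form of the cell problem on `U` with datum `χ`:
`ψ + k η = 0`, `η = ∇φ`, `div ψ = div χ` in `U` and `ψ · n = χ · n` on `∂U`. -/
def IsLocalSolution {d : ℕ} (k : Pt d → Pt d →L[ℝ] Pt d) (U : Set (Pt d)) (χ : Pt d → Pt d)
    (η ψ : L2V U) (φ : L2 U) : Prop :=
  (∀ ξ : L2V U, (∫ x in U, inner ℝ (k x (η x)) (ξ x)) + (∫ x in U, inner ℝ (ψ x) (ξ x)) = 0) ∧
  (∀ τ : L2V U, MemH0Div U τ →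
    (∫ x in U, inner ℝ (η x) (τ x)) + (∫ x in U, φ x * weakDiv U τ x) = 0) ∧
  MemHDiv U ψ ∧
  (∀ q : L2 U, ∫ x in U, weakDiv U ψ x * q x = ∫ x in U, weakDiv U χ x * q x) ∧
  MemH0Div U (fun x => ψ x - χ x)

/-- `span {η_χ^K}`, `χ` ranging over `RT₀(K)`. -/
def gradSpan {d : ℕ} (k : Pt d → Pt d →L[ℝ] Pt d) (K : Cell d) : Submodule ℝ (L2V K.dom) :=
  Submodule.span ℝ {η | ∃ χ ∈ K.RT0, ∃ (ψ : L2V K.dom) (φ : L2 K.dom),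
    IsLocalSolution k K.dom χ η ψ φ}

/-- `span {ψ_χ^K}`, `χ` ranging over `RT₀(K)`. -/
def velSpan {d : ℕ} (k : Pt d → Pt d →L[ℝ] Pt d) (K : Cell d) : Submodule ℝ (L2V K.dom) :=
  Submodule.span ℝ {ψ | ∃ χ ∈ K.RT0, ∃ (η : L2V K.dom) (φ : L2 K.dom),
    IsLocalSolution k K.dom χ η ψ φ}

/-! ### The finite element spaces -/

namespace Mesh

/-- `X_{1,h}`: the fields `θ ∈ [L²(Ω)]^d` with `θ|_K ∈ span {η_χ^K}` for each cell `K`. -/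
def X1 {d : ℕ} {Ω : Set (Pt d)} (M : Mesh Ω) (k : Pt d → Pt d →L[ℝ] Pt d) : Set (L2V Ω) :=
  {θ | ∀ K ∈ M.cells, ∃ w ∈ gradSpan k K, ∀ᵐ x ∂(volume.restrict K.dom), θ x = w x}

/-- `X̃_{2,h}`: the fields `u ∈ [L²(Ω)]^d` with `u|_K ∈ span {ψ_χ^K}` for each cell `K`. -/
def X2broken {d : ℕ} {Ω : Set (Pt d)} (M : Mesh Ω) (k : Pt d → Pt d →L[ℝ] Pt d) :
    Set (L2V Ω) :=
  {u | ∀ K ∈ M.cells, ∃ w ∈ velSpan k K, ∀ᵐ x ∂(volume.restrict K.dom), u x = w x}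

/-- `X_{2,h}`: the fields `u ∈ H(div, Ω)` with `u|_K ∈ span {ψ_χ^K}` for each cell `K`. -/
def X2 {d : ℕ} {Ω : Set (Pt d)} (M : Mesh Ω) (k : Pt d → Pt d →L[ℝ] Pt d) : Set (L2V Ω) :=
  {u | MemHDiv Ω u ∧ u ∈ M.X2broken k}

/-- `Q_h`: the functions in `L²(Ω)` that are constant on each cell. -/
def Q {d : ℕ} {Ω : Set (Pt d)} (M : Mesh Ω) : Set (L2 Ω) :=
  {q | ∀ K ∈ M.cells, ∃ c : ℝ, ∀ᵐ x ∂(volume.restrict K.dom), q x = c}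

/-- The union of all faces of the mesh. -/
def skeleton {d : ℕ} {Ω : Set (Pt d)} (M : Mesh Ω) : Set (Pt d) :=
  ⋃ K ∈ M.cells, frontier K.dom

/-- The Lagrange multiplier space `Π_h`: square-integrable functions `π` on the faces, such that
`π|_e ∈ X_{2,h} · n_e` on each interface `e` of two cells, and `π|_e = 0` on each face
`e ⊆ ∂Ω`. -/
def Multipliers {d : ℕ} {Ω : Set (Pt d)} (M : Mesh Ω) (k : Pt d → Pt d →L[ℝ] Pt d) :
    Set (Lp ℝ 2 (surf M.skeleton)) :=
  {π | (∀ K ∈ M.cells, ∀ L ∈ M.cells, K ≠ L → ∀ e ∈ K.faces, e ∈ L.faces →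
      ∃ v ∈ M.X2 k, ∀ᵐ x ∂(surf e), π x = normalTrace K.dom v x) ∧
    (∀ K ∈ M.cells, ∀ e ∈ K.faces, e ⊆ frontier Ω → ∀ᵐ x ∂(surf e), π x = 0)}

/-- `[C_h τ, π] = ∑_K (τ · n_{∂K}, π)_{∂K}`. -/
def pairC {d : ℕ} {Ω : Set (Pt d)} (M : Mesh Ω) (τ : L2V Ω) (π : Lp ℝ 2 (surf M.skeleton)) : ℝ :=
  ∑ K ∈ M.cells, ∫ x, normalTrace K.dom τ x * π x ∂(surf (frontier K.dom))

/-! ### The two discrete problems -/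

/-- `((θ, u), p) ∈ X_{1,h} × X_{2,h} × Q_h` solves the local expanded mixed MsFEM. -/
def IsMsFEMSolution {d : ℕ} {Ω : Set (Pt d)} (M : Mesh Ω) (k : Pt d → Pt d →L[ℝ] Pt d)
    (f : L2 Ω) (θ u : L2V Ω) (p : L2 Ω) : Prop :=
  θ ∈ M.X1 k ∧ u ∈ M.X2 k ∧ p ∈ M.Q ∧
  (∀ ξ ∈ M.X1 k,
    (∫ x in Ω, inner ℝ (k x (θ x)) (ξ x)) + (∫ x in Ω, inner ℝ (u x) (ξ x)) = 0) ∧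
  (∀ τ ∈ M.X2 k,
    (∫ x in Ω, inner ℝ (θ x) (τ x)) + (∫ x in Ω, p x * weakDiv Ω τ x) = 0) ∧
  (∀ q ∈ M.Q, ∫ x in Ω, weakDiv Ω u x * q x = ∫ x in Ω, f x * q x)

/-- `(θ, u, p, lam) ∈ X_{1,h} × X̃_{2,h} × Q_h × Π_h` solves the hybridized method. -/
def IsHybridSolution {d : ℕ} {Ω : Set (Pt d)} (M : Mesh Ω) (k : Pt d → Pt d →L[ℝ] Pt d)
    (f : L2 Ω) (θ u : L2V Ω) (p : L2 Ω) (lam : Lp ℝ 2 (surf M.skeleton)) : Prop :=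
  θ ∈ M.X1 k ∧ u ∈ M.X2broken k ∧ p ∈ M.Q ∧ lam ∈ M.Multipliers k ∧
  (∀ ξ ∈ M.X1 k,
    (∫ x in Ω, inner ℝ (k x (θ x)) (ξ x)) + (∫ x in Ω, inner ℝ (u x) (ξ x)) = 0) ∧
  (∀ τ ∈ M.X2broken k,
    (∫ x in Ω, inner ℝ (θ x) (τ x))
      + ∑ K ∈ M.cells, ∫ x in K.dom, p x * weakDiv K.dom τ x = M.pairC τ lam) ∧
  (∀ q ∈ M.Q,
    ∑ K ∈ M.cells, ∫ x in K.dom, weakDiv K.dom u x * q x = ∫ x in Ω, f x * q x) ∧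
  (∀ π ∈ M.Multipliers k, M.pairC u π = 0)

end Mesh

end ExpMsFEM

end

noncomputable section

namespace ExpMsFEM

open Set Measure
open scoped ENNReal

/-! All unknowns live in finite-dimensional spaces, so the hybridized problem is a square linear
system and uniqueness is the whole matter. The mixed problem is the hybridized one with the
multiplier eliminated.

Local spaces. The field ψ_χ differs from χ by a divergence-free field without normal flux, so it
inherits the constant divergence and the constant face fluxes of χ (`HasFlux.of_hasWeakDiv0_sub`).
RT₀ has a basis dual to the faces; its Green formula comes from integrating along rays from a vertex
of a simplex, or along the edges of a box (`Cell.exists_facetSystem`). Hence every choice of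
constant face fluxes is attained by a local velocity (`exists_mem_velSpan_of_flux`), provided that
the cell problems are solvable: this is Lax-Milgram on the closure of the gradients, with a
potential supplied by the Poincaré inequality (`exists_isLocalSolution`). Moreover ψ = -kη, so the
broken velocities are exactly the image of X_{1,h} under -k (`Mesh.brokenSpace_velSpan_eq_map`).

Uniqueness. The first equation forces u = -kθ. If f = 0, testing the second equation with u kills
the pressure and multiplier terms and leaves (kθ, θ) = 0, so θ = u = 0. What remains is (p, div τ) =
[C_h τ, λ] for all broken τ. A velocity with flux through one face of one cell K shows that λ = p|_K
on that face. Now prescribe on each K the face fluxes of p|_K x, where x is the position vector: the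
left side becomes d ∑ p|_K² |K|, and the right side vanishes because x · n does not jump across
interfaces and λ = 0 on ∂Ω. So p = 0 and λ = 0 (`Mesh.eq_zero_of_forall_traces`).

Equivalence. A broken velocity is in H(div, Ω) exactly when its jump vanishes inside Ω. The jump cut
off to Ω is itself a multiplier, so this amounts to orthogonality to all multipliers
(`Mesh.mem_X2_iff_forall_integral`). Hybrid solutions are therefore mixed solutions. Conversely, for
a mixed solution the functional τ ↦ (θ, τ) + (p, div τ) vanishes on the common kernel of the
functionals [C_h ·, π], hence is one of them (`IsMixed.exists_isHybrid`), and uniqueness passes to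
the mixed problem. -/

/-! ### Hyperplane charts and Green's formula along straight paths -/

/-- An orthonormal basis of the kernel together with the transversal vector `u` gives a linear
isomorphism, which pushes Lebesgue measure to a Haar measure, and Haar measures are proportional.
The factor `c` is never computed: only its positivity and finiteness matter later. The base point is
free by translation invariance. -/
theorem exists_hyperplane_chart {d : ℕ} (hd : 0 < d) (ℓ : Pt d →ₗ[ℝ] ℝ) (u : Pt d)
    (hu : ℓ u ≠ 0) :
    ∃ (B : Pt (d - 1) →ₗᵢ[ℝ] Pt d) (c : ℝ≥0∞), (∀ x, x ∈ range B ↔ ℓ x = 0) ∧ c ≠ 0 ∧ c ≠ ⊤ ∧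
      ∀ p : Pt d, (volume : Measure (Pt d)) =
        c • (volume : Measure (Pt (d - 1) × ℝ)).map (fun q => p + B q.1 + q.2 • u) := by
  have hrank : Module.finrank ℝ (LinearMap.ker ℓ) = d - 1 := by
    have h1 := LinearMap.finrank_range_add_finrank_ker ℓ
    have h2 : LinearMap.range ℓ = ⊤ := by
      rw [LinearMap.range_eq_top]
      exact LinearMap.surjective (by rintro rfl; simp at hu)
    rw [h2, finrank_top] at h1
    simp at h1
    omega
  let b : OrthonormalBasis (Fin (d - 1)) ℝ (LinearMap.ker ℓ) :=
    (stdOrthonormalBasis ℝ (LinearMap.ker ℓ)).reindex (finCongr hrank)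
  let B : Pt (d - 1) →ₗᵢ[ℝ] Pt d :=
    (LinearMap.ker ℓ).subtypeₗᵢ.comp b.repr.symm.toLinearIsometry
  have hB : ∀ x, x ∈ range B ↔ ℓ x = 0 := by
    intro x
    constructor
    · rintro ⟨z, rfl⟩
      exact (b.repr.symm z).2
    · intro hx
      exact ⟨b.repr ⟨x, hx⟩, by simp [B]⟩
  let L₀ : (Pt (d - 1) × ℝ) →ₗ[ℝ] Pt d :=
    B.toLinearMap.coprod (LinearMap.toSpanSingleton ℝ (Pt d) u)
  have hL₀ : ∀ q, L₀ q = B q.1 + q.2 • u := fun q => by simp [L₀]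
  have hℓB : ∀ z, ℓ (B z) = 0 := fun z => (hB _).1 ⟨z, rfl⟩
  have hinj : Function.Injective L₀ := by
    rw [injective_iff_map_eq_zero]
    intro q hq
    rw [hL₀] at hq
    have h2 : q.2 = 0 := by
      have := congrArg ℓ hq
      simpa [hℓB, hu] using this
    have h1 : B q.1 = 0 := by simpa only [h2, zero_smul, add_zero] using hq
    exact Prod.ext ((map_eq_zero_iff B B.injective).1 h1) h2
  let L : (Pt (d - 1) × ℝ) ≃L[ℝ] Pt d :=
    (LinearEquiv.ofInjectiveOfFinrankEq L₀ hinj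
      (by simp [Module.finrank_prod]; omega)).toContinuousLinearEquiv
  have hL : ∀ q, L q = B q.1 + q.2 • u := fun q => by
    rw [← hL₀]; rfl
  have : (volume : Measure (Pt (d - 1) × ℝ)).IsAddHaarMeasure := by
    rw [volume_eq_prod]; infer_instance
  have hHaar : ((volume : Measure (Pt (d - 1) × ℝ)).map L).IsAddHaarMeasure :=
    L.isAddHaarMeasure_map _
  refine ⟨B, addHaarScalarFactor volume ((volume : Measure (Pt (d - 1) × ℝ)).map L), hB, ?_, ?_,
    fun p => ?_⟩
  · exact_mod_cast (addHaarScalarFactor_pos_of_isAddHaarMeasure _ _).ne'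
  · exact ENNReal.coe_ne_top
  · have h1 : (fun q : Pt (d - 1) × ℝ => p + B q.1 + q.2 • u) = (fun x => p + x) ∘ L := by
      funext q; simp [hL, add_assoc]
    rw [h1, ← map_map (by fun_prop) L.continuous.measurable, map_add_left_eq_self]
    exact isAddLeftInvariant_eq_smul _ _

theorem integral_eq_of_chart {d : ℕ} {B : Pt (d - 1) →ₗᵢ[ℝ] Pt d} {c : ℝ≥0∞} {p u : Pt d}
    (hc : c ≠ 0) (hc' : c ≠ ⊤)
    (hvol : (volume : Measure (Pt d)) =
        c • (volume : Measure (Pt (d - 1) × ℝ)).map (fun q => p + B q.1 + q.2 • u))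
    {G : Pt d → ℝ} (hG : Integrable G) :
    ∫ x, G x = c.toReal * ∫ s : ℝ, ∫ w, G (p + B w + s • u) := by
  have hm : Measurable (fun q : Pt (d - 1) × ℝ => p + B q.1 + q.2 • u) := by
    have := B.continuous
    fun_prop
  have hG' : Integrable G ((volume : Measure (Pt (d - 1) × ℝ)).map
      (fun q => p + B q.1 + q.2 • u)) := by
    rw [hvol] at hG
    exact (integrable_smul_measure hc hc').1 hG
  have hG'' := hG'.comp_measurable hm
  conv_lhs => rw [hvol]
  rw [integral_smul_measure, integral_map hm.aemeasurable hG'.aestronglyMeasurable, smul_eq_mul]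
  congr 1
  rw [volume_eq_prod] at hG'' ⊢
  exact integral_prod_symm _ hG''

/-- This is why `B` is required to be an isometry: it identifies the Hausdorff measure on the
hyperplane with Lebesgue measure, without a factor. -/
theorem setIntegral_hausdorff_of_chart {d : ℕ} (B : Pt (d - 1) →ₗᵢ[ℝ] Pt d) (p : Pt d)
    {e : Set (Pt d)} (he : MeasurableSet e) (hsub : e ⊆ range (fun z => p + B z)) (φ : Pt d → ℝ) :
    ∫ x in e, φ x ∂μHE[d - 1] = ∫ z in (fun z => p + B z) ⁻¹' e, φ (p + B z) := by
  have hA : Isometry (fun z => p + B z) := (IsometryEquiv.addLeft p).isometry.comp B.isometry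
  have h := hA.map_euclideanHausdorffMeasure (d := d - 1)
  rw [EuclideanSpace.euclideanHausdorffMeasure_eq_volume] at h
  have hemb : MeasurableEmbedding (fun z => p + B z) := hA.isClosedEmbedding.measurableEmbedding
  rw [← hemb.setIntegral_map, h, restrict_restrict he, inter_eq_left.2 hsub]

theorem hausdorff_apply_of_chart {d : ℕ} (B : Pt (d - 1) →ₗᵢ[ℝ] Pt d) (p : Pt d)
    {e : Set (Pt d)} (hsub : e ⊆ range (fun z => p + B z)) :
    μHE[d - 1] e = volume ((fun z => p + B z) ⁻¹' e) := by
  have hA : Isometry (fun z => p + B z) := (IsometryEquiv.addLeft p).isometry.comp B.isometry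
  have h := hA.euclideanHausdorffMeasure_preimage (d := d - 1) e
  rw [EuclideanSpace.euclideanHausdorffMeasure_eq_volume] at h
  rw [h, inter_eq_left.2 hsub]

theorem inner_gradient {d : ℕ} (φ : Pt d → ℝ) (v x : Pt d) :
    inner ℝ v (gradient φ x) = fderiv ℝ φ x v := by
  rw [real_inner_comm, gradient, InnerProductSpace.toDual_symm_apply]

theorem continuous_gradient {d : ℕ} {φ : Pt d → ℝ} (hφ : ContDiff ℝ ∞ φ) :
    Continuous (gradient φ) := by
  have h : Continuous (fderiv ℝ φ) := hφ.continuous_fderiv (by simp)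
  exact (InnerProductSpace.toDual ℝ (Pt d)).symm.continuous.comp h

/-- The set `K` is swept by the segments `s ↦ Γ z + s • D z` with density `s ^ κ`, and `χ` is `s • D
z` along them. So the integrand times the density is the derivative of `s ^ (κ + 1) * φ (Γ z + s • D
z)`, and only the endpoint `s = 1` contributes. Cones have `κ = d - 1`, cylinders have `κ = 0`. -/
theorem green_of_paths {d : ℕ} {K : Set (Pt d)} {E' : Set (Pt (d - 1))}
    {Γ D : Pt (d - 1) → Pt d} (hΓ : Continuous Γ) (hD : Continuous D) (hE' : IsCompact E')
    (hK : IsCompact K) {κ : ℕ} {c : ℝ} {χ : Pt d → Pt d} (hχ : Continuous χ)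
    (hχΓ : ∀ z (s : ℝ), χ (Γ z + s • D z) = s • D z)
    (hint : ∀ F : Pt d → ℝ, Continuous F →
      ∫ x in K, F x = c * ∫ s in Ioc (0 : ℝ) 1, s ^ κ * ∫ z in E', F (Γ z + s • D z))
    {φ : Pt d → ℝ} (hφ : ContDiff ℝ ∞ φ) :
    (∫ x in K, inner ℝ (χ x) (gradient φ x)) + ((κ : ℝ) + 1) * ∫ x in K, φ x
      = c * ∫ z in E', φ (Γ z + D z) := by
  have hg := continuous_gradient hφ
  have hFc : Continuous (fun x => inner ℝ (χ x) (gradient φ x) + ((κ : ℝ) + 1) * φ x) :=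
    (hχ.inner hg).add (continuous_const.mul hφ.continuous)
  have h1 : (∫ x in K, inner ℝ (χ x) (gradient φ x)) + ((κ : ℝ) + 1) * ∫ x in K, φ x
      = ∫ x in K, (inner ℝ (χ x) (gradient φ x) + ((κ : ℝ) + 1) * φ x) := by
    rw [integral_add, integral_const_mul]
    · exact (hχ.inner hg).continuousOn.integrableOn_compact hK
    · exact (continuous_const.mul hφ.continuous).continuousOn.integrableOn_compact hK
  rw [h1]
  set F : Pt d → ℝ := fun x => inner ℝ (χ x) (gradient φ x) + ((κ : ℝ) + 1) * φ x with hF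
  rw [hint F hFc]
  congr 1
  have h2 : ∀ s : ℝ, s ^ κ * ∫ z in E', F (Γ z + s • D z)
      = ∫ z in E', s ^ κ * F (Γ z + s • D z) := fun s => (integral_const_mul _ _).symm
  simp only [h2]
  rw [integral_integral_swap]
  · congr 1
    funext z
    rw [← intervalIntegral.integral_of_le zero_le_one]
    have hder : ∀ s : ℝ, HasDerivAt (fun s => s ^ (κ + 1) * φ (Γ z + s • D z))
        (s ^ κ * F (Γ z + s • D z)) s := by
      intro s
      have ha : HasDerivAt (fun s : ℝ => Γ z + s • D z) (D z) s := by
        simpa using ((hasDerivAt_id s).smul_const (D z)).const_add (Γ z)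
      have hb : HasDerivAt (fun s : ℝ => φ (Γ z + s • D z))
          (fderiv ℝ φ (Γ z + s • D z) (D z)) s :=
        ((hφ.differentiable (by simp)) _).hasFDerivAt.comp_hasDerivAt s ha
      have hp := (hasDerivAt_pow (κ + 1) s).mul hb
      refine hp.congr_deriv ?_
      simp only [hF, hχΓ, inner_gradient, map_smul, smul_eq_mul]
      push_cast
      ring
    rw [intervalIntegral.integral_eq_sub_of_hasDerivAt (fun s _ => hder s)]
    · simp
    · apply Continuous.intervalIntegrable
      have : Continuous (fun s : ℝ => Γ z + s • D z) := by fun_prop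
      exact (continuous_pow κ).mul (hFc.comp this)
  · have hcont : Continuous (Function.uncurry fun (s : ℝ) (z : Pt (d - 1)) =>
        s ^ κ * F (Γ z + s • D z)) := by
      have : Continuous (fun q : ℝ × Pt (d - 1) => Γ q.2 + q.1 • D q.2) := by fun_prop
      exact (continuous_fst.pow κ).mul (hFc.comp this)
    rw [prod_restrict]
    refine IntegrableOn.mono_set (t := Icc (0 : ℝ) 1 ×ˢ E') ?_
      (prod_mono Ioc_subset_Icc_self subset_rfl)
    exact hcont.continuousOn.integrableOn_compact (isCompact_Icc.prod hE')

theorem setIntegral_eq_of_slices {d : ℕ} {K : Set (Pt d)} (hK : IsCompact K)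
    {B : Pt (d - 1) →ₗᵢ[ℝ] Pt d} {c : ℝ≥0∞} {p u : Pt d} (hc : c ≠ 0) (hc' : c ≠ ⊤)
    (hvol : (volume : Measure (Pt d)) =
        c • (volume : Measure (Pt (d - 1) × ℝ)).map (fun q => p + B q.1 + q.2 • u))
    {κ : ℕ} {E' : Set (Pt (d - 1))} {Γ D : Pt (d - 1) → Pt d}
    (hout : ∀ s : ℝ, s ≠ 0 → s ∉ Ioc (0 : ℝ) 1 → ∀ w, p + B w + s • u ∉ K)
    (hin : ∀ s ∈ Ioc (0 : ℝ) 1, ∀ F : Pt d → ℝ,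
      ∫ w, K.indicator F (p + B w + s • u) = s ^ κ * ∫ z in E', F (Γ z + s • D z))
    (F : Pt d → ℝ) (hF : Continuous F) :
    ∫ x in K, F x = c.toReal * ∫ s in Ioc (0 : ℝ) 1, s ^ κ * ∫ z in E', F (Γ z + s • D z) := by
  have hKm := hK.isClosed.measurableSet
  rw [← integral_indicator hKm, integral_eq_of_chart hc hc' hvol
    ((integrable_indicator_iff hKm).2 (hF.continuousOn.integrableOn_compact hK)),
    ← integral_indicator measurableSet_Ioc]
  congr 1
  refine integral_congr_ae ?_
  -- The slice `s = 0` (the apex of a cone, the far end of a cylinder) may meet `K`, but it is a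
  -- null set.
  have h0 : ∀ᵐ s : ℝ, s ≠ 0 := by simp [ae_iff, measure_singleton]
  filter_upwards [h0] with s hs
  by_cases hs1 : s ∈ Ioc (0 : ℝ) 1
  · rw [indicator_of_mem hs1, hin s hs1]
  · rw [indicator_of_notMem hs1]
    simp [indicator_of_notMem (hout s hs hs1 _)]

theorem isCompact_preimage_chart {d : ℕ} (B : Pt (d - 1) →ₗᵢ[ℝ] Pt d) (p : Pt d)
    {e : Set (Pt d)} (he : IsCompact e) : IsCompact ((fun z => p + B z) ⁻¹' e) := by
  have hA : Isometry (fun z => p + B z) := (IsometryEquiv.addLeft p).isometry.comp B.isometry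
  exact hA.isClosedEmbedding.isCompact_preimage he

/-- Green's formula for a field that points away from the apex of a cone. -/
theorem green_cone {d : ℕ} (hd : 0 < d) {K e : Set (Pt d)} (hK : IsCompact K) (he : IsCompact e)
    (ℓ : Pt d →ᵃ[ℝ] ℝ) (v p : Pt d) (hv : ℓ v = 1) (hp : ℓ p = 0)
    (heℓ : ∀ x ∈ e, ℓ x = 0)
    (hsub : ∀ x ∈ K, 0 ≤ ℓ x ∧ ℓ x ≤ 1)
    (hcone : ∀ y, ℓ y = 0 → ∀ s : ℝ, 0 < s → s ≤ 1 → (v + s • (y - v) ∈ K ↔ y ∈ e)) :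
    ∃ h : ℝ, 0 < h ∧ ∀ φ : Pt d → ℝ, ContDiff ℝ ∞ φ →
      (∫ x in K, inner ℝ (x - v) (gradient φ x)) + (d : ℝ) * ∫ x in K, φ x
        = h * ∫ x in e, φ x ∂μHE[d - 1] := by
  have hu : ℓ.linear (p - v) = -1 := by
    have := ℓ.linearMap_vsub p v
    simp only [vsub_eq_sub] at this
    rw [this, hv, hp]; norm_num
  obtain ⟨B, c, hB, hc, hc', hvol⟩ := exists_hyperplane_chart hd ℓ.linear (p - v)
    (by rw [hu]; norm_num)
  have hℓ : ∀ x w : Pt d, ℓ (x + w) = ℓ x + ℓ.linear w := fun x w => by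
    have := ℓ.map_vadd x w
    rw [vadd_eq_add, vadd_eq_add] at this
    rw [add_comm x, this, add_comm]
  have hℓB : ∀ z, ℓ.linear (B z) = 0 := fun z => (hB _).1 ⟨z, rfl⟩
  have hℓA : ∀ z, ℓ (p + B z) = 0 := fun z => by rw [hℓ, hp, hℓB, add_zero]
  have hsubset : e ⊆ range (fun z => p + B z) := by
    intro x hx
    have : x - p ∈ range B := by
      rw [hB]
      have := ℓ.linearMap_vsub x p
      simp only [vsub_eq_sub] at this
      rw [this, heℓ x hx, hp, sub_zero]
    obtain ⟨z, hz⟩ := this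
    exact ⟨z, by simp [hz]⟩
  have hBc := B.continuous
  refine ⟨c.toReal, ENNReal.toReal_pos hc hc', fun φ hφ => ?_⟩
  rw [setIntegral_hausdorff_of_chart B p he.isClosed.measurableSet hsubset]
  have hdκ : (d : ℝ) = ((d - 1 : ℕ) : ℝ) + 1 := by
    rw [Nat.cast_sub hd]; simp
  rw [hdκ]
  -- The volume chart is based at the apex `v`, the chart of the face at `p`. Both use the same `B`,
  -- and `B z + (p - v)` leads from the apex to the point `p + B z` of the face.
  have key := green_of_paths (K := K) (E' := (fun z => p + B z) ⁻¹' e) (Γ := fun _ => v)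
    (D := fun z => B z + (p - v)) (κ := d - 1) (c := c.toReal) (χ := fun x => x - v)
    continuous_const (by fun_prop) (isCompact_preimage_chart B p he) hK (by fun_prop)
    (fun z s => by simp) (setIntegral_eq_of_slices hK hc hc' (hvol v) ?_ ?_) hφ
  · rw [key]
    congr 2
    funext z
    congr 1
    abel
  · intro s hs0 hs w hmem
    have := hsub _ hmem
    rw [hℓ, hℓ, hℓB, map_smul, hu, hv] at this
    simp only [add_zero, smul_eq_mul, mul_neg, mul_one] at this
    exact hs ⟨lt_of_le_of_ne (by linarith) hs0.symm, by linarith⟩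
  · intro s hs F
    -- The slice at height `s` is the face scaled by `s` about the apex, hence the Jacobian `s ^ (d
    -- - 1)`.
    have h1 := integral_comp_smul (volume : Measure (Pt (d - 1)))
      (fun w => K.indicator F (v + B w + s • (p - v))) s
    rw [finrank_euclideanSpace_fin, abs_of_nonneg (by have := hs.1; positivity), smul_eq_mul,
      inv_mul_eq_div, eq_div_iff (pow_ne_zero _ hs.1.ne'), mul_comm] at h1
    rw [← h1, ← integral_indicator (isCompact_preimage_chart B p he).isClosed.measurableSet]
    congr 2
    funext z
    have h2 : v + B (s • z) + s • (p - v) = v + s • (p + B z - v) := by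
      rw [map_smul]; module
    have h3 : v + s • (B z + (p - v)) = v + s • (p + B z - v) := by module
    rw [h2]
    by_cases hz : p + B z ∈ e
    · rw [indicator_of_mem ((hcone _ (hℓA z) s hs.1 hs.2).2 hz),
        indicator_of_mem (show z ∈ (fun z => p + B z) ⁻¹' e from hz), h3]
    · rw [indicator_of_notMem (fun h => hz ((hcone _ (hℓA z) s hs.1 hs.2).1 h)),
        indicator_of_notMem (show z ∉ (fun z => p + B z) ⁻¹' e from hz)]

/-- Green's formula for a field in the direction of the generatrices of a cylinder. -/
theorem green_slab {d : ℕ} (hd : 0 < d) {K e : Set (Pt d)} (hK : IsCompact K) (he : IsCompact e)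
    (ℓ : Pt d →ᵃ[ℝ] ℝ) (u p : Pt d) (hu : ℓ.linear u = 1) (hp : ℓ p = 1)
    (heℓ : ∀ x ∈ e, ℓ x = 1)
    (hsub : ∀ x ∈ K, 0 ≤ ℓ x ∧ ℓ x ≤ 1)
    (hslab : ∀ y, ℓ y = 1 → ∀ s : ℝ, 0 ≤ s → s ≤ 1 → (y - (1 - s) • u ∈ K ↔ y ∈ e)) :
    ∃ h : ℝ, 0 < h ∧ ∀ φ : Pt d → ℝ, ContDiff ℝ ∞ φ →
      (∫ x in K, inner ℝ (ℓ x • u) (gradient φ x)) + ∫ x in K, φ x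
        = h * ∫ x in e, φ x ∂μHE[d - 1] := by
  obtain ⟨B, c, hB, hc, hc', hvol⟩ := exists_hyperplane_chart hd ℓ.linear u
    (by rw [hu]; norm_num)
  have hℓ : ∀ x w : Pt d, ℓ (x + w) = ℓ x + ℓ.linear w := fun x w => by
    have := ℓ.map_vadd x w
    rw [vadd_eq_add, vadd_eq_add] at this
    rw [add_comm x, this, add_comm]
  have hℓB : ∀ z, ℓ.linear (B z) = 0 := fun z => (hB _).1 ⟨z, rfl⟩
  have hℓA : ∀ z, ℓ (p + B z) = 1 := fun z => by rw [hℓ, hp, hℓB, add_zero]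
  have hℓΓ : ∀ z (s : ℝ), ℓ (p - u + B z + s • u) = s := fun z s => by
    rw [hℓ, hℓ, sub_eq_add_neg, hℓ, hℓB, map_smul, map_neg, hu, hp]; simp
  have hsubset : e ⊆ range (fun z => p + B z) := by
    intro x hx
    have : x - p ∈ range B := by
      rw [hB]
      have := ℓ.linearMap_vsub x p
      simp only [vsub_eq_sub] at this
      rw [this, heℓ x hx, hp, sub_self]
    obtain ⟨z, hz⟩ := this
    exact ⟨z, by simp [hz]⟩
  have hBc := B.continuous
  refine ⟨c.toReal, ENNReal.toReal_pos hc hc', fun φ hφ => ?_⟩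
  rw [setIntegral_hausdorff_of_chart B p he.isClosed.measurableSet hsubset]
  have hℓc : Continuous ℓ := ℓ.continuous_of_finiteDimensional
  -- The paths start on the hyperplane `ℓ = 0`, which contains `p - u`. Along them `ℓ` equals the
  -- parameter `s`, so `ℓ x • u` is `s • u`.
  have key := green_of_paths (K := K) (E' := (fun z => p + B z) ⁻¹' e)
    (Γ := fun z => p - u + B z)
    (D := fun _ => u) (κ := 0) (c := c.toReal) (χ := fun x => ℓ x • u)
    (by fun_prop) (by fun_prop) (isCompact_preimage_chart B p he) hK (by fun_prop)
    (fun z s => by rw [hℓΓ]) (setIntegral_eq_of_slices hK hc hc' (hvol (p - u)) ?_ ?_) hφ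
  · simp only [Nat.cast_zero, zero_add, one_mul] at key
    rw [key]
    congr 2
    funext z
    congr 1
    abel
  · intro s hs0 hs w hmem
    have := hsub _ hmem
    rw [hℓΓ] at this
    exact hs ⟨lt_of_le_of_ne this.1 hs0.symm, this.2⟩
  · intro s hs F
    rw [pow_zero, one_mul,
      ← integral_indicator (isCompact_preimage_chart B p he).isClosed.measurableSet]
    congr 1
    funext z
    have h2 : p - u + B z + s • u = (p + B z) - (1 - s) • u := by module
    by_cases hz : p + B z ∈ e
    · rw [indicator_of_mem (show z ∈ (fun z => p + B z) ⁻¹' e from hz), h2,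
        indicator_of_mem ((hslab _ (hℓA z) s hs.1.le hs.2).2 hz)]
    · rw [indicator_of_notMem (show z ∉ (fun z => p + B z) ⁻¹' e from hz), h2,
        indicator_of_notMem (fun h => hz ((hslab _ (hℓA z) s hs.1.le hs.2).1 h))]

/-! ### Cells as intersections of half-spaces -/

/-- `K` is cut out by the affine inequalities `0 ≤ ℓ i x`, its faces lie on the hyperplanes
`ℓ i x = 0`, and none of the inequalities is redundant. -/
structure IsFacetSystem {d : ℕ} (K : Cell d) {ι : Type} (ℓ : ι → Pt d →ᵃ[ℝ] ℝ) : Prop where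
  carrier_eq : K.carrier = {x | ∀ i, 0 ≤ ℓ i x}
  faces_eq : K.faces = range (fun i => {x | x ∈ K.carrier ∧ ℓ i x = 0})
  exists_interior : ∃ y, ∀ i, 0 < ℓ i y
  exists_regular : ∀ i, ∃ y, ℓ i y = 0 ∧ ∀ j, j ≠ i → 0 < ℓ j y

/-- The field `χ` satisfies Green's formula on `K` with divergence `δ`, normal trace `h` on `e`, and
vanishing normal trace on the rest of the boundary. -/
def FluxThroughFace {d : ℕ} (K : Cell d) (e : Set (Pt d)) (χ : Pt d → Pt d) (δ h : ℝ) : Prop :=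
  ∀ φ : Pt d → ℝ, ContDiff ℝ ∞ φ →
    (∫ x in K.carrier, inner ℝ (χ x) (gradient φ x)) + δ * ∫ x in K.carrier, φ x
      = h * ∫ x in e, φ x ∂μHE[d - 1]

theorem affine_apply_line {d : ℕ} (ℓ : Pt d →ᵃ[ℝ] ℝ) (v y : Pt d) (s : ℝ) :
    ℓ (v + s • (y - v)) = (1 - s) * ℓ v + s * ℓ y := by
  have h : v + s • (y - v) = AffineMap.lineMap v y s := by
    rw [AffineMap.lineMap_apply, vsub_eq_sub, vadd_eq_add, add_comm]
  rw [h, AffineMap.apply_lineMap, AffineMap.lineMap_apply, vsub_eq_sub, vadd_eq_add, smul_eq_mul]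
  ring

theorem Cell.isCompact_carrier {d : ℕ} (K : Cell d) : IsCompact K.carrier := by
  cases K with
  | simplex s => exact (Set.finite_range s.points).isCompact_convexHull (𝕜 := ℝ)
  | box a b h =>
    have h1 : (Cell.box a b h).carrier
        = (EuclideanSpace.equiv (Fin d) ℝ).symm '' (Set.Icc a b) := by
      ext x
      constructor
      · intro hx
        exact ⟨fun i => x i, ⟨fun i => (hx i).1, fun i => (hx i).2⟩, by ext i; simp⟩
      · rintro ⟨z, hz, rfl⟩ i
        exact ⟨by simpa using hz.1 i, by simpa using hz.2 i⟩
    rw [h1]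
    exact isCompact_Icc.image (EuclideanSpace.equiv (Fin d) ℝ).symm.continuous

theorem Cell.convex_carrier {d : ℕ} (K : Cell d) : Convex ℝ K.carrier := by
  cases K with
  | simplex s => exact convex_convexHull ℝ _
  | box a b h =>
    intro x hx y hy s t hs ht hst i
    have h1 := hx i
    have h2 := hy i
    simp only [PiLp.add_apply, PiLp.smul_apply, smul_eq_mul]
    have hs' : s = 1 - t := by linarith
    subst hs'
    constructor <;> nlinarith

/-! ### Simplices: barycentric coordinates and the dual basis of RT₀ -/

section Simplex

variable {d : ℕ}

/-- The vertices of a simplex of full dimension as an affine basis. -/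
def simplexBasis (s : Affine.Simplex ℝ (Pt d) d) : AffineBasis (Fin (d + 1)) ℝ (Pt d) :=
  ⟨s.points, s.independent, by
    rw [s.independent.affineSpan_eq_top_iff_card_eq_finrank_add_one]; simp⟩

theorem simplexBasis_apply (s : Affine.Simplex ℝ (Pt d) d) (i : Fin (d + 1)) :
    simplexBasis s i = s.points i := rfl

theorem simplex_carrier (s : Affine.Simplex ℝ (Pt d) d) :
    (Cell.simplex s).carrier = {x | ∀ i, 0 ≤ (simplexBasis s).coord i x} :=
  (simplexBasis s).convexHull_eq_nonneg_coord

/-- A vanishing barycentric coordinate drops out of the convex combination, which then uses the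
other vertices only. -/
theorem simplex_face (s : Affine.Simplex ℝ (Pt d) d) (i : Fin (d + 1)) :
    convexHull ℝ (s.points '' {i}ᶜ)
      = {x | x ∈ (Cell.simplex s).carrier ∧ (simplexBasis s).coord i x = 0} := by
  set b := simplexBasis s with hb
  apply subset_antisymm
  · intro x hx
    refine ⟨convexHull_mono (image_subset_range _ _) hx, ?_⟩
    have hconv : Convex ℝ ((b.coord i) ⁻¹' {0}) :=
      (convex_singleton (0 : ℝ)).affine_preimage (b.coord i)
    refine convexHull_min ?_ hconv hx
    rintro _ ⟨j, hj, rfl⟩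
    exact b.coord_apply_ne (Ne.symm hj)
  · rintro x ⟨hx, hi⟩
    rw [simplex_carrier] at hx
    have h1 : ∑ j ∈ Finset.univ.erase i, b.coord j x = 1 := by
      have := b.sum_coord_apply_eq_one x
      rw [← Finset.add_sum_erase _ _ (Finset.mem_univ i), hi, zero_add] at this
      exact this
    have h2 : ∑ j ∈ Finset.univ.erase i, b.coord j x • s.points j = x := by
      have := b.linear_combination_coord_eq_self x
      rw [← Finset.add_sum_erase _ _ (Finset.mem_univ i), hi, zero_smul, zero_add] at this
      exact this
    rw [← h2]
    refine (convex_convexHull ℝ _).sum_mem (fun j _ => hx j) h1 (fun j hj => ?_)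
    exact subset_convexHull ℝ _ ⟨j, by simpa using hj, rfl⟩

theorem simplex_isFacetSystem (hd : 0 < d) (s : Affine.Simplex ℝ (Pt d) d) :
    IsFacetSystem (Cell.simplex s) (fun i => (simplexBasis s).coord i) := by
  set b := simplexBasis s with hb
  have hpos : ∃ y, ∀ i, 0 < b.coord i y := by
    have : (interior (convexHull ℝ (range b))).Nonempty := by
      rw [interior_convexHull_nonempty_iff_affineSpan_eq_top]; exact b.tot
    rwa [b.interior_convexHull] at this
  refine ⟨simplex_carrier s, ?_, hpos, fun i => ?_⟩
  · ext e
    constructor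
    · rintro ⟨i, rfl⟩; exact ⟨i, (simplex_face s i).symm⟩
    · rintro ⟨i, rfl⟩; exact ⟨i, (simplex_face s i).symm⟩
  · obtain ⟨y, hy⟩ := hpos
    have hlt : b.coord i y < 1 := by
      have : NeZero d := ⟨hd.ne'⟩
      obtain ⟨j, hj⟩ : ∃ j : Fin (d + 1), j ≠ i := exists_ne i
      have h1 := b.sum_coord_apply_eq_one y
      rw [← h1]
      exact Finset.single_lt_sum hj (Finset.mem_univ i) (Finset.mem_univ j) (hy j)
        (fun k _ _ => (hy k).le)
    have hlt' : 0 < 1 - b.coord i y := by linarith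
    -- The projection of the interior point `y` from the vertex `b i` onto the opposite hyperplane.
    refine ⟨b i + (1 - b.coord i y)⁻¹ • (y - b i), ?_, fun j hj => ?_⟩
    · rw [affine_apply_line, b.coord_apply_eq]
      field_simp
      ring
    · rw [affine_apply_line, b.coord_apply_ne hj, mul_zero, zero_add]
      exact mul_pos (inv_pos.2 hlt') (hy j)

/-- The simplex is the cone over a face with the opposite vertex as apex, and the field pointing
away from that vertex is tangential to all other faces. -/
theorem simplex_flux (hd : 0 < d) (s : Affine.Simplex ℝ (Pt d) d) (i : Fin (d + 1)) :
    ∃ h : ℝ, 0 < h ∧ FluxThroughFace (Cell.simplex s)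
      {x | x ∈ (Cell.simplex s).carrier ∧ (simplexBasis s).coord i x = 0}
      (fun x => x - s.points i) d h := by
  set b := simplexBasis s with hb
  have : NeZero d := ⟨hd.ne'⟩
  obtain ⟨j, hj⟩ : ∃ j : Fin (d + 1), j ≠ i := exists_ne i
  have hcont : Continuous (b.coord i) := (b.coord i).continuous_of_finiteDimensional
  refine green_cone hd (Cell.isCompact_carrier _)
    ((Cell.isCompact_carrier _).inter_right (isClosed_singleton.preimage hcont)) (b.coord i)
    (s.points i) (s.points j) (b.coord_apply_eq i) (b.coord_apply_ne hj.symm) (fun x hx => hx.2)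
    (fun x hx => ?_) (fun y hy t ht ht1 => ?_)
  · rw [simplex_carrier] at hx
    refine ⟨hx i, ?_⟩
    rw [← b.sum_coord_apply_eq_one x]
    exact Finset.single_le_sum (f := fun j => b.coord j x) (fun k _ => hx k) (Finset.mem_univ i)
  · rw [simplex_carrier]
    simp only [mem_ofPred_eq, affine_apply_line]
    have hv : ∀ k, k ≠ i → b.coord k (s.points i) = 0 := fun k hk => b.coord_apply_ne hk
    constructor
    · intro h
      refine ⟨fun k => ?_, hy⟩
      by_cases hk : k = i
      · rw [hk]; exact hy.ge
      · have := h k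
        rw [← hb, hv k hk, mul_zero, zero_add] at this
        exact nonneg_of_mul_nonneg_right this ht
    · rintro ⟨h, -⟩ k
      by_cases hk : k = i
      · rw [hk, hy, ← simplexBasis_apply, b.coord_apply_eq]; linarith
      · rw [hv k hk, mul_zero, zero_add]
        exact mul_nonneg ht.le (h k)

theorem simplex_RT0_span (s : Affine.Simplex ℝ (Pt d) d) {χ : Pt d → Pt d}
    (hχ : χ ∈ (Cell.simplex s).RT0) :
    ∃ w : Fin (d + 1) → ℝ, ∀ x, χ x = ∑ i, w i • (x - s.points i) := by
  obtain ⟨a, c, h⟩ := hχ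
  set b := simplexBasis s with hb
  -- The weights need sum `c` and first moment `-a`. The first two terms have sum zero and moment
  -- `-a`, the third has sum `c` and moment zero.
  refine ⟨fun i => b.coord i (-a) - b.coord i 0 + c * b.coord i 0, fun x => ?_⟩
  rw [h x]
  have e1 : ∀ y, ∑ i, b.coord i y • s.points i = y := fun y => b.linear_combination_coord_eq_self y
  have e2 : ∀ y, ∑ i, b.coord i y = 1 := fun y => b.sum_coord_apply_eq_one y
  simp only [smul_sub, Finset.sum_sub_distrib, ← Finset.sum_smul, add_smul, sub_smul,
    Finset.sum_add_distrib, mul_smul, ← Finset.smul_sum, e1, e2]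
  module

end Simplex

/-! ### Boxes: facet functions and the dual basis of RT₀ -/

section Box

variable {d : ℕ}

/-- The normalized distances to the hyperplanes `x i = a i` and `x i = b i`. -/
def boxFacet (a b : Fin d → ℝ) : Fin d × Bool → Pt d →ᵃ[ℝ] ℝ
  | (i, false) => (b i - a i)⁻¹ •
      ((EuclideanSpace.proj (𝕜 := ℝ) i).toLinearMap.toAffineMap - AffineMap.const ℝ (Pt d) (a i))
  | (i, true) => (b i - a i)⁻¹ •
      (AffineMap.const ℝ (Pt d) (b i) - (EuclideanSpace.proj (𝕜 := ℝ) i).toLinearMap.toAffineMap)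

theorem boxFacet_false (a b : Fin d → ℝ) (i : Fin d) (x : Pt d) :
    boxFacet a b (i, false) x = (b i - a i)⁻¹ * (x i - a i) := by
  simp [boxFacet]

theorem boxFacet_true (a b : Fin d → ℝ) (i : Fin d) (x : Pt d) :
    boxFacet a b (i, true) x = (b i - a i)⁻¹ * (b i - x i) := by
  simp [boxFacet]

theorem boxFacet_not {a b : Fin d → ℝ} (h : ∀ i, a i < b i) (i : Fin d) (σ : Bool) (x : Pt d) :
    boxFacet a b (i, !σ) x = 1 - boxFacet a b (i, σ) x := by
  have := sub_ne_zero.2 (h i).ne'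
  cases σ
  · simp only [Bool.not_false, boxFacet_false, boxFacet_true]; field_simp; ring
  · simp only [Bool.not_true, boxFacet_false, boxFacet_true]; field_simp; ring

theorem box_carrier {a b : Fin d → ℝ} (h : ∀ i, a i < b i) :
    (Cell.box a b h).carrier = {x | ∀ i, 0 ≤ boxFacet a b i x} := by
  ext x
  have hp : ∀ i, 0 < (b i - a i)⁻¹ := fun i => inv_pos.2 (sub_pos.2 (h i))
  constructor
  · rintro hx ⟨i, σ⟩
    cases σ
    · rw [boxFacet_false]; exact mul_nonneg (hp i).le (sub_nonneg.2 (hx i).1)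
    · rw [boxFacet_true]; exact mul_nonneg (hp i).le (sub_nonneg.2 (hx i).2)
  · intro hx i
    have h1 := hx (i, false)
    have h2 := hx (i, true)
    rw [boxFacet_false] at h1
    rw [boxFacet_true] at h2
    exact ⟨sub_nonneg.1 (nonneg_of_mul_nonneg_right h1 (hp i)),
      sub_nonneg.1 (nonneg_of_mul_nonneg_right h2 (hp i))⟩

theorem boxFacet_false_eq_zero {a b : Fin d → ℝ} (h : ∀ i, a i < b i) (i : Fin d) (x : Pt d) :
    boxFacet a b (i, false) x = 0 ↔ x i = a i := by
  rw [boxFacet_false, mul_eq_zero, sub_eq_zero]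
  simp [sub_ne_zero.2 (h i).ne']

theorem boxFacet_true_eq_zero {a b : Fin d → ℝ} (h : ∀ i, a i < b i) (i : Fin d) (x : Pt d) :
    boxFacet a b (i, true) x = 0 ↔ x i = b i := by
  rw [boxFacet_true, mul_eq_zero, sub_eq_zero, eq_comm (a := b i) (b := x i)]
  simp [sub_ne_zero.2 (h i).ne']

theorem box_isFacetSystem {a b : Fin d → ℝ} (h : ∀ i, a i < b i) :
    IsFacetSystem (Cell.box a b h) (boxFacet a b) := by
  have hp : ∀ i, 0 < (b i - a i)⁻¹ := fun i => inv_pos.2 (sub_pos.2 (h i))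
  refine ⟨box_carrier h, ?_, ?_, ?_⟩
  · ext e
    constructor
    · rintro ⟨i, rfl | rfl⟩
      · refine ⟨(i, false), ?_⟩
        simp only [boxFacet_false_eq_zero h]
      · refine ⟨(i, true), ?_⟩
        simp only [boxFacet_true_eq_zero h]
    · rintro ⟨⟨i, σ⟩, rfl⟩
      refine ⟨i, ?_⟩
      cases σ
      · left; simp only [boxFacet_false_eq_zero h]
      · right; simp only [boxFacet_true_eq_zero h]
  · refine ⟨WithLp.toLp 2 fun i => (a i + b i) / 2, ?_⟩
    rintro ⟨i, σ⟩
    have := h i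
    cases σ
    · rw [boxFacet_false]; exact mul_pos (hp i) (by simp only; linarith)
    · rw [boxFacet_true]; exact mul_pos (hp i) (by simp only; linarith)
  · rintro ⟨i, σ⟩
    -- The centre of the face `(i, σ)`.
    refine ⟨WithLp.toLp 2 fun j => if j = i then (if σ then b i else a i) else (a j + b j) / 2,
      ?_, ?_⟩
    · cases σ
      · rw [boxFacet_false_eq_zero h]; simp
      · rw [boxFacet_true_eq_zero h]; simp
    · rintro ⟨j, τ⟩ hj
      have := h j
      by_cases hji : j = i
      · subst hji
        have hτ : τ = !σ := by
          cases σ <;> cases τ <;> simp_all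
        subst hτ
        rw [boxFacet_not h]
        have h0 : boxFacet a b (j, σ)
            (WithLp.toLp 2 fun k => if k = j then (if σ then b j else a j) else (a k + b k) / 2)
              = 0 := by
          cases σ
          · rw [boxFacet_false_eq_zero h]; simp
          · rw [boxFacet_true_eq_zero h]; simp
        rw [h0]; norm_num
      · cases τ
        · rw [boxFacet_false]; exact mul_pos (hp j) (by simp only [hji, if_false]; linarith)
        · rw [boxFacet_true]; exact mul_pos (hp j) (by simp only [hji, if_false]; linarith)

/-- The edge vector of a box that points towards the face `(i, σ)`. -/
def boxEdge (a b : Fin d → ℝ) : Fin d × Bool → Pt d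
  | (i, false) => EuclideanSpace.single i (a i - b i)
  | (i, true) => EuclideanSpace.single i (b i - a i)

theorem boxFacet_linear_edge {a b : Fin d → ℝ} (h : ∀ i, a i < b i) (i : Fin d) (σ : Bool) :
    (boxFacet a b (i, !σ)).linear (boxEdge a b (i, σ)) = 1 := by
  have := sub_ne_zero.2 (h i).ne'
  cases σ
  · simp [boxFacet, boxEdge]; field_simp; ring
  · simp [boxFacet, boxEdge]; field_simp

theorem boxFacet_add_edge {a b : Fin d → ℝ} {i j : Fin d} (hij : j ≠ i) (σ τ : Bool) (y : Pt d)
    (s : ℝ) : boxFacet a b (j, τ) (y - s • boxEdge a b (i, σ)) = boxFacet a b (j, τ) y := by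
  cases σ <;> cases τ <;> simp [boxFacet_false, boxFacet_true, boxEdge, hij]

/-- The box is a cylinder over each of its faces. The field is parallel to one edge direction,
vanishes on the opposite face and is tangential to the remaining faces; `green_slab` applies with
the facet function of the opposite face, which is one on the face in question. -/
theorem box_flux (hd : 0 < d) {a b : Fin d → ℝ} (h : ∀ i, a i < b i) (i : Fin d) (σ : Bool) :
    ∃ t : ℝ, 0 < t ∧ FluxThroughFace (Cell.box a b h)
      {x | x ∈ (Cell.box a b h).carrier ∧ boxFacet a b (i, σ) x = 0}
      (fun x => boxFacet a b (i, !σ) x • boxEdge a b (i, σ)) 1 t := by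
  have hcont : Continuous (boxFacet a b (i, σ)) :=
    (boxFacet a b (i, σ)).continuous_of_finiteDimensional
  obtain ⟨p, hp, -⟩ := (box_isFacetSystem h).exists_regular (i, σ)
  have hsub := boxFacet_linear_edge h i σ
  have hslice : ∀ x ∈ (Cell.box a b h).carrier,
      0 ≤ boxFacet a b (i, !σ) x ∧ boxFacet a b (i, !σ) x ≤ 1 := by
    intro x hx
    rw [box_carrier] at hx
    have h1 := hx (i, σ)
    have h2 := hx (i, !σ)
    refine ⟨h2, ?_⟩
    rw [boxFacet_not h]; linarith
  have hcyl : ∀ y, boxFacet a b (i, !σ) y = 1 → ∀ s : ℝ, 0 ≤ s → s ≤ 1 →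
      (y - (1 - s) • boxEdge a b (i, σ) ∈ (Cell.box a b h).carrier ↔
        y ∈ {x | x ∈ (Cell.box a b h).carrier ∧ boxFacet a b (i, σ) x = 0}) := by
    intro y hy s hs hs1
    have hy0 : boxFacet a b (i, σ) y = 0 := by
      have := boxFacet_not h i σ y
      linarith
    have h1 : boxFacet a b (i, !σ) (y - (1 - s) • boxEdge a b (i, σ)) = s := by
      have e1 : y - (1 - s) • boxEdge a b (i, σ)
          = (-(1 - s) • boxEdge a b (i, σ)) +ᵥ y := by
        rw [vadd_eq_add]; module
      rw [e1, AffineMap.map_vadd, map_smul, hsub, hy, vadd_eq_add, smul_eq_mul]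
      ring
    have h2 : boxFacet a b (i, σ) (y - (1 - s) • boxEdge a b (i, σ)) = 1 - s := by
      have := boxFacet_not h i σ (y - (1 - s) • boxEdge a b (i, σ))
      linarith
    rw [box_carrier]
    constructor
    · intro hm
      refine ⟨?_, hy0⟩
      rintro ⟨j, τ⟩
      by_cases hji : j = i
      · subst hji
        rcases Bool.eq_or_eq_not τ σ with rfl | rfl
        · exact hy0.ge
        · rw [hy]; norm_num
      · have := hm (j, τ)
        rwa [boxFacet_add_edge hji] at this
    · rintro ⟨hm, -⟩ ⟨j, τ⟩
      by_cases hji : j = i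
      · subst hji
        rcases Bool.eq_or_eq_not τ σ with rfl | rfl
        · rw [h2]; linarith
        · rw [h1]; exact hs
      · rw [boxFacet_add_edge hji]
        exact hm (j, τ)
  obtain ⟨t, ht, key⟩ := green_slab hd (Cell.isCompact_carrier (Cell.box a b h))
    (e := {x | x ∈ (Cell.box a b h).carrier ∧ boxFacet a b (i, σ) x = 0})
    ((Cell.isCompact_carrier _).inter_right (isClosed_singleton.preimage hcont))
    (boxFacet a b (i, !σ)) (boxEdge a b (i, σ)) p hsub
    (by rw [boxFacet_not h, hp, sub_zero])
    (fun x hx => by rw [boxFacet_not h, hx.2, sub_zero])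
    hslice hcyl
  exact ⟨t, ht, fun φ hφ => by simpa only [one_mul] using key φ hφ⟩

theorem box_RT0_span {a b : Fin d → ℝ} (h : ∀ i, a i < b i) {χ : Pt d → Pt d}
    (hχ : χ ∈ (Cell.box a b h).RT0) :
    ∃ w : Fin d × Bool → ℝ, ∀ x,
      χ x = ∑ q, w q • (boxFacet a b (q.1, !q.2) x • boxEdge a b q) := by
  obtain ⟨α, c, hχ⟩ := hχ
  have hne : ∀ i, b i - a i ≠ 0 := fun i => sub_ne_zero.2 (h i).ne'
  -- Each component is the affine interpolation of its values on two opposite faces. A basis field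
  -- equals the outward edge vector on its own face, so its weight is the outward component there
  -- divided by the edge length.
  refine ⟨fun q => if q.2 then (b q.1 - a q.1)⁻¹ * (α q.1 + c q.1 * b q.1)
    else - ((b q.1 - a q.1)⁻¹ * (α q.1 + c q.1 * a q.1)), fun x => ?_⟩
  ext j
  rw [hχ, Fintype.sum_prod_type]
  simp only [Fintype.sum_bool, if_true, Bool.not_true, Bool.not_false, boxFacet_false,
    boxFacet_true, boxEdge]
  rw [WithLp.ofLp_sum, Finset.sum_apply, Finset.sum_eq_single j]
  · simp
    have := hne j
    field_simp
    ring
  · intro i _ hij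
    simp [hij.symm]
  · simp

theorem box_edge_mem_RT0 {a b : Fin d → ℝ} (h : ∀ i, a i < b i) (i : Fin d) (σ : Bool) :
    (fun x => boxFacet a b (i, !σ) x • boxEdge a b (i, σ)) ∈ (Cell.box a b h).RT0 := by
  have hne : b i - a i ≠ 0 := sub_ne_zero.2 (h i).ne'
  cases σ
  · refine ⟨fun j => if j = i then - b i else 0, fun j => if j = i then 1 else 0, fun x j => ?_⟩
    by_cases hj : j = i
    · subst hj
      simp [boxFacet_true, boxEdge]
      field_simp; ring
    · simp [boxFacet_true, boxEdge, hj]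
  · refine ⟨fun j => if j = i then - a i else 0, fun j => if j = i then 1 else 0, fun x j => ?_⟩
    by_cases hj : j = i
    · subst hj
      simp [boxFacet_false, boxEdge]
      field_simp; ring
    · simp [boxFacet_false, boxEdge, hj]

end Box

/-! ### Common description of both kinds of cells -/

/-- Every cell is cut out by affine inequalities, and `RT₀` has a basis dual to the faces. -/
theorem Cell.exists_facetSystem {d : ℕ} (hd : 0 < d) (K : Cell d) :
    ∃ (ι : Type) (_ : Fintype ι) (ℓ : ι → Pt d →ᵃ[ℝ] ℝ) (X : ι → Pt d → Pt d),
      IsFacetSystem K ℓ ∧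
      (∀ i, X i ∈ K.RT0 ∧ ∃ δ h : ℝ, 0 < h ∧
        FluxThroughFace K {x | x ∈ K.carrier ∧ ℓ i x = 0} (X i) δ h) ∧
      ∀ χ ∈ K.RT0, ∃ w : ι → ℝ, ∀ x, χ x = ∑ i, w i • X i x := by
  cases K with
  | simplex s =>
    refine ⟨Fin (d + 1), inferInstance, fun i => (simplexBasis s).coord i,
      fun i x => x - s.points i, simplex_isFacetSystem hd s, fun i => ⟨?_, ?_⟩,
      fun χ hχ => simplex_RT0_span s hχ⟩
    · exact ⟨-s.points i, 1, fun x => by module⟩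
    · obtain ⟨h, hh, hf⟩ := simplex_flux hd s i
      exact ⟨d, h, hh, hf⟩
  | box a b h =>
    refine ⟨Fin d × Bool, inferInstance, boxFacet a b,
      fun q x => boxFacet a b (q.1, !q.2) x • boxEdge a b q, box_isFacetSystem h,
      fun q => ⟨box_edge_mem_RT0 h q.1 q.2, ?_⟩, fun χ hχ => box_RT0_span h hχ⟩
    obtain ⟨t, ht, hf⟩ := box_flux hd h q.1 q.2
    exact ⟨1, t, ht, hf⟩

/-- The inf-sup argument tests with multiples of the position vector. -/
theorem Cell.id_mem_RT0 {d : ℕ} (K : Cell d) : (fun x : Pt d => x) ∈ K.RT0 := by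
  cases K with
  | simplex s => exact ⟨0, 1, fun x => by simp⟩
  | box a b h => exact ⟨0, fun _ => 1, fun x i => by simp⟩

theorem Cell.continuous_of_mem_RT0 {d : ℕ} {K : Cell d} {χ : Pt d → Pt d} (hχ : χ ∈ K.RT0) :
    Continuous χ := by
  cases K with
  | simplex s =>
    obtain ⟨a, c, h⟩ := hχ
    rw [funext h]; fun_prop
  | box a b h' =>
    obtain ⟨a, c, h⟩ := hχ
    have : χ = fun x => WithLp.toLp 2 (fun i => a i + c i * x i) := by
      funext x; ext i; exact h x i
    rw [this]; fun_prop

/-! ### Interior, boundary and surface measure of a cell -/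

section FacetSystem

variable {d : ℕ} {K : Cell d} {ι : Type} {ℓ : ι → Pt d →ᵃ[ℝ] ℝ}

theorem IsFacetSystem.dom_eq [Finite ι] (h : IsFacetSystem K ℓ) : K.dom = {x | ∀ i, 0 < ℓ i x} := by
  have hc : ∀ i, Continuous (ℓ i) := fun i => (ℓ i).continuous_of_finiteDimensional
  rw [Cell.dom, h.carrier_eq]
  apply subset_antisymm
  · intro x hx i
    obtain ⟨y, hy⟩ := h.exists_interior
    have h0 : 0 ≤ ℓ i x := interior_subset hx i
    refine lt_of_le_of_ne h0 (fun h0 => ?_)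
    have hcont : Continuous (fun t : ℝ => x + t • (y - x)) := by fun_prop
    have hmem : ∀ᶠ t : ℝ in nhds 0, x + t • (y - x) ∈ interior {x | ∀ i, 0 ≤ ℓ i x} :=
      hcont.continuousAt (isOpen_interior.mem_nhds (by simpa using hx))
    obtain ⟨ε, hε, hball⟩ := Metric.eventually_nhds_iff.1 hmem
    -- A small step away from the interior point `y` makes `ℓ i` negative, although it stays in the
    -- cell.
    have h1 := interior_subset (hball (y := -(ε / 2)) (by
      rw [Real.dist_eq, sub_zero, abs_neg, abs_of_pos (by positivity)]; linarith)) i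
    rw [affine_apply_line, ← h0] at h1
    have := hy i
    nlinarith
  · refine interior_maximal (fun x hx i => (hx i).le) ?_
    rw [show {x | ∀ i, 0 < ℓ i x} = ⋂ i, {x | 0 < ℓ i x} by ext; simp]
    exact isOpen_iInter_of_finite fun i => isOpen_lt continuous_const (hc i)

theorem IsFacetSystem.frontier_eq [Finite ι] (h : IsFacetSystem K ℓ) :
    frontier K.dom = ⋃ i, {x | x ∈ K.carrier ∧ ℓ i x = 0} := by
  have hne : (interior K.carrier).Nonempty := by
    obtain ⟨y, hy⟩ := h.exists_interior
    exact ⟨y, by change y ∈ K.dom; rw [h.dom_eq]; exact hy⟩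
  have h1 : frontier K.dom = K.carrier \ K.dom := by
    rw [frontier, Cell.dom, interior_interior,
      K.convex_carrier.closure_interior_eq_closure_of_nonempty_interior hne,
      K.isCompact_carrier.isClosed.closure_eq]
  rw [h1, h.dom_eq]
  ext x
  simp only [mem_sdiff, mem_ofPred_eq, not_forall, not_lt, mem_iUnion]
  constructor
  · rintro ⟨hx, i, hi⟩
    refine ⟨i, hx, le_antisymm hi ?_⟩
    rw [h.carrier_eq] at hx
    exact hx i
  · rintro ⟨i, hx, hi⟩
    exact ⟨hx, i, hi.le⟩

theorem IsFacetSystem.exists_chart (hd : 0 < d) (h : IsFacetSystem K ℓ) (i : ι) :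
    ∃ (B : Pt (d - 1) →ₗᵢ[ℝ] Pt d) (p : Pt d), {x | ℓ i x = 0} = range (fun z => p + B z) := by
  obtain ⟨y, hy⟩ := h.exists_interior
  obtain ⟨p, hp, -⟩ := h.exists_regular i
  have hlin : ∀ x, (ℓ i).linear (x - p) = ℓ i x := fun x => by
    have := (ℓ i).linearMap_vsub x p
    simp only [vsub_eq_sub] at this
    rw [this, hp, sub_zero]
  obtain ⟨B, -, hB, -⟩ := exists_hyperplane_chart hd (ℓ i).linear (y - p)
    (by rw [hlin]; exact (hy i).ne')
  refine ⟨B, p, ?_⟩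
  ext x
  rw [mem_ofPred_eq, ← hlin, ← hB]
  constructor
  · rintro ⟨z, hz⟩; exact ⟨z, by simp [hz]⟩
  · rintro ⟨z, rfl⟩; exact ⟨z, by simp⟩

theorem isCompact_carrier_inter (K : Cell d) (ℓ : Pt d →ᵃ[ℝ] ℝ) :
    IsCompact {x | x ∈ K.carrier ∧ ℓ x = 0} :=
  K.isCompact_carrier.inter_right
    (isClosed_singleton.preimage ℓ.continuous_of_finiteDimensional)

theorem IsFacetSystem.hausdorff_face_lt_top (hd : 0 < d) (h : IsFacetSystem K ℓ) (i : ι) :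
    μHE[d - 1] {x | x ∈ K.carrier ∧ ℓ i x = 0} < ⊤ := by
  obtain ⟨B, p, hr⟩ := h.exists_chart hd i
  rw [hausdorff_apply_of_chart B p (by rw [← hr]; exact fun x hx => hx.2)]
  exact (isCompact_preimage_chart B p (isCompact_carrier_inter K (ℓ i))).measure_lt_top

/-- A short step from `x` towards the regular point of the face stays in `V` and makes all other
inequalities strict. Near the point reached, the face fills its hyperplane and so contains a
nonempty relatively open set. -/
theorem IsFacetSystem.hausdorff_face_pos [Finite ι] (hd : 0 < d) (h : IsFacetSystem K ℓ) (i : ι)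
    {x : Pt d} (hx : x ∈ K.carrier) (hxi : ℓ i x = 0) {V : Set (Pt d)} (hV : IsOpen V)
    (hxV : x ∈ V) : 0 < μHE[d - 1] ({x | x ∈ K.carrier ∧ ℓ i x = 0} ∩ V) := by
  obtain ⟨B, p, hr⟩ := h.exists_chart hd i
  have hBc := B.continuous
  rw [hausdorff_apply_of_chart B p (by rw [← hr]; exact fun x hx => hx.1.2)]
  obtain ⟨y, hyi, hy⟩ := h.exists_regular i
  have hcont : Continuous (fun t : ℝ => x + t • (y - x)) := by fun_prop
  have hmem : ∀ᶠ t : ℝ in nhds 0, x + t • (y - x) ∈ V :=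
    hcont.continuousAt (hV.mem_nhds (by simpa using hxV))
  obtain ⟨ε, hε, hball⟩ := Metric.eventually_nhds_iff.1 hmem
  set t : ℝ := min (ε / 2) (1 / 2) with ht
  have ht0 : 0 < t := by positivity
  have ht1 : t ≤ 1 / 2 := min_le_right _ _
  have hte : t < ε := (min_le_left _ _).trans_lt (by linarith)
  have hw : x + t • (y - x) ∈ V := hball (by rw [Real.dist_eq, sub_zero, abs_of_pos ht0]; exact hte)
  rw [h.carrier_eq] at hx
  have hwi : ℓ i (x + t • (y - x)) = 0 := by rw [affine_apply_line, hxi, hyi]; simp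
  have hwj : ∀ j, j ≠ i → 0 < ℓ j (x + t • (y - x)) := fun j hj => by
    rw [affine_apply_line]
    have h1 := hx j
    have h2 := hy j hj
    have : 0 < t * ℓ j y := mul_pos ht0 h2
    nlinarith
  have hwr : x + t • (y - x) ∈ range (fun z => p + B z) := by rw [← hr]; exact hwi
  obtain ⟨z, hz⟩ := hwr
  have hopen : IsOpen ((fun z => p + B z) ⁻¹' (V ∩ ⋂ j, {x | j ≠ i → 0 < ℓ j x})) := by
    refine IsOpen.preimage (by fun_prop) (hV.inter (isOpen_iInter_of_finite fun j => ?_))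
    by_cases hj : j = i
    · simp [hj]
    · simpa [hj] using isOpen_lt continuous_const (ℓ j).continuous_of_finiteDimensional
  refine (hopen.measure_pos volume ⟨z, ?_⟩).trans_le (measure_mono ?_)
  · simp only [mem_preimage, hz]
    exact ⟨hw, mem_iInter.2 hwj⟩
  · rintro z' ⟨hz'V, hz'⟩
    have h0 : ℓ i (p + B z') = 0 := by
      have : p + B z' ∈ {x | ℓ i x = 0} := by rw [hr]; exact ⟨z', rfl⟩
      exact this
    refine ⟨⟨?_, h0⟩, hz'V⟩
    rw [h.carrier_eq]
    intro j
    by_cases hj : j = i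
    · rw [hj]; exact h0.ge
    · exact (mem_iInter.1 hz' j hj).le

end FacetSystem

/-! ### Faces and measures of cells, independent of the kind -/

namespace Cell

variable {d : ℕ}

theorem finite_faces (K : Cell d) : K.faces.Finite := by
  cases K with
  | simplex s =>
    refine (finite_range fun i => convexHull ℝ (s.points '' {i}ᶜ)).subset ?_
    rintro e ⟨i, rfl⟩; exact ⟨i, rfl⟩
  | box a b h =>
    refine ((finite_range fun i => {x | x ∈ (box a b h).carrier ∧ x i = a i}).union
      (finite_range fun i => {x | x ∈ (box a b h).carrier ∧ x i = b i})).subset ?_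
    rintro e ⟨i, rfl | rfl⟩
    · exact Or.inl ⟨i, rfl⟩
    · exact Or.inr ⟨i, rfl⟩

/-- The faces of a cell as a finite set. -/
def faceSet (K : Cell d) : Finset (Set (Pt d)) := K.finite_faces.toFinset

theorem mem_faceSet {K : Cell d} {e : Set (Pt d)} : e ∈ K.faceSet ↔ e ∈ K.faces := by
  simp [faceSet]

theorem isOpen_dom (K : Cell d) : IsOpen K.dom := isOpen_interior

theorem convex_dom (K : Cell d) : Convex ℝ K.dom := K.convex_carrier.interior

theorem dom_subset (K : Cell d) : K.dom ⊆ K.carrier := interior_subset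

theorem carrier_ae_eq_dom (K : Cell d) : K.carrier =ᵐ[volume] K.dom := by
  have h := K.convex_carrier.addHaar_frontier (volume : Measure (Pt d))
  rw [frontier, K.isCompact_carrier.isClosed.closure_eq] at h
  refine (ae_le_set.2 h).antisymm ?_
  exact K.dom_subset.eventuallyLE

theorem dom_nonempty (hd : 0 < d) (K : Cell d) : K.dom.Nonempty := by
  obtain ⟨ι, _, ℓ, X, h, -⟩ := K.exists_facetSystem hd
  obtain ⟨y, hy⟩ := h.exists_interior
  exact ⟨y, by rw [h.dom_eq]; exact hy⟩

theorem closure_dom (hd : 0 < d) (K : Cell d) : closure K.dom = K.carrier := by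
  rw [dom, K.convex_carrier.closure_interior_eq_closure_of_nonempty_interior
    (K.dom_nonempty hd), K.isCompact_carrier.isClosed.closure_eq]

theorem volume_dom_lt_top (K : Cell d) : volume K.dom < ⊤ :=
  (measure_mono K.dom_subset).trans_lt K.isCompact_carrier.measure_lt_top

theorem volume_dom_pos (hd : 0 < d) (K : Cell d) : 0 < volume K.dom :=
  K.isOpen_dom.measure_pos volume (K.dom_nonempty hd)

instance (K : Cell d) : IsFiniteMeasure ((volume : Measure (Pt d)).restrict K.dom) :=
  ⟨by rw [restrict_apply_univ]; exact K.volume_dom_lt_top⟩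

theorem frontier_dom (hd : 0 < d) (K : Cell d) : frontier K.dom = ⋃ e ∈ K.faceSet, e := by
  obtain ⟨ι, _, ℓ, X, h, -⟩ := K.exists_facetSystem hd
  rw [h.frontier_eq]
  ext x
  simp only [mem_iUnion, mem_faceSet, h.faces_eq]
  constructor
  · rintro ⟨i, hi⟩; exact ⟨_, ⟨i, rfl⟩, hi⟩
  · rintro ⟨_, ⟨i, rfl⟩, hi⟩; exact ⟨i, hi⟩

theorem isCompact_face (hd : 0 < d) {K : Cell d} {e : Set (Pt d)} (he : e ∈ K.faces) :
    IsCompact e := by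
  obtain ⟨ι, _, ℓ, X, h, -⟩ := K.exists_facetSystem hd
  rw [h.faces_eq] at he
  obtain ⟨i, rfl⟩ := he
  exact isCompact_carrier_inter K (ℓ i)

theorem hausdorff_face_lt_top (hd : 0 < d) {K : Cell d} {e : Set (Pt d)} (he : e ∈ K.faces) :
    μHE[d - 1] e < ⊤ := by
  obtain ⟨ι, _, ℓ, X, h, -⟩ := K.exists_facetSystem hd
  rw [h.faces_eq] at he
  obtain ⟨i, rfl⟩ := he
  exact h.hausdorff_face_lt_top hd i

theorem hausdorff_face_inter_pos (hd : 0 < d) {K : Cell d} {e : Set (Pt d)} (he : e ∈ K.faces)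
    {x : Pt d} (hx : x ∈ e) {V : Set (Pt d)} (hV : IsOpen V) (hxV : x ∈ V) :
    0 < μHE[d - 1] (e ∩ V) := by
  obtain ⟨ι, _, ℓ, X, h, -⟩ := K.exists_facetSystem hd
  rw [h.faces_eq] at he
  obtain ⟨i, rfl⟩ := he
  exact h.hausdorff_face_pos hd i hx.1 hx.2 hV hxV

theorem face_nonempty (hd : 0 < d) {K : Cell d} {e : Set (Pt d)} (he : e ∈ K.faces) :
    e.Nonempty := by
  obtain ⟨ι, _, ℓ, X, h, -⟩ := K.exists_facetSystem hd
  rw [h.faces_eq] at he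
  obtain ⟨i, rfl⟩ := he
  obtain ⟨y, hyi, hy⟩ := h.exists_regular i
  refine ⟨y, ?_, hyi⟩
  rw [h.carrier_eq]
  intro j
  by_cases hj : j = i
  · rw [hj]; exact hyi.ge
  · exact (hy j hj).le

theorem face_subset_frontier (hd : 0 < d) {K : Cell d} {e : Set (Pt d)} (he : e ∈ K.faces) :
    e ⊆ frontier K.dom := by
  rw [K.frontier_dom hd]
  exact subset_biUnion_of_mem (u := fun e => e) (mem_faceSet.2 he)

theorem face_subset_carrier (hd : 0 < d) {K : Cell d} {e : Set (Pt d)} (he : e ∈ K.faces) :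
    e ⊆ K.carrier := by
  rw [← K.closure_dom hd]
  exact (face_subset_frontier hd he).trans frontier_subset_closure

theorem hausdorff_frontier_lt_top (hd : 0 < d) (K : Cell d) :
    μHE[d - 1] (frontier K.dom) < ⊤ := by
  rw [K.frontier_dom hd]
  exact (measure_biUnion_lt_top K.faceSet.finite_toSet
    (fun e he => hausdorff_face_lt_top hd (mem_faceSet.1 he)))

end Cell

/-! ### Square-integrability and test functions -/

section Integrability

variable {d : ℕ} {μ : Measure (Pt d)}

theorem integrable_inner_of_memLp {u v : Pt d → Pt d} (hu : MemLp u 2 μ) (hv : MemLp v 2 μ) :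
    Integrable (fun x => inner ℝ (u x) (v x)) μ := by
  refine (L2.integrable_inner (𝕜 := ℝ) hu.toLp hv.toLp).congr ?_
  filter_upwards [hu.coeFn_toLp, hv.coeFn_toLp] with x h1 h2
  rw [h1, h2]

theorem integrable_mul_of_memLp {u v : Pt d → ℝ} (hu : MemLp u 2 μ) (hv : MemLp v 2 μ) :
    Integrable (fun x => u x * v x) μ :=
  hu.integrable_mul hv

theorem memLp_of_continuous_of_hasCompactSupport {F : Type*} [NormedAddCommGroup F]
    [IsFiniteMeasureOnCompacts μ] {φ : Pt d → F} (hφ : Continuous φ)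
    (hc : HasCompactSupport φ) : MemLp φ 2 μ :=
  hφ.memLp_of_hasCompactSupport hc

theorem hasCompactSupport_gradient {φ : Pt d → ℝ} (hc : HasCompactSupport φ) :
    HasCompactSupport (gradient φ) := by
  have h : HasCompactSupport (fderiv ℝ φ) := hc.fderiv ℝ
  exact h.comp_left (g := (InnerProductSpace.toDual ℝ (Pt d)).symm) (map_zero _)

theorem memLp_gradient [IsFiniteMeasureOnCompacts μ] {φ : Pt d → ℝ} (hφ : ContDiff ℝ ∞ φ)
    (hc : HasCompactSupport φ) : MemLp (gradient φ) 2 μ :=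
  memLp_of_continuous_of_hasCompactSupport (continuous_gradient hφ)
    (hasCompactSupport_gradient hc)

theorem memLp_test [IsFiniteMeasureOnCompacts μ] {φ : Pt d → ℝ} (hφ : ContDiff ℝ ∞ φ)
    (hc : HasCompactSupport φ) : MemLp φ 2 μ :=
  memLp_of_continuous_of_hasCompactSupport hφ.continuous hc

/-- A smooth cutoff function that equals one on a neighbourhood of a compact set. -/
theorem exists_cutoff {s : Set (Pt d)} (hs : IsCompact s) :
    ∃ φ : Pt d → ℝ, ContDiff ℝ ∞ φ ∧ HasCompactSupport φ ∧
      ∀ x ∈ s, φ x = 1 ∧ gradient φ x = 0 := by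
  obtain ⟨R, hR⟩ := hs.isBounded.subset_ball (0 : Pt d)
  let f : ContDiffBump (0 : Pt d) := ⟨max R 1, max R 1 + 1, by positivity, by linarith⟩
  refine ⟨f, f.contDiff, f.hasCompactSupport, fun x hx => ?_⟩
  have hx' : x ∈ Metric.ball (0 : Pt d) (max R 1) :=
    Metric.ball_subset_ball (le_max_left _ _) (hR hx)
  refine ⟨f.one_of_mem_closedBall (Metric.ball_subset_closedBall hx'), ?_⟩
  have : (f : Pt d → ℝ) =ᶠ[nhds x] fun _ => 1 := by
    filter_upwards [Metric.isOpen_ball.mem_nhds hx'] with y hy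
    exact f.one_of_mem_closedBall (Metric.ball_subset_closedBall hy)
  rw [gradient, this.fderiv_eq]
  simp

end Integrability

/-! ### Weak divergence -/

section WeakDiv

variable {d : ℕ} {U : Set (Pt d)}

/-- The fundamental lemma of the calculus of variations. It makes `weakDiv`, which is defined by
choice, computable from any candidate. -/
theorem HasWeakDiv.unique (hU : IsOpen U) {v : Pt d → Pt d} {g g' : L2 U}
    (h : HasWeakDiv U v g) (h' : HasWeakDiv U v g') : g = g' := by
  have hmem : MemLp (fun x => g x - g' x) 2 ((volume : Measure (Pt d)).restrict U) :=
    (Lp.memLp g).sub (Lp.memLp g')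
  have hloc : LocallyIntegrable (fun x => g x - g' x) ((volume : Measure (Pt d)).restrict U) :=
    hmem.locallyIntegrable (by norm_num)
  have := hU.ae_eq_zero_of_integral_contDiff_smul_eq_zero
    (hloc.locallyIntegrableOn U) (fun φ hφ hc hsub => ?_)
  · apply Lp.ext
    filter_upwards [this, ae_restrict_mem hU.measurableSet] with x hx hxU
    exact sub_eq_zero.1 (hx hxU)
  · have h1 := h φ hφ hc hsub
    have h2 := h' φ hφ hc hsub
    rw [h1, neg_inj] at h2
    have e : ∀ x, φ x • (g x - g' x) = g x * φ x - g' x * φ x := fun x => by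
      rw [smul_eq_mul]; ring
    simp only [e]
    rw [integral_sub (integrable_mul_of_memLp (Lp.memLp g) (memLp_test hφ hc))
      (integrable_mul_of_memLp (Lp.memLp g') (memLp_test hφ hc)), h2, sub_self]

theorem HasWeakDiv.weakDiv_eq (hU : IsOpen U) {v : Pt d → Pt d} {g : L2 U}
    (h : HasWeakDiv U v g) : weakDiv U v = g := by
  have hex : ∃ g : L2 U, HasWeakDiv U v g := ⟨g, h⟩
  rw [weakDiv, dif_pos hex]
  exact hex.choose_spec.unique hU h

theorem MemHDiv.hasWeakDiv {v : Pt d → Pt d} (h : MemHDiv U v) :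
    HasWeakDiv U v (weakDiv U v) := by
  rw [weakDiv, dif_pos h.2]
  exact h.2.choose_spec

theorem HasWeakDiv.smul_add {v w : Pt d → Pt d} {g g' : L2 U}
    (hv : MemLp v 2 (volume.restrict U)) (hw : MemLp w 2 (volume.restrict U))
    (h : HasWeakDiv U v g) (h' : HasWeakDiv U w g') (a : ℝ) :
    HasWeakDiv U (fun x => a • v x + w x) (a • g + g') := by
  intro φ hφ hc hsub
  have e1 : ∫ x in U, inner ℝ (a • v x + w x) (gradient φ x)
      = a * (∫ x in U, inner ℝ (v x) (gradient φ x)) + ∫ x in U, inner ℝ (w x) (gradient φ x) := by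
    rw [← integral_const_mul, ← integral_add
      ((integrable_inner_of_memLp hv (memLp_gradient hφ hc)).const_mul a)
      (integrable_inner_of_memLp hw (memLp_gradient hφ hc))]
    simp only [inner_add_left, real_inner_smul_left]
  have e2 : ∫ x in U, (a • g + g' : L2 U) x * φ x
      = a * (∫ x in U, g x * φ x) + ∫ x in U, g' x * φ x := by
    rw [← integral_const_mul, ← integral_add
      ((integrable_mul_of_memLp (Lp.memLp g) (memLp_test hφ hc)).const_mul a)
      (integrable_mul_of_memLp (Lp.memLp g') (memLp_test hφ hc))]
    refine integral_congr_ae ?_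
    filter_upwards [Lp.coeFn_add (a • g) g', Lp.coeFn_smul a g] with x h1 h2
    rw [h1, Pi.add_apply, h2, Pi.smul_apply, smul_eq_mul]
    ring
  rw [e1, e2, h φ hφ hc hsub, h' φ hφ hc hsub]
  ring

/-- `g` is the divergence of `v`, and the normal component of `v` vanishes on `∂U`. -/
def HasWeakDiv0 (U : Set (Pt d)) (v : Pt d → Pt d) (g : L2 U) : Prop :=
  ∀ φ : Pt d → ℝ, ContDiff ℝ ∞ φ → HasCompactSupport φ →
    (∫ x in U, inner ℝ (v x) (gradient φ x)) + (∫ x in U, g x * φ x) = 0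

theorem HasWeakDiv0.hasWeakDiv {v : Pt d → Pt d} {g : L2 U} (h : HasWeakDiv0 U v g) :
    HasWeakDiv U v g := fun φ hφ hc _ => by
  have := h φ hφ hc
  linarith

theorem HasWeakDiv0.memH0Div (hU : IsOpen U) {v : Pt d → Pt d} {g : L2 U}
    (hv : MemLp v 2 (volume.restrict U)) (h : HasWeakDiv0 U v g) : MemH0Div U v := by
  refine ⟨⟨hv, g, h.hasWeakDiv⟩, ?_⟩
  rw [h.hasWeakDiv.weakDiv_eq hU]
  exact h

theorem MemH0Div.hasWeakDiv0 {v : Pt d → Pt d} (h : MemH0Div U v) :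
    HasWeakDiv0 U v (weakDiv U v) := h.2

end WeakDiv

/-! ### Fields with constant divergence and constant face fluxes -/

section Flux

variable {d : ℕ} {K : Cell d}

/-- `v` has the constant divergence `δ` on `K` and the constant normal flux `c e` on each face
`e` of `K`. -/
def HasFlux (K : Cell d) (v : Pt d → Pt d) (δ : ℝ) (c : Set (Pt d) → ℝ) : Prop :=
  MemLp v 2 (volume.restrict K.dom) ∧
    ∀ φ : Pt d → ℝ, ContDiff ℝ ∞ φ → HasCompactSupport φ →
      (∫ x in K.dom, inner ℝ (v x) (gradient φ x)) + δ * ∫ x in K.dom, φ x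
        = ∑ e ∈ K.faceSet, c e * ∫ x in e, φ x ∂μHE[d - 1]

theorem HasFlux.congr {v w : Pt d → Pt d} {δ : ℝ} {c : Set (Pt d) → ℝ} (h : HasFlux K v δ c)
    (hvw : v =ᵐ[volume.restrict K.dom] w) : HasFlux K w δ c := by
  refine ⟨(memLp_congr_ae hvw).1 h.1, fun φ hφ hc => ?_⟩
  rw [← h.2 φ hφ hc]
  congr 1
  refine integral_congr_ae ?_
  filter_upwards [hvw] with x hx
  rw [hx]

theorem HasFlux.smul_add {v w : Pt d → Pt d} {δ δ' : ℝ} {c c' : Set (Pt d) → ℝ}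
    (h : HasFlux K v δ c) (h' : HasFlux K w δ' c') (a : ℝ) :
    HasFlux K (fun x => a • v x + w x) (a * δ + δ') (fun e => a * c e + c' e) := by
  refine ⟨(h.1.const_smul a).add h'.1, fun φ hφ hc => ?_⟩
  have e1 : ∫ x in K.dom, inner ℝ (a • v x + w x) (gradient φ x)
      = a * (∫ x in K.dom, inner ℝ (v x) (gradient φ x))
        + ∫ x in K.dom, inner ℝ (w x) (gradient φ x) := by
    rw [← integral_const_mul, ← integral_add
      ((integrable_inner_of_memLp h.1 (memLp_gradient hφ hc)).const_mul a)
      (integrable_inner_of_memLp h'.1 (memLp_gradient hφ hc))]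
    simp only [inner_add_left, real_inner_smul_left]
  have h1 := h.2 φ hφ hc
  have h2 := h'.2 φ hφ hc
  simp only [add_mul, mul_assoc, Finset.sum_add_distrib, ← Finset.mul_sum]
  rw [e1, ← h1, ← h2]
  ring

theorem hasFlux_zero : HasFlux K (fun _ => 0) 0 (fun _ => 0) := by
  refine ⟨MemLp.zero, fun φ _ _ => by simp⟩

theorem HasFlux.smul {v : Pt d → Pt d} {δ : ℝ} {c : Set (Pt d) → ℝ} (h : HasFlux K v δ c)
    (a : ℝ) : HasFlux K (fun x => a • v x) (a * δ) (fun e => a * c e) := by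
  simpa using h.smul_add hasFlux_zero a

theorem HasFlux.sum {ι : Type*} (s : Finset ι) {v : ι → Pt d → Pt d} {δ : ι → ℝ}
    {c : ι → Set (Pt d) → ℝ} (h : ∀ i, HasFlux K (v i) (δ i) (c i)) (w : ι → ℝ) :
    HasFlux K (fun x => ∑ i ∈ s, w i • v i x) (∑ i ∈ s, w i * δ i)
      (fun e => ∑ i ∈ s, w i * c i e) := by
  classical
  induction s using Finset.induction_on with
  | empty => simpa using hasFlux_zero
  | insert a s ha ih => simpa only [Finset.sum_insert ha] using (h a).smul_add ih (w a)

open Classical in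
theorem FluxThroughFace.hasFlux {e : Set (Pt d)} (he : e ∈ K.faces) {χ : Pt d → Pt d}
    (hχ : Continuous χ) {δ h : ℝ} (hf : FluxThroughFace K e χ δ h) :
    HasFlux K χ δ (Pi.single e h) := by
  refine ⟨?_, fun φ hφ _ => ?_⟩
  · obtain ⟨C, hC⟩ := K.isCompact_carrier.exists_bound_of_continuousOn hχ.continuousOn
    refine MemLp.of_bound hχ.aestronglyMeasurable C ?_
    filter_upwards [ae_restrict_mem K.isOpen_dom.measurableSet] with x hx
    exact hC x (K.dom_subset hx)
  · have := hf φ hφ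
    rw [setIntegral_congr_set K.carrier_ae_eq_dom,
      setIntegral_congr_set K.carrier_ae_eq_dom] at this
    rw [this, Finset.sum_eq_single e]
    · simp
    · intro e' _ hne; simp [hne]
    · intro h'; exact absurd (Cell.mem_faceSet.2 he) h'

theorem exists_hasFlux_of_mem_RT0 (hd : 0 < d) {χ : Pt d → Pt d} (hχ : χ ∈ K.RT0) :
    ∃ δ c, HasFlux K χ δ c := by
  classical
  obtain ⟨ι, _, ℓ, X, hF, hX, hspan⟩ := K.exists_facetSystem hd
  obtain ⟨w, hw⟩ := hspan χ hχ
  choose hR δ h hpos hf using hX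
  have hi : ∀ i, HasFlux K (X i) (δ i) (Pi.single {x | x ∈ K.carrier ∧ ℓ i x = 0} (h i)) :=
    fun i => (hf i).hasFlux (by rw [hF.faces_eq]; exact ⟨i, rfl⟩)
      (Cell.continuous_of_mem_RT0 (hR i))
  have := HasFlux.sum Finset.univ hi w
  rw [← funext hw] at this
  exact ⟨_, _, this⟩

open Classical in
theorem exists_RT0_hasFlux (hd : 0 < d) {e : Set (Pt d)} (he : e ∈ K.faces) :
    ∃ χ ∈ K.RT0, ∃ δ, HasFlux K χ δ (Pi.single e 1) := by
  obtain ⟨ι, _, ℓ, X, hF, hX, -⟩ := K.exists_facetSystem hd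
  have he' := he
  rw [hF.faces_eq] at he'
  obtain ⟨i, rfl⟩ := he'
  obtain ⟨hR, δ, h, hpos, hf⟩ := hX i
  have h1 := (hf.hasFlux he (Cell.continuous_of_mem_RT0 hR)).smul h⁻¹
  refine ⟨fun x => h⁻¹ • X i x, ?_, h⁻¹ * δ, ?_⟩
  · cases K with
    | simplex s =>
      obtain ⟨a, c, hac⟩ := hR
      exact ⟨h⁻¹ • a, h⁻¹ * c, fun x => by simp only [hac]; module⟩
    | box a b hab =>
      obtain ⟨α, c, hac⟩ := hR
      refine ⟨fun j => h⁻¹ * α j, fun j => h⁻¹ * c j, fun x j => ?_⟩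
      simp only [PiLp.smul_apply, hac, smul_eq_mul]; ring
  · convert h1 using 1
    funext e'
    by_cases hee : e' = {x | x ∈ K.carrier ∧ ℓ i x = 0}
    · subst hee; simp [hpos.ne']
    · simp [hee]

/-- The piecewise constant function on the boundary of `K` with values `c e` on the faces `e`. -/
def faceFun (K : Cell d) (c : Set (Pt d) → ℝ) (x : Pt d) : ℝ :=
  ∑ e ∈ K.faceSet, e.indicator (fun _ => c e) x

theorem measurable_faceFun (hd : 0 < d) (c : Set (Pt d) → ℝ) : Measurable (faceFun K c) :=
  Finset.measurable_fun_sum _ fun _ he => measurable_const.indicator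
    (Cell.isCompact_face hd (Cell.mem_faceSet.1 he)).isClosed.measurableSet

theorem bound_faceFun (c : Set (Pt d) → ℝ) (x : Pt d) :
    ‖faceFun K c x‖ ≤ ∑ e ∈ K.faceSet, |c e| := by
  refine (norm_sum_le _ _).trans (Finset.sum_le_sum fun e _ => ?_)
  by_cases hx : x ∈ e
  · rw [indicator_of_mem hx, Real.norm_eq_abs]
  · rw [indicator_of_notMem hx, norm_zero]; exact abs_nonneg _

theorem isFiniteMeasure_surf_frontier (hd : 0 < d) (K : Cell d) :
    IsFiniteMeasure (surf (frontier K.dom)) :=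
  ⟨by rw [surf, restrict_apply_univ]; exact K.hausdorff_frontier_lt_top hd⟩

theorem memLp_faceFun (hd : 0 < d) (c : Set (Pt d) → ℝ) {μ : Measure (Pt d)} [IsFiniteMeasure μ] :
    MemLp (faceFun K c) 2 μ :=
  MemLp.of_bound (measurable_faceFun hd c).aestronglyMeasurable _
    (Filter.Eventually.of_forall (bound_faceFun c))

/-- Overlaps of faces do no harm: `faceFun` adds the values there, and so does the sum of the face
integrals. -/
theorem integral_faceFun_mul (hd : 0 < d) (c : Set (Pt d) → ℝ) {π : Pt d → ℝ}
    (hπ : Integrable π (surf (frontier K.dom))) :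
    ∫ x, faceFun K c x * π x ∂surf (frontier K.dom)
      = ∑ e ∈ K.faceSet, c e * ∫ x in e, π x ∂μHE[d - 1] := by
  have h1 : ∀ x, faceFun K c x * π x
      = ∑ e ∈ K.faceSet, e.indicator (fun x => c e * π x) x := fun x => by
    rw [faceFun, Finset.sum_mul]
    refine Finset.sum_congr rfl fun e _ => ?_
    by_cases hx : x ∈ e
    · simp [indicator_of_mem hx]
    · simp [indicator_of_notMem hx]
  simp only [h1]
  have hm : ∀ e ∈ K.faceSet, MeasurableSet e := fun e he =>
    (Cell.isCompact_face hd (Cell.mem_faceSet.1 he)).isClosed.measurableSet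
  rw [integral_finsetSum]
  · refine Finset.sum_congr rfl fun e he => ?_
    rw [integral_indicator (hm e he), integral_const_mul, surf, restrict_restrict (hm e he),
      inter_eq_left.2 (Cell.face_subset_frontier hd (Cell.mem_faceSet.1 he))]
  · intro e he
    exact (hπ.const_mul (c e)).indicator (hm e he)

theorem HasFlux.hasWeakDiv (hd : 0 < d) {v : Pt d → Pt d} {δ : ℝ} {c : Set (Pt d) → ℝ}
    (h : HasFlux K v δ c) :
    HasWeakDiv K.dom v ((memLp_const δ : MemLp (fun _ => δ) 2 (volume.restrict K.dom)).toLp) := by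
  intro φ hφ hc hsub
  have h1 := h.2 φ hφ hc
  -- A test function supported in the open cell vanishes on the boundary.
  have h2 : ∑ e ∈ K.faceSet, c e * ∫ x in e, φ x ∂μHE[d - 1] = 0 := by
    refine Finset.sum_eq_zero fun e he => ?_
    have : ∫ x in e, φ x ∂μHE[d - 1] = ∫ x in e, 0 ∂μHE[d - 1] := by
      refine setIntegral_congr_fun
        (Cell.isCompact_face hd (Cell.mem_faceSet.1 he)).isClosed.measurableSet fun x hx => ?_
      refine image_eq_zero_of_notMem_tsupport fun hx' => ?_
      have hfr := Cell.face_subset_frontier hd (Cell.mem_faceSet.1 he) hx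
      rw [K.isOpen_dom.frontier_eq] at hfr
      exact hfr.2 (hsub hx')
    rw [this]; simp
  have h3 : ∫ x in K.dom, (MemLp.toLp _ (memLp_const δ :
      MemLp (fun _ => δ) 2 (volume.restrict K.dom))) x * φ x = δ * ∫ x in K.dom, φ x := by
    rw [← integral_const_mul]
    refine integral_congr_ae ?_
    filter_upwards [(memLp_const δ : MemLp (fun _ => δ) 2 (volume.restrict K.dom)).coeFn_toLp]
      with x hx
    rw [hx]
  rw [h3]
  linarith

theorem HasFlux.memHDiv (hd : 0 < d) {v : Pt d → Pt d} {δ : ℝ} {c : Set (Pt d) → ℝ}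
    (h : HasFlux K v δ c) : MemHDiv K.dom v := ⟨h.1, _, h.hasWeakDiv hd⟩

theorem HasFlux.weakDiv_ae (hd : 0 < d) {v : Pt d → Pt d} {δ : ℝ} {c : Set (Pt d) → ℝ}
    (h : HasFlux K v δ c) : weakDiv K.dom v =ᵐ[volume.restrict K.dom] fun _ => δ := by
  rw [(h.hasWeakDiv hd).weakDiv_eq K.isOpen_dom]
  exact (memLp_const δ : MemLp (fun _ => δ) 2 (volume.restrict K.dom)).coeFn_toLp

theorem IsNormalTrace.unique (hd : 0 < d) {v : Pt d → Pt d}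
    {γ γ' : Lp ℝ 2 (surf (frontier K.dom))} (h : IsNormalTrace K.dom v γ)
    (h' : IsNormalTrace K.dom v γ') : γ = γ' := by
  have := isFiniteMeasure_surf_frontier hd K
  have hmem : MemLp (fun x => γ x - γ' x) 2 (surf (frontier K.dom)) :=
    (Lp.memLp γ).sub (Lp.memLp γ')
  have hz := ae_eq_zero_of_integral_contDiff_smul_eq_zero
    (hmem.locallyIntegrable (by norm_num)) (fun φ hφ hc => ?_)
  · apply Lp.ext
    filter_upwards [hz] with x hx
    exact sub_eq_zero.1 hx
  · have h1 := h.2 φ hφ hc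
    have h2 := h'.2 φ hφ hc
    rw [h1] at h2
    have e : ∀ x, φ x • (γ x - γ' x) = γ x * φ x - γ' x * φ x := fun x => by
      rw [smul_eq_mul]; ring
    simp only [e]
    rw [integral_sub (integrable_mul_of_memLp (Lp.memLp γ) (memLp_test hφ hc))
      (integrable_mul_of_memLp (Lp.memLp γ') (memLp_test hφ hc)), h2, sub_self]

/-- The face sum in `HasFlux` is the boundary integral against `faceFun`, which is therefore a
normal trace; uniqueness identifies it with the chosen one. -/
theorem HasFlux.normalTrace_ae (hd : 0 < d) {v : Pt d → Pt d} {δ : ℝ} {c : Set (Pt d) → ℝ}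
    (h : HasFlux K v δ c) : normalTrace K.dom v =ᵐ[surf (frontier K.dom)] faceFun K c := by
  have := isFiniteMeasure_surf_frontier hd K
  have hm : MemLp (faceFun K c) 2 (surf (frontier K.dom)) := memLp_faceFun hd c
  have hγ : IsNormalTrace K.dom v hm.toLp := by
    refine ⟨h.memHDiv hd, fun φ hφ hc => ?_⟩
    have e1 : ∫ x, (MemLp.toLp _ hm) x * φ x ∂surf (frontier K.dom)
        = ∑ e ∈ K.faceSet, c e * ∫ x in e, φ x ∂μHE[d - 1] := by
      rw [← integral_faceFun_mul hd c
        ((memLp_test (μ := surf (frontier K.dom)) hφ hc).integrable (by norm_num))]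
      refine integral_congr_ae ?_
      filter_upwards [hm.coeFn_toLp] with x hx
      rw [hx]
    have e2 : ∫ x in K.dom, weakDiv K.dom v x * φ x = δ * ∫ x in K.dom, φ x := by
      rw [← integral_const_mul]
      refine integral_congr_ae ?_
      filter_upwards [h.weakDiv_ae hd] with x hx
      rw [hx]
    rw [e1, e2]
    exact h.2 φ hφ hc
  have hex : ∃ γ, IsNormalTrace K.dom v γ := ⟨_, hγ⟩
  have : normalTrace K.dom v = hm.toLp := by
    rw [normalTrace, dif_pos hex]
    exact hex.choose_spec.unique hd hγ
  rw [this]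
  exact hm.coeFn_toLp

end Flux

/-! ### The Poincaré inequality on convex sets -/

section Poincare

variable {d : ℕ} {U : Set (Pt d)}

/-- The variance of `g` is nonnegative. -/
theorem sq_intervalIntegral_le {g : ℝ → ℝ} (hg : Continuous g) :
    (∫ s in (0 : ℝ)..1, g s) ^ 2 ≤ ∫ s in (0 : ℝ)..1, g s ^ 2 := by
  set c := ∫ s in (0 : ℝ)..1, g s with hc
  have h1 : 0 ≤ ∫ s in (0 : ℝ)..1, (g s - c) ^ 2 :=
    intervalIntegral.integral_nonneg zero_le_one fun _ _ => sq_nonneg _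
  have h2 : ∫ s in (0 : ℝ)..1, (g s - c) ^ 2
      = (∫ s in (0 : ℝ)..1, g s ^ 2) - 2 * c * c + c ^ 2 := by
    have e : ∀ s, (g s - c) ^ 2 = g s ^ 2 - 2 * c * g s + c ^ 2 := fun s => by ring
    simp only [e]
    rw [intervalIntegral.integral_add, intervalIntegral.integral_sub,
      intervalIntegral.integral_const_mul, ← hc, intervalIntegral.integral_const]
    · simp
    all_goals exact Continuous.intervalIntegrable (by fun_prop) _ _
  nlinarith

theorem sq_sub_le_integral_gradient {φ : Pt d → ℝ} (hφ : ContDiff ℝ ∞ φ) (x y : Pt d) :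
    (φ x - φ y) ^ 2
      ≤ ∫ s in (0 : ℝ)..1, ‖y - x‖ ^ 2 * ‖gradient φ (x + s • (y - x))‖ ^ 2 := by
  have hline : Continuous (fun s : ℝ => x + s • (y - x)) := by fun_prop
  have hgc := continuous_gradient hφ
  have hder : ∀ s : ℝ, HasDerivAt (fun s : ℝ => φ (x + s • (y - x)))
      (inner ℝ (y - x) (gradient φ (x + s • (y - x)))) s := by
    intro s
    have ha : HasDerivAt (fun s : ℝ => x + s • (y - x)) (y - x) s := by
      simpa using ((hasDerivAt_id s).smul_const (y - x)).const_add x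
    rw [inner_gradient]
    exact ((hφ.differentiable (by simp)) _).hasFDerivAt.comp_hasDerivAt s ha
  have hcont : Continuous fun s : ℝ => inner ℝ (y - x) (gradient φ (x + s • (y - x))) :=
    continuous_const.inner (hgc.comp hline)
  have hftc := intervalIntegral.integral_eq_sub_of_hasDerivAt (a := 0) (b := 1)
    (fun s _ => hder s) (hcont.intervalIntegrable _ _)
  simp only [one_smul, zero_smul, add_zero, add_sub_cancel] at hftc
  have h1 := sq_intervalIntegral_le hcont
  rw [hftc] at h1
  calc (φ x - φ y) ^ 2 = (φ y - φ x) ^ 2 := by ring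
    _ ≤ _ := h1
    _ ≤ _ := by
      refine intervalIntegral.integral_mono_on zero_le_one
        ((hcont.pow 2).intervalIntegrable _ _)
        ((continuous_const.mul ((hgc.comp hline).norm.pow 2)).intervalIntegrable _ _)
        fun s _ => ?_
      rw [← mul_pow]
      exact sq_le_sq' (neg_le_of_abs_le (abs_real_inner_le_norm _ _))
        (real_inner_le_norm _ _)

theorem lintegral_comp_affine_le {F : Pt d → ℝ≥0∞} (hF : Measurable F) (c : Pt d) {b : ℝ}
    (hb : 1 / 2 ≤ b) : ∫⁻ y, F (c + b • y) ≤ 2 ^ d * ∫⁻ y, F y := by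
  have hb0 : 0 < b := by linarith
  have h1 : ∫⁻ y, F (c + b • y) = ∫⁻ y, F (b • y) := by
    have := lintegral_add_left_eq_self (μ := (volume : Measure (Pt d))) (fun y => F (b • y))
      (b⁻¹ • c)
    rw [← this]
    congr 1
    funext y
    rw [smul_add, smul_smul, mul_inv_cancel₀ hb0.ne', one_smul]
  have h2 : ∫⁻ y, F (b • y) = ENNReal.ofReal |(b ^ d)⁻¹| * ∫⁻ y, F y := by
    rw [← lintegral_map hF (measurable_const_smul b), map_addHaar_smul _ hb0.ne',
      lintegral_smul_measure, finrank_euclideanSpace_fin, smul_eq_mul]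
  rw [h1, h2]
  gcongr
  rw [abs_of_nonneg (by positivity), ← inv_pow]
  calc ENNReal.ofReal (b⁻¹ ^ d) ≤ ENNReal.ofReal (2 ^ d) := by
        apply ENNReal.ofReal_le_ofReal
        gcongr
        rw [inv_le_comm₀ hb0 two_pos]; linarith
    _ = 2 ^ d := by rw [ENNReal.ofReal_pow (by norm_num)]; norm_num

/-- One of `s` and `1 - s` is at least 1/2. Integrating first over the endpoint with that weight,
the substitution costs at most `2 ^ d` and does not degenerate as `s` tends to 0 or 1; the other
endpoint contributes the volume. -/
theorem lintegral_segment_le {F : Pt d → ℝ≥0∞} (hF : Measurable F) {s : ℝ} :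
    ∫⁻ x in U, ∫⁻ y in U, F (x + s • (y - x)) ≤ volume U * (2 ^ d * ∫⁻ y, F y) := by
  have key : ∀ a b : ℝ, 1 / 2 ≤ b →
      ∫⁻ x in U, ∫⁻ y in U, F (a • x + b • y) ≤ volume U * (2 ^ d * ∫⁻ y, F y) := by
    intro a b hb
    calc ∫⁻ x in U, ∫⁻ y in U, F (a • x + b • y)
        ≤ ∫⁻ x in U, (2 ^ d * ∫⁻ y, F y) := by
          refine lintegral_mono fun x => ?_
          exact (setLIntegral_le_lintegral _ _).trans (lintegral_comp_affine_le hF _ hb)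
      _ = _ := by rw [setLIntegral_const, mul_comm]
  rcases le_total (1 / 2) s with hs | hs
  · convert key (1 - s) s hs using 6
    module
  · have hsw : ∫⁻ x in U, ∫⁻ y in U, F (x + s • (y - x))
        = ∫⁻ y in U, ∫⁻ x in U, F (x + s • (y - x)) :=
      lintegral_lintegral_swap (by fun_prop)
    rw [hsw]
    convert key s (1 - s) (by linarith) using 6
    module

theorem lintegral_sq_sub_le (hU : Convex ℝ U) (hUo : IsOpen U) {D : ℝ}
    (hD : ∀ x ∈ U, ∀ y ∈ U, ‖y - x‖ ≤ D) {φ : Pt d → ℝ} (hφ : ContDiff ℝ ∞ φ) :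
    ∫⁻ x in U, ∫⁻ y in U, ENNReal.ofReal ((φ x - φ y) ^ 2)
      ≤ ENNReal.ofReal (D ^ 2) * (volume U * (2 ^ d *
        ∫⁻ x in U, ENNReal.ofReal (‖gradient φ x‖ ^ 2))) := by
  have hgc := continuous_gradient hφ
  have hgm : Measurable fun x => ENNReal.ofReal (‖gradient φ x‖ ^ 2) :=
    (ENNReal.continuous_ofReal.comp (hgc.norm.pow 2)).measurable
  -- By convexity the segments stay in `U`, so extending the integrand by zero changes nothing on
  -- them, while the integral over the whole space reduces to `U`.
  set F : Pt d → ℝ≥0∞ := U.indicator fun x => ENNReal.ofReal (‖gradient φ x‖ ^ 2) with hF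
  have hFm : Measurable F := hgm.indicator hUo.measurableSet
  have hpt : ∀ x ∈ U, ∀ y ∈ U, ENNReal.ofReal ((φ x - φ y) ^ 2)
      ≤ ENNReal.ofReal (D ^ 2) * ∫⁻ s in Ioc (0 : ℝ) 1, F (x + s • (y - x)) := by
    intro x hx y hy
    have hline : Continuous (fun s : ℝ => x + s • (y - x)) := by fun_prop
    have h1 := sq_sub_le_integral_gradient hφ x y
    rw [intervalIntegral.integral_of_le zero_le_one, integral_const_mul] at h1
    have hcont : Continuous fun s : ℝ => ‖gradient φ (x + s • (y - x))‖ ^ 2 :=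
      (hgc.comp hline).norm.pow 2
    calc ENNReal.ofReal ((φ x - φ y) ^ 2)
        ≤ ENNReal.ofReal (D ^ 2 * ∫ s in Ioc (0 : ℝ) 1, ‖gradient φ (x + s • (y - x))‖ ^ 2) := by
          refine ENNReal.ofReal_le_ofReal (h1.trans (mul_le_mul_of_nonneg_right
            (pow_le_pow_left₀ (norm_nonneg _) (hD x hx y hy) 2) ?_))
          exact integral_nonneg fun _ => sq_nonneg _
      _ = ENNReal.ofReal (D ^ 2) * ∫⁻ s in Ioc (0 : ℝ) 1,
            ENNReal.ofReal (‖gradient φ (x + s • (y - x))‖ ^ 2) := by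
          rw [ENNReal.ofReal_mul (by positivity), ofReal_integral_eq_lintegral_ofReal]
          · exact (hcont.continuousOn.integrableOn_Icc (a := 0) (b := 1)).mono_set
              Ioc_subset_Icc_self
          · exact Filter.Eventually.of_forall fun _ => by positivity
      _ = _ := by
          congr 1
          refine setLIntegral_congr_fun measurableSet_Ioc fun s hs => ?_
          rw [hF, indicator_of_mem]
          exact hU.add_smul_sub_mem hx hy ⟨hs.1.le, hs.2⟩
  calc ∫⁻ x in U, ∫⁻ y in U, ENNReal.ofReal ((φ x - φ y) ^ 2)
      ≤ ∫⁻ x in U, ∫⁻ y in U, ENNReal.ofReal (D ^ 2) *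
          ∫⁻ s in Ioc (0 : ℝ) 1, F (x + s • (y - x)) := by
        refine setLIntegral_mono' hUo.measurableSet fun x hx => ?_
        exact setLIntegral_mono' hUo.measurableSet fun y hy => hpt x hx y hy
    _ = ENNReal.ofReal (D ^ 2) * ∫⁻ x in U, ∫⁻ y in U,
          ∫⁻ s in Ioc (0 : ℝ) 1, F (x + s • (y - x)) := by
        simp only [lintegral_const_mul' _ _ ENNReal.ofReal_ne_top]
    _ = ENNReal.ofReal (D ^ 2) * ∫⁻ s in Ioc (0 : ℝ) 1, ∫⁻ x in U, ∫⁻ y in U,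
          F (x + s • (y - x)) := by
        congr 1
        have h1 : ∀ x, ∫⁻ y in U, ∫⁻ s in Ioc (0 : ℝ) 1, F (x + s • (y - x))
            = ∫⁻ s in Ioc (0 : ℝ) 1, ∫⁻ y in U, F (x + s • (y - x)) := fun x =>
          lintegral_lintegral_swap (by fun_prop)
        simp only [h1]
        refine lintegral_lintegral_swap (Measurable.aemeasurable ?_)
        have hm : Measurable fun q : (Pt d × ℝ) × Pt d => F (q.1.1 + q.1.2 • (q.2 - q.1.1)) := by
          fun_prop
        exact hm.lintegral_prod_right'
    _ ≤ ENNReal.ofReal (D ^ 2) * ∫⁻ s in Ioc (0 : ℝ) 1, volume U * (2 ^ d * ∫⁻ y, F y) := by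
        gcongr with s
        exact lintegral_segment_le hFm
    _ = _ := by
        rw [setLIntegral_const, Real.volume_Ioc, sub_zero, ENNReal.ofReal_one, mul_one, hF,
          lintegral_indicator hUo.measurableSet]

/-- The Poincaré inequality on bounded convex open sets. -/
theorem exists_poincare (hU : Convex ℝ U) (hUo : IsOpen U) (hUb : Bornology.IsBounded U)
    (hpos : 0 < volume U) :
    ∃ C : ℝ, 0 ≤ C ∧ ∀ φ : Pt d → ℝ, ContDiff ℝ ∞ φ → HasCompactSupport φ →
      ∫ x in U, (φ x - (volume.real U)⁻¹ * ∫ y in U, φ y) ^ 2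
        ≤ C * ∫ x in U, ‖gradient φ x‖ ^ 2 := by
  have hfin : volume U < ⊤ := hUb.measure_lt_top
  have : IsFiniteMeasure ((volume : Measure (Pt d)).restrict U) :=
    ⟨by rwa [restrict_apply_univ]⟩
  set V := volume.real U with hV
  have hV0 : 0 < V := ENNReal.toReal_pos hpos.ne' hfin.ne
  have hDb : ∀ x ∈ U, ∀ y ∈ U, ‖y - x‖ ≤ Metric.diam U := fun x hx y hy => by
    rw [← dist_eq_norm]; exact Metric.dist_le_diam_of_mem hUb hy hx
  refine ⟨Metric.diam U ^ 2 * 2 ^ d, by positivity, fun φ hφ hc => ?_⟩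
  have key := lintegral_sq_sub_le hU hUo hDb hφ
  have hφ2 : Integrable (fun x => φ x ^ 2) (volume.restrict U) :=
    ((memLp_test hφ hc).integrable_sq)
  have hφ1 : Integrable φ (volume.restrict U) := (memLp_test hφ hc).integrable (by norm_num)
  have hg2 : Integrable (fun x => ‖gradient φ x‖ ^ 2) (volume.restrict U) :=
    (memLp_gradient hφ hc).norm.integrable_sq
  set I := ∫ x in U, φ x ^ 2 with hI
  set J := ∫ x in U, φ x with hJ
  have hquad : ∀ a b c : ℝ, Integrable (fun x => a * φ x ^ 2 + b * φ x + c) (volume.restrict U) ∧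
      ∫ x in U, (a * φ x ^ 2 + b * φ x + c) = a * I + b * J + V * c := fun a b c => by
    have h1 := hφ2.const_mul a
    have h2 := hφ1.const_mul b
    have h3 : Integrable (fun _ : Pt d => c) (volume.restrict U) := integrable_const c
    have h12 : Integrable (fun x => a * φ x ^ 2 + b * φ x) (volume.restrict U) := h1.add h2
    refine ⟨h12.add h3, ?_⟩
    rw [integral_add h12 h3, integral_add h1 h2, integral_const_mul, integral_const_mul,
      integral_const, measureReal_restrict_apply_univ, smul_eq_mul]
  have hexp : ∀ x y, (φ x - φ y) ^ 2 = 1 * φ y ^ 2 + (-2 * φ x) * φ y + φ x ^ 2 :=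
    fun x y => by ring
  have hint : ∀ x, Integrable (fun y => (φ x - φ y) ^ 2) (volume.restrict U) := fun x => by
    simp only [hexp]
    exact (hquad _ _ _).1
  have hinner : ∀ x, ∫ y in U, (φ x - φ y) ^ 2 = V * φ x ^ 2 + (-2 * J) * φ x + I := fun x => by
    simp only [hexp]
    rw [(hquad _ _ _).2]
    ring
  have hint2 := (hquad V (-2 * J) I).1
  have houter : ∫ x in U, (V * φ x ^ 2 + (-2 * J) * φ x + I) = 2 * V * I - 2 * J ^ 2 := by
    rw [(hquad _ _ _).2]
    ring
  have hL : ∫⁻ x in U, ∫⁻ y in U, ENNReal.ofReal ((φ x - φ y) ^ 2)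
      = ENNReal.ofReal (2 * V * I - 2 * J ^ 2) := by
    have h1 : ∀ x, ∫⁻ y in U, ENNReal.ofReal ((φ x - φ y) ^ 2)
        = ENNReal.ofReal (V * φ x ^ 2 + (-2 * J) * φ x + I) := fun x => by
      rw [← hinner, ofReal_integral_eq_lintegral_ofReal (hint x)
        (Filter.Eventually.of_forall fun _ => by positivity)]
    simp only [h1]
    rw [← houter, ofReal_integral_eq_lintegral_ofReal hint2]
    refine Filter.Eventually.of_forall fun x => ?_
    simp only [Pi.zero_apply]
    rw [← hinner]
    exact integral_nonneg fun _ => by positivity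
  have hR : ENNReal.ofReal (Metric.diam U ^ 2) * (volume U * (2 ^ d *
        ∫⁻ x in U, ENNReal.ofReal (‖gradient φ x‖ ^ 2)))
      = ENNReal.ofReal (Metric.diam U ^ 2 * (V * (2 ^ d * ∫ x in U, ‖gradient φ x‖ ^ 2))) := by
    have h2d : ENNReal.ofReal ((2 : ℝ) ^ d) = 2 ^ d := by
      rw [ENNReal.ofReal_pow (by norm_num)]; norm_num
    rw [ENNReal.ofReal_mul (by positivity), ENNReal.ofReal_mul hV0.le,
      ENNReal.ofReal_mul (by positivity), h2d,
      ofReal_integral_eq_lintegral_ofReal hg2 (Filter.Eventually.of_forall fun _ => by positivity),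
      hV, ofReal_measureReal hfin.ne]
  rw [hL, hR, ENNReal.ofReal_le_ofReal_iff
    (by have : 0 ≤ ∫ x in U, ‖gradient φ x‖ ^ 2 := integral_nonneg fun _ => by positivity
        positivity)] at key
  have hlhs : ∫ x in U, (φ x - V⁻¹ * J) ^ 2 = I - V⁻¹ * J ^ 2 := by
    have e : ∀ x, (φ x - V⁻¹ * J) ^ 2
        = 1 * φ x ^ 2 + (-2 * (V⁻¹ * J)) * φ x + (V⁻¹ * J) ^ 2 := fun x => by ring
    simp only [e]
    rw [(hquad _ _ _).2]
    field_simp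
    ring
  rw [hlhs]
  -- The double integral of `(φ x - φ y) ^ 2` is `2 * V` times the squared distance of `φ` to its
  -- mean. The factor 2 is given away at the end.
  have h0 : V * (2 * (I - V⁻¹ * J ^ 2)) = 2 * V * I - 2 * J ^ 2 := by
    field_simp
  have h3 : V * (2 * (I - V⁻¹ * J ^ 2))
      ≤ V * (Metric.diam U ^ 2 * 2 ^ d * ∫ x in U, ‖gradient φ x‖ ^ 2) := by
    rw [h0]; linarith
  have h4 := le_of_mul_le_mul_left h3 hV0
  have h5 : 0 ≤ Metric.diam U ^ 2 * 2 ^ d * ∫ x in U, ‖gradient φ x‖ ^ 2 := by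
    have : 0 ≤ ∫ x in U, ‖gradient φ x‖ ^ 2 := integral_nonneg fun _ => by positivity
    positivity
  linarith

end Poincare

/-! ### The coefficient as a coercive operator on L² -/

/-- The assumptions on the coefficient `k` on the set `U`. -/
structure IsCoeff {d : ℕ} (k : Pt d → Pt d →L[ℝ] Pt d) (U : Set (Pt d)) (kmin kmax : ℝ) :
    Prop where
  measurableSet : MeasurableSet U
  measurable : Measurable k
  symm : ∀ x ∈ U, ∀ ζ ζ' : Pt d, inner ℝ (k x ζ) ζ' = inner ℝ ζ (k x ζ')
  pos : 0 < kmin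
  bound : ∀ x ∈ U, ∀ ζ : Pt d,
    kmin * ‖ζ‖ ^ 2 ≤ inner ℝ ζ (k x ζ) ∧ inner ℝ ζ (k x ζ) ≤ kmax * ‖ζ‖ ^ 2

section Coeff

variable {d : ℕ} {k : Pt d → Pt d →L[ℝ] Pt d} {U V : Set (Pt d)} {kmin kmax : ℝ}

theorem IsCoeff.mono (hk : IsCoeff k U kmin kmax) (hV : MeasurableSet V) (hVU : V ⊆ U) :
    IsCoeff k V kmin kmax :=
  ⟨hV, hk.measurable, fun x hx => hk.symm x (hVU hx), hk.pos, fun x hx => hk.bound x (hVU hx)⟩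

/-- Only the quadratic form is bounded by assumption; symmetry turns this into an operator bound by
polarization. With `ξ` parallel to `k x ζ` and of the norm of `ζ`, four times `⟪k x ζ, ξ⟫` is the
form at `ζ + ξ` minus the form at `ζ - ξ`, and the latter is nonnegative. -/
theorem IsCoeff.norm_le (hk : IsCoeff k U kmin kmax) {x : Pt d} (hx : x ∈ U) (ζ : Pt d) :
    ‖k x ζ‖ ≤ kmax * ‖ζ‖ := by
  by_cases h0 : k x ζ = 0
  · rw [h0, norm_zero]
    by_cases hζ : ζ = 0
    · simp [hζ]
    · have h1 := hk.bound x hx ζ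
      have h2 : 0 < ‖ζ‖ := norm_pos_iff.2 hζ
      have h3 : kmin * ‖ζ‖ ^ 2 ≤ kmax * ‖ζ‖ ^ 2 := h1.1.trans h1.2
      have h4 := le_of_mul_le_mul_right h3 (by positivity)
      have := hk.pos
      have : 0 ≤ kmax := by linarith
      positivity
  · have hn : 0 < ‖k x ζ‖ := norm_pos_iff.2 h0
    have hζ : 0 < ‖ζ‖ := norm_pos_iff.2 (by rintro rfl; simp at h0)
    set t := ‖ζ‖ / ‖k x ζ‖ with ht
    have ht0 : 0 < t := by positivity
    set ξ := t • k x ζ with hξ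
    have hξn : ‖ξ‖ = ‖ζ‖ := by
      rw [hξ, norm_smul, Real.norm_eq_abs, abs_of_pos ht0, ht]; field_simp
    have hpol : inner ℝ (ζ + ξ) (k x (ζ + ξ)) - inner ℝ (ζ - ξ) (k x (ζ - ξ))
        = 4 * inner ℝ (k x ζ) ξ := by
      have hs := hk.symm x hx ζ ξ
      simp only [map_add, map_sub, inner_add_left, inner_add_right, inner_sub_left,
        inner_sub_right]
      rw [real_inner_comm (k x ζ) ξ, hs]
      ring
    have hin : inner ℝ (k x ζ) ξ = ‖ζ‖ * ‖k x ζ‖ := by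
      rw [hξ, real_inner_smul_right, real_inner_self_eq_norm_sq, ht]; field_simp
    have h1 := (hk.bound x hx (ζ + ξ)).2
    have h2 := (hk.bound x hx (ζ - ξ)).1
    have h3 : 0 ≤ kmin * ‖ζ - ξ‖ ^ 2 := mul_nonneg hk.pos.le (sq_nonneg _)
    have h4 : ‖ζ + ξ‖ ^ 2 ≤ 4 * ‖ζ‖ ^ 2 := by
      have := norm_add_le ζ ξ
      rw [hξn] at this
      nlinarith [norm_nonneg (ζ + ξ)]
    have hk0 : 0 ≤ kmax := by
      have h5 := hk.bound x hx ζ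
      have h6 := le_of_mul_le_mul_right (h5.1.trans h5.2) (by positivity)
      linarith [hk.pos]
    have h5 : kmax * ‖ζ + ξ‖ ^ 2 ≤ kmax * (4 * ‖ζ‖ ^ 2) := mul_le_mul_of_nonneg_left h4 hk0
    have h6 : ‖ζ‖ * ‖k x ζ‖ ≤ ‖ζ‖ * (kmax * ‖ζ‖) := by
      rw [← hin]; nlinarith
    exact le_of_mul_le_mul_left h6 hζ

theorem IsCoeff.memLp (hk : IsCoeff k U kmin kmax) (u : L2V U) :
    MemLp (fun x => k x (u x)) 2 (volume.restrict U) := by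
  have hm : AEStronglyMeasurable (fun x => k x (u x)) (volume.restrict U) :=
    isBoundedBilinearMap_apply.continuous.comp_aestronglyMeasurable
      (hk.measurable.stronglyMeasurable.aestronglyMeasurable.prodMk (Lp.memLp u).1)
  refine MemLp.of_le_mul (c := kmax) (Lp.memLp u) hm ?_
  filter_upwards [ae_restrict_mem hk.measurableSet] with x hx
  exact hk.norm_le hx _

/-- Multiplication by the coefficient on `[L²(U)]^d`. -/
def coeffOp (hk : IsCoeff k U kmin kmax) : L2V U →L[ℝ] L2V U :=
  LinearMap.mkContinuous
    { toFun := fun u => (hk.memLp u).toLp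
      map_add' := fun u v => by
        apply Lp.ext
        filter_upwards [(hk.memLp (u + v)).coeFn_toLp, (hk.memLp u).coeFn_toLp,
          (hk.memLp v).coeFn_toLp, Lp.coeFn_add u v,
          Lp.coeFn_add ((hk.memLp u).toLp _) ((hk.memLp v).toLp _)] with x h1 h2 h3 h4 h5
        rw [h1, h5, Pi.add_apply, h2, h3, h4, Pi.add_apply, map_add]
      map_smul' := fun a u => by
        apply Lp.ext
        filter_upwards [(hk.memLp (a • u)).coeFn_toLp, (hk.memLp u).coeFn_toLp,
          Lp.coeFn_smul a u, Lp.coeFn_smul a ((hk.memLp u).toLp _)] with x h1 h2 h3 h4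
        rw [h1, RingHom.id_apply, h4, Pi.smul_apply, h2, h3, Pi.smul_apply, map_smul] }
    |kmax| (fun u => by
      refine Lp.norm_le_mul_norm_of_ae_le_mul ?_
      filter_upwards [(hk.memLp u).coeFn_toLp, ae_restrict_mem hk.measurableSet] with x h1 hx
      change ‖(hk.memLp u).toLp _ x‖ ≤ _
      rw [h1]
      exact (hk.norm_le hx _).trans (mul_le_mul_of_nonneg_right (le_abs_self _) (norm_nonneg _)))

theorem coeffOp_ae (hk : IsCoeff k U kmin kmax) (u : L2V U) :
    coeffOp hk u =ᵐ[volume.restrict U] fun x => k x (u x) := (hk.memLp u).coeFn_toLp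

theorem inner_coeffOp (hk : IsCoeff k U kmin kmax) (u v : L2V U) :
    inner ℝ (coeffOp hk u) v = ∫ x in U, inner ℝ (k x (u x)) (v x) := by
  rw [L2.inner_def]
  refine integral_congr_ae ?_
  filter_upwards [coeffOp_ae hk u] with x hx
  rw [hx]

theorem coeffOp_coercive (hk : IsCoeff k U kmin kmax) (u : L2V U) :
    kmin * ‖u‖ ^ 2 ≤ inner ℝ (coeffOp hk u) u := by
  rw [← real_inner_self_eq_norm_sq, L2.inner_def, L2.inner_def, ← integral_const_mul]
  refine integral_mono_ae ((L2.integrable_inner u u).const_mul _) (L2.integrable_inner _ u) ?_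
  filter_upwards [coeffOp_ae hk u, ae_restrict_mem hk.measurableSet] with x h1 hx
  rw [h1, real_inner_self_eq_norm_sq, real_inner_comm]
  exact (hk.bound x hx _).1

theorem eq_zero_of_inner_coeffOp (hk : IsCoeff k U kmin kmax) {u : L2V U}
    (h : inner ℝ (coeffOp hk u) u = 0) : u = 0 := by
  have h1 := coeffOp_coercive hk u
  rw [h] at h1
  have h2 : ‖u‖ ^ 2 ≤ 0 := by
    by_contra hlt
    push Not at hlt
    have := mul_pos hk.pos hlt
    linarith
  exact norm_eq_zero.1 (pow_eq_zero_iff two_ne_zero |>.1 (le_antisymm h2 (sq_nonneg _)))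

end Coeff

/-! ### The closed space of gradients and its potentials -/

section LocalProblem

variable {d : ℕ} {U : Set (Pt d)}

theorem inner_real_eq_mul (a b : ℝ) : inner ℝ a b = a * b := by simp [mul_comm]

/-- The smooth compactly supported functions. -/
def testFunctions (d : ℕ) : Submodule ℝ (Pt d → ℝ) where
  carrier := {φ | ContDiff ℝ ∞ φ ∧ HasCompactSupport φ}
  add_mem' := fun h h' => ⟨h.1.add h'.1, h.2.add h'.2⟩
  zero_mem' := ⟨contDiff_const, HasCompactSupport.zero⟩
  smul_mem' := fun a _ h => ⟨h.1.const_smul a, h.2.smul_left (f := fun _ => a)⟩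

theorem gradient_add_apply {φ φ' : Pt d → ℝ} (h : ContDiff ℝ ∞ φ) (h' : ContDiff ℝ ∞ φ')
    (x : Pt d) : gradient (φ + φ') x = gradient φ x + gradient φ' x := by
  rw [gradient, fderiv_add ((h.differentiable (by simp)) x) ((h'.differentiable (by simp)) x),
    map_add]
  rfl

theorem gradient_smul_apply {φ : Pt d → ℝ} (h : ContDiff ℝ ∞ φ) (a : ℝ)
    (x : Pt d) : gradient (a • φ) x = a • gradient φ x := by
  rw [gradient, fderiv_const_smul ((h.differentiable (by simp)) x)]
  simp [gradient]

/-- The gradient of a test function, as an element of `[L²(U)]^d`. -/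
def testGrad (U : Set (Pt d)) : testFunctions d →ₗ[ℝ] L2V U where
  toFun φ := (memLp_gradient φ.2.1 φ.2.2).toLp
  map_add' φ φ' := by
    apply Lp.ext
    filter_upwards [(memLp_gradient (μ := volume.restrict U) (φ + φ').2.1 (φ + φ').2.2).coeFn_toLp,
      (memLp_gradient (μ := volume.restrict U) φ.2.1 φ.2.2).coeFn_toLp,
      (memLp_gradient (μ := volume.restrict U) φ'.2.1 φ'.2.2).coeFn_toLp,
      Lp.coeFn_add ((memLp_gradient (μ := volume.restrict U) φ.2.1 φ.2.2).toLp _)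
        ((memLp_gradient (μ := volume.restrict U) φ'.2.1 φ'.2.2).toLp _)] with x h1 h2 h3 h4
    rw [h1, h4, Pi.add_apply, h2, h3]
    exact gradient_add_apply φ.2.1 φ'.2.1 x
  map_smul' a φ := by
    apply Lp.ext
    filter_upwards [(memLp_gradient (μ := volume.restrict U) (a • φ).2.1 (a • φ).2.2).coeFn_toLp,
      (memLp_gradient (μ := volume.restrict U) φ.2.1 φ.2.2).coeFn_toLp,
      Lp.coeFn_smul a ((memLp_gradient (μ := volume.restrict U) φ.2.1 φ.2.2).toLp _)]
      with x h1 h2 h4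
    rw [h1, RingHom.id_apply, h4, Pi.smul_apply, h2]
    exact gradient_smul_apply φ.2.1 a x

theorem testGrad_ae (φ : testFunctions d) :
    testGrad U φ =ᵐ[volume.restrict U] gradient (φ : Pt d → ℝ) :=
  (memLp_gradient φ.2.1 φ.2.2).coeFn_toLp

theorem integral_inner_gradient {v : Pt d → Pt d} {w : L2V U} (h : w =ᵐ[volume.restrict U] v)
    (φ : testFunctions d) :
    ∫ x in U, inner ℝ (v x) (gradient (φ : Pt d → ℝ) x) = inner ℝ w (testGrad U φ) := by
  rw [L2.inner_def]
  refine integral_congr_ae ?_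
  filter_upwards [testGrad_ae φ, h] with x h1 h2
  rw [h1, h2]

/-- The closure of the gradients in `[L²(U)]^d`. -/
def gradSpace (U : Set (Pt d)) : Submodule ℝ (L2V U) :=
  (LinearMap.range (testGrad U)).topologicalClosure

/-- Passing to the closure does not change an orthogonal complement, so the condition only has to be
tested on gradients. This turns the constraints of the cell problem into Hilbert space geometry. -/
theorem hasWeakDiv0_zero_iff {v : Pt d → Pt d} {w : L2V U} (h : w =ᵐ[volume.restrict U] v) :
    HasWeakDiv0 U v 0 ↔ w ∈ (gradSpace U)ᗮ := by
  rw [gradSpace, Submodule.orthogonal_closure, Submodule.mem_orthogonal']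
  have h0 : ∀ φ : Pt d → ℝ, ∫ x in U, (0 : L2 U) x * φ x = 0 := fun φ => by
    rw [integral_congr_ae (g := fun _ => 0), integral_zero]
    filter_upwards [Lp.coeFn_zero ℝ 2 (volume.restrict U)] with x hx
    rw [hx, Pi.zero_apply, zero_mul]
  constructor
  · rintro hv _ ⟨φ, rfl⟩
    have := hv φ φ.2.1 φ.2.2
    rwa [h0, add_zero, integral_inner_gradient h] at this
  · intro hw φ hφ hc
    rw [h0, add_zero]
    have := hw _ ⟨⟨φ, hφ, hc⟩, rfl⟩
    rwa [← integral_inner_gradient h] at this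

/-- The generalized Poincaré property: elements of the closure of the gradients have a potential
in `L²(U)`. -/
theorem exists_potential (hU : Convex ℝ U) (hUo : IsOpen U) (hUb : Bornology.IsBounded U)
    (hpos : 0 < volume U) {η : L2V U} (hη : η ∈ gradSpace U) :
    ∃ p : L2 U, ∀ (τ : L2V U) (g : L2 U), HasWeakDiv0 U τ g → inner ℝ η τ + inner ℝ p g = 0 := by
  have : IsFiniteMeasure ((volume : Measure (Pt d)).restrict U) :=
    ⟨by rw [restrict_apply_univ]; exact hUb.measure_lt_top⟩
  obtain ⟨C, hC, hpoinc⟩ := exists_poincare hU hUo hUb hpos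
  -- Normalizing potentials to mean zero makes them controlled by their gradients, so that they
  -- converge along with the gradients.
  let avg : (Pt d → ℝ) → ℝ := fun φ => (volume.real U)⁻¹ * ∫ y in U, φ y
  have hmem : ∀ φ : testFunctions d, MemLp (fun x => (φ : Pt d → ℝ) x - avg φ) 2
      (volume.restrict U) := fun φ => (memLp_test φ.2.1 φ.2.2).sub (memLp_const _)
  let P : testFunctions d → L2 U := fun φ => (hmem φ).toLp
  have hPae : ∀ φ, P φ =ᵐ[volume.restrict U] fun x => (φ : Pt d → ℝ) x - avg φ :=
    fun φ => (hmem φ).coeFn_toLp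
  have havg : ∀ φ φ' : testFunctions d, avg (φ - φ' : testFunctions d) = avg φ - avg φ' := by
    intro φ φ'
    simp only [avg]
    have := integral_sub ((memLp_test (μ := volume.restrict U) φ.2.1 φ.2.2).integrable one_le_two)
      ((memLp_test (μ := volume.restrict U) φ'.2.1 φ'.2.2).integrable one_le_two)
    rw [← mul_sub, ← this]
    rfl
  have hPsub : ∀ φ φ', P φ - P φ' = P (φ - φ') := fun φ φ' => by
    apply Lp.ext
    filter_upwards [Lp.coeFn_sub (P φ) (P φ'), hPae φ, hPae φ', hPae (φ - φ')] with x h1 h2 h3 h4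
    rw [h1, Pi.sub_apply, h2, h3, h4, havg]
    simp only [Submodule.coe_sub, Pi.sub_apply]
    ring
  have hPnorm : ∀ φ, ‖P φ‖ ≤ Real.sqrt C * ‖testGrad U φ‖ := fun φ => by
    have h1 : ‖P φ‖ ^ 2 = ∫ x in U, ((φ : Pt d → ℝ) x - avg φ) ^ 2 := by
      rw [← real_inner_self_eq_norm_sq, L2.inner_def]
      refine integral_congr_ae ?_
      filter_upwards [hPae φ] with x hx
      rw [real_inner_self_eq_norm_sq, hx, Real.norm_eq_abs, sq_abs]
    have h2 : ‖testGrad U φ‖ ^ 2 = ∫ x in U, ‖gradient (φ : Pt d → ℝ) x‖ ^ 2 := by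
      rw [← real_inner_self_eq_norm_sq, L2.inner_def]
      refine integral_congr_ae ?_
      filter_upwards [testGrad_ae (U := U) φ] with x hx
      rw [real_inner_self_eq_norm_sq, hx]
    have h3 := hpoinc φ φ.2.1 φ.2.2
    refine (sq_le_sq₀ (norm_nonneg _) (by positivity)).1 ?_
    rw [mul_pow, Real.sq_sqrt hC, h1, h2]
    exact h3
  have hgreen : ∀ (φ : testFunctions d) (τ : L2V U) (g : L2 U), HasWeakDiv0 U τ g →
      inner ℝ (testGrad U φ) τ + inner ℝ (P φ) g = 0 := by
    intro φ τ g hτ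
    -- Testing with a function equal to one on `U` shows that `g` has integral zero, so subtracting
    -- the mean from `φ` does not affect the pairing with `g`.
    obtain ⟨ρ, hρ, hρc, hρ1⟩ := exists_cutoff hUb.isCompact_closure
    have e1 := hτ φ φ.2.1 φ.2.2
    have e2 := hτ ρ hρ hρc
    have e3 : ∫ x in U, inner ℝ (τ x) (gradient ρ x) = 0 := by
      rw [setIntegral_congr_fun (g := fun _ => 0) hUo.measurableSet, integral_zero]
      intro x hx
      simp [(hρ1 x (subset_closure hx)).2]
    have e4 : ∫ x in U, g x * ρ x = ∫ x in U, g x := by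
      refine setIntegral_congr_fun hUo.measurableSet fun x hx => ?_
      simp [(hρ1 x (subset_closure hx)).1]
    rw [e3, e4, zero_add] at e2
    have e5 : (inner ℝ (P φ) g : ℝ) = ∫ x in U, g x * (φ : Pt d → ℝ) x := by
      rw [L2.inner_def]
      have h1 : ∫ x in U, (g x * (φ : Pt d → ℝ) x - avg φ * g x)
          = ∫ x in U, g x * (φ : Pt d → ℝ) x := by
        rw [integral_sub (integrable_mul_of_memLp (Lp.memLp g) (memLp_test φ.2.1 φ.2.2))
          (((Lp.memLp g).integrable one_le_two).const_mul _), integral_const_mul, e2]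
        ring
      rw [← h1]
      refine integral_congr_ae ?_
      filter_upwards [hPae φ] with x hx
      rw [hx, inner_real_eq_mul]
      ring
    rw [e5, real_inner_comm, ← integral_inner_gradient (v := τ) (Filter.EventuallyEq.refl _ _)]
    exact e1
  rw [gradSpace, ← SetLike.mem_coe, Submodule.topologicalClosure_coe,
    mem_closure_iff_seq_limit] at hη
  obtain ⟨w, hw, hlim⟩ := hη
  choose φ hφ using hw
  have hcauchy : CauchySeq (fun n => P (φ n)) := by
    have hcw : CauchySeq w := hlim.cauchySeq
    rw [Metric.cauchySeq_iff'] at hcw ⊢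
    intro ε hε
    obtain ⟨N, hN⟩ := hcw (ε / (Real.sqrt C + 1)) (by positivity)
    refine ⟨N, fun n hn => ?_⟩
    have h1 := hN n hn
    rw [dist_eq_norm] at h1 ⊢
    rw [hPsub]
    have h2 : testGrad U (φ n - φ N) = w n - w N := by rw [map_sub, hφ, hφ]
    refine (hPnorm _).trans_lt ?_
    rw [h2]
    rw [lt_div_iff₀ (by positivity)] at h1
    nlinarith [norm_nonneg (w n - w N), Real.sqrt_nonneg C]
  obtain ⟨p, hp⟩ := cauchySeq_tendsto_of_complete hcauchy
  refine ⟨p, fun τ g hτ => ?_⟩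
  have hl1 : Filter.Tendsto (fun n => inner ℝ (w n) τ + inner ℝ (P (φ n)) g) Filter.atTop
      (nhds (inner ℝ η τ + inner ℝ p g)) :=
    (hlim.inner tendsto_const_nhds).add (hp.inner tendsto_const_nhds)
  have hl2 : (fun n => (inner ℝ (w n) τ + inner ℝ (P (φ n)) g : ℝ)) = fun _ => 0 := by
    funext n
    rw [← hφ n]
    exact hgreen _ _ _ hτ
  rw [hl2] at hl1
  exact tendsto_nhds_unique hl1 tendsto_const_nhds |>.symm ▸ rfl

end LocalProblem

/-! ### Solvability and uniqueness of the cell problem -/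

section LocalSolution

variable {d : ℕ} {k : Pt d → Pt d →L[ℝ] Pt d} {U : Set (Pt d)} {kmin kmax : ℝ}

/-- The form `(k η, ξ)` on the space of gradients. -/
def gradForm (hk : IsCoeff k U kmin kmax) : gradSpace U →L[ℝ] gradSpace U →L[ℝ] ℝ :=
  LinearMap.mkContinuous₂
    (LinearMap.mk₂ ℝ (fun η ξ => inner ℝ (coeffOp hk η) (ξ : L2V U))
      (fun _ _ _ => by rw [Submodule.coe_add, map_add, inner_add_left])
      (fun _ _ _ => by rw [Submodule.coe_smul, map_smul, real_inner_smul_left, smul_eq_mul])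
      (fun _ _ _ => by rw [Submodule.coe_add, inner_add_right])
      (fun _ _ _ => by rw [Submodule.coe_smul, real_inner_smul_right, smul_eq_mul]))
    ‖coeffOp hk‖ (fun η ξ => by
      rw [LinearMap.mk₂_apply]
      refine (norm_inner_le_norm _ _).trans ?_
      exact mul_le_mul_of_nonneg_right ((coeffOp hk).le_opNorm _) (norm_nonneg _))

theorem gradForm_apply (hk : IsCoeff k U kmin kmax) (η ξ : gradSpace U) :
    gradForm hk η ξ = inner ℝ (coeffOp hk η) (ξ : L2V U) := rfl

theorem isCoercive_gradForm (hk : IsCoeff k U kmin kmax) : IsCoercive (gradForm hk) :=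
  ⟨kmin, hk.pos, fun u => by
    rw [gradForm_apply, mul_assoc, ← sq]
    exact coeffOp_coercive hk u⟩

instance : CompleteSpace (gradSpace U) :=
  (Submodule.isClosed_topologicalClosure _).completeSpace_coe

/-- The solution operator of a coercive variational problem on a closed subspace. -/
def galerkinSolve {E : Type*} [NormedAddCommGroup E] [InnerProductSpace ℝ E] (G : Submodule ℝ E)
    [CompleteSpace G] (B : G →L[ℝ] G →L[ℝ] ℝ) (hB : IsCoercive B) : E →ₗ[ℝ] E :=
  -(G.subtype ∘ₗ hB.continuousLinearEquivOfBilin.symm.toLinearMap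
    ∘ₗ G.orthogonalProjectionOnto.toLinearMap)

theorem galerkinSolve_spec {E : Type*} [NormedAddCommGroup E] [InnerProductSpace ℝ E]
    (G : Submodule ℝ E) [CompleteSpace G] (B : G →L[ℝ] G →L[ℝ] ℝ) (hB : IsCoercive B) (χ : E) :
    ∃ v : G, galerkinSolve G B hB χ = v ∧ ∀ ξ : G, B v ξ = -inner ℝ χ (ξ : E) := by
  refine ⟨-hB.continuousLinearEquivOfBilin.symm (G.orthogonalProjectionOnto χ), rfl, fun ξ => ?_⟩
  rw [← hB.continuousLinearEquivOfBilin_apply, _root_.map_neg,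
    ContinuousLinearEquiv.apply_symm_apply, inner_neg_left,
    Submodule.inner_orthogonalProjectionOnto_eq_of_mem_right]

/-- The solution operator `χ ↦ η` of the cell problem. -/
def cellSolve (hk : IsCoeff k U kmin kmax) : L2V U →ₗ[ℝ] L2V U :=
  galerkinSolve (gradSpace U) (gradForm hk) (isCoercive_gradForm hk)

theorem cellSolve_mem (hk : IsCoeff k U kmin kmax) (χ : L2V U) :
    cellSolve hk χ ∈ gradSpace U := by
  obtain ⟨v, hv, -⟩ := galerkinSolve_spec (gradSpace U) (gradForm hk) (isCoercive_gradForm hk) χ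
  rw [cellSolve, hv]
  exact v.2

theorem inner_cellSolve (hk : IsCoeff k U kmin kmax) (χ : L2V U) {ξ : L2V U}
    (hξ : ξ ∈ gradSpace U) : inner ℝ (coeffOp hk (cellSolve hk χ)) ξ = -inner ℝ χ ξ := by
  obtain ⟨v, hv, h⟩ := galerkinSolve_spec (gradSpace U) (gradForm hk) (isCoercive_gradForm hk) χ
  rw [cellSolve, hv]
  exact h ⟨ξ, hξ⟩

theorem eq_cellSolve (hk : IsCoeff k U kmin kmax) {χ η : L2V U} (hη : η ∈ gradSpace U)
    (h : ∀ ξ ∈ gradSpace U, inner ℝ (coeffOp hk η) ξ = -inner ℝ χ ξ) : η = cellSolve hk χ := by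
  have hmem := Submodule.sub_mem _ hη (cellSolve_mem hk χ)
  have : η - cellSolve hk χ = 0 := by
    refine eq_zero_of_inner_coeffOp hk ?_
    rw [map_sub, inner_sub_left, h _ hmem, inner_cellSolve hk χ hmem, sub_self]
  exact sub_eq_zero.1 this

/-- The local solutions are given by the solution operator. -/
theorem IsLocalSolution.eq (hk : IsCoeff k U kmin kmax) (hUo : IsOpen U) {χ : Pt d → Pt d}
    (hχ : MemLp χ 2 (volume.restrict U)) (hχd : ∃ g : L2 U, HasWeakDiv U χ g)
    {η ψ : L2V U} {p : L2 U}
    (h : IsLocalSolution k U χ η ψ p) :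
    η = cellSolve hk hχ.toLp ∧ ψ = -coeffOp hk η ∧ HasWeakDiv0 U (fun x => ψ x - χ x) 0 := by
  obtain ⟨h1, h2, h3, h4, h5⟩ := h
  have hψ : ψ = -coeffOp hk η := by
    have h6 : coeffOp hk η + ψ = 0 := by
      -- The first equation is tested with its own residual.
      have := h1 (coeffOp hk η + ψ)
      rw [← inner_coeffOp hk, ← L2.inner_def, ← inner_add_left] at this
      exact inner_self_eq_zero.1 this
    exact eq_neg_of_add_eq_zero_right h6
  have hdiv : HasWeakDiv0 U (fun x => ψ x - χ x) 0 := by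
    have e1 : weakDiv U ψ = weakDiv U χ := by
      have h7 : inner ℝ (weakDiv U ψ - weakDiv U χ) (weakDiv U ψ - weakDiv U χ) = (0 : ℝ) := by
        rw [inner_sub_left, L2.inner_def, L2.inner_def, sub_eq_zero]
        have := h4 (weakDiv U ψ - weakDiv U χ)
        simpa only [inner_real_eq_mul] using this
      exact sub_eq_zero.1 (inner_self_eq_zero.1 h7)
    have e2 : HasWeakDiv U χ (weakDiv U χ) := MemHDiv.hasWeakDiv ⟨hχ, hχd⟩
    have e3 := e2.smul_add hχ h3.1 h3.hasWeakDiv (-1)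
    have e4 : HasWeakDiv U (fun x => ψ x - χ x) 0 := by
      have e5 : (-1 : ℝ) • weakDiv U χ + weakDiv U ψ = 0 := by rw [e1]; simp
      have e6 : (fun x => (-1 : ℝ) • χ x + ψ x) = fun x => ψ x - χ x := by
        funext x; module
      rwa [e5, e6] at e3
    have e7 := h5.hasWeakDiv0
    rwa [e4.weakDiv_eq hUo] at e7
  -- The second equation makes `η` orthogonal to every divergence-free field without normal flux,
  -- that is, to the complement of the closed space of gradients.
  have hη : η ∈ gradSpace U := by
    have hcl : (gradSpace U)ᗮᗮ = gradSpace U := Submodule.orthogonal_orthogonal _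
    rw [← hcl, Submodule.mem_orthogonal']
    intro τ hτ
    have h6 : HasWeakDiv0 U τ 0 := (hasWeakDiv0_zero_iff (Filter.EventuallyEq.refl _ _)).2 hτ
    have h7 := h2 τ (h6.memH0Div hUo (Lp.memLp τ))
    rw [h6.hasWeakDiv.weakDiv_eq hUo] at h7
    have h8 : ∫ x in U, p x * (0 : L2 U) x = 0 := by
      rw [integral_congr_ae (g := fun _ => 0), integral_zero]
      filter_upwards [Lp.coeFn_zero ℝ 2 (volume.restrict U)] with x hx
      rw [hx, Pi.zero_apply, mul_zero]
    rw [h8, add_zero, ← L2.inner_def] at h7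
    exact h7
  refine ⟨eq_cellSolve hk hη fun ξ hξ => ?_, hψ, hdiv⟩
  have hae : (ψ - hχ.toLp : L2V U) =ᵐ[volume.restrict U] fun x => ψ x - χ x := by
    filter_upwards [Lp.coeFn_sub ψ hχ.toLp, hχ.coeFn_toLp] with x e1 e2
    rw [e1, Pi.sub_apply, e2]
  have hperp := (hasWeakDiv0_zero_iff hae).1 hdiv
  have := (Submodule.mem_orthogonal' _ _).1 hperp ξ hξ
  rw [hψ, inner_sub_left, inner_neg_left] at this
  linarith

/-- Lax-Milgram on the gradients gives `η`, and `ψ = -k η`. The variational equation then says that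
`ψ - χ` is orthogonal to all gradients, which yields both the divergence and the boundary condition;
the scalar unknown is the potential of `η`. -/
theorem exists_isLocalSolution (hk : IsCoeff k U kmin kmax) (hU : Convex ℝ U) (hUo : IsOpen U)
    (hUb : Bornology.IsBounded U) (hpos : 0 < volume U) {χ : Pt d → Pt d}
    (hχ : MemLp χ 2 (volume.restrict U)) (hχd : ∃ g : L2 U, HasWeakDiv U χ g) :
    ∃ (η ψ : L2V U) (p : L2 U), IsLocalSolution k U χ η ψ p := by
  set η := cellSolve hk hχ.toLp with hη
  obtain ⟨p, hp⟩ := exists_potential hU hUo hUb hpos (cellSolve_mem hk hχ.toLp)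
  set ψ := -coeffOp hk η with hψ
  have hae : (ψ - hχ.toLp : L2V U) =ᵐ[volume.restrict U] fun x => ψ x - χ x := by
    filter_upwards [Lp.coeFn_sub ψ hχ.toLp, hχ.coeFn_toLp] with x e1 e2
    rw [e1, Pi.sub_apply, e2]
  have hdiv : HasWeakDiv0 U (fun x => ψ x - χ x) 0 := by
    refine (hasWeakDiv0_zero_iff hae).2 ((Submodule.mem_orthogonal' _ _).2 fun ξ hξ => ?_)
    rw [inner_sub_left, hψ, inner_neg_left, inner_cellSolve hk _ hξ]
    ring
  have hsub : MemLp (fun x => ψ x - χ x) 2 (volume.restrict U) := (Lp.memLp ψ).sub hχ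
  obtain ⟨g, hg⟩ := hχd
  have hψd : HasWeakDiv U ψ g := by
    have := hg.smul_add hχ hsub hdiv.hasWeakDiv 1
    have e1 : (fun x => (1 : ℝ) • χ x + (ψ x - χ x)) = ψ := by funext x; module
    rwa [e1, one_smul, add_zero] at this
  refine ⟨η, ψ, p, fun ξ => ?_, fun τ hτ => ?_, ⟨Lp.memLp ψ, g, hψd⟩, fun q => ?_,
    hdiv.memH0Div hUo hsub⟩
  · rw [← inner_coeffOp hk, ← L2.inner_def, hψ, inner_neg_left, add_neg_cancel]
  · have := hp τ _ hτ.hasWeakDiv0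
    rw [L2.inner_def, L2.inner_def] at this
    simpa only [inner_real_eq_mul] using this
  · rw [hψd.weakDiv_eq hUo, hg.weakDiv_eq hUo]

end LocalSolution

/-! ### The local multiscale spaces -/

section CellSpaces

variable {d : ℕ} {k : Pt d → Pt d →L[ℝ] Pt d} {K : Cell d} {kmin kmax : ℝ}

/-- The difference contributes nothing to Green's formula. This is how the multiscale velocities
inherit the traces of RT₀, whatever the coefficient. -/
theorem HasFlux.of_hasWeakDiv0_sub {χ ψ : Pt d → Pt d} {δ : ℝ} {c : Set (Pt d) → ℝ}
    (hψ : MemLp ψ 2 (volume.restrict K.dom))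
    (h : HasFlux K χ δ c) (hdiv : HasWeakDiv0 K.dom (fun x => ψ x - χ x) 0) :
    HasFlux K ψ δ c := by
  have h0 : HasFlux K (fun x => ψ x - χ x) 0 (fun _ => 0) := by
    refine ⟨hψ.sub h.1, fun φ hφ hc => ?_⟩
    have h1 := hdiv φ hφ hc
    have h2 : ∫ x in K.dom, (0 : L2 K.dom) x * φ x = 0 := by
      rw [integral_congr_ae (g := fun _ => 0), integral_zero]
      filter_upwards [Lp.coeFn_zero ℝ 2 (volume.restrict K.dom)] with x hx
      rw [hx, Pi.zero_apply, zero_mul]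
    rw [h2, add_zero] at h1
    simp only [zero_mul, add_zero, Finset.sum_const_zero]
    exact h1
  have := h.smul_add h0 1
  simp only [one_mul, add_zero] at this
  refine this.congr (Filter.Eventually.of_forall fun x => ?_)
  simp

theorem HasFlux.isLocalSolution_eq (hd : 0 < d) (hk : IsCoeff k K.dom kmin kmax)
    {χ : Pt d → Pt d} {δ : ℝ} {c : Set (Pt d) → ℝ} (h : HasFlux K χ δ c) {η ψ : L2V K.dom}
    {p : L2 K.dom} (hs : IsLocalSolution k K.dom χ η ψ p) :
    η = cellSolve hk h.1.toLp ∧ ψ = -coeffOp hk η ∧ HasFlux K ψ δ c := by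
  obtain ⟨h1, h2, h3⟩ := hs.eq hk K.isOpen_dom h.1 ⟨_, h.hasWeakDiv hd⟩
  exact ⟨h1, h2, h.of_hasWeakDiv0_sub (Lp.memLp ψ) h3⟩

theorem exists_isLocalSolution_of_mem_RT0 (hd : 0 < d) (hk : IsCoeff k K.dom kmin kmax)
    {χ : Pt d → Pt d} (hχ : χ ∈ K.RT0) :
    ∃ (η ψ : L2V K.dom) (p : L2 K.dom), IsLocalSolution k K.dom χ η ψ p := by
  obtain ⟨δ, c, h⟩ := exists_hasFlux_of_mem_RT0 hd hχ
  exact exists_isLocalSolution hk K.convex_dom K.isOpen_dom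
    (K.isCompact_carrier.isBounded.subset K.dom_subset) (K.volume_dom_pos hd) h.1
    ⟨_, h.hasWeakDiv hd⟩

theorem velSpan_eq_map (hd : 0 < d) (hk : IsCoeff k K.dom kmin kmax) :
    velSpan k K = (gradSpan k K).map (-(coeffOp hk).toLinearMap) := by
  rw [velSpan, gradSpan, Submodule.map_span]
  congr 1
  ext ψ
  constructor
  · rintro ⟨χ, hχ, η, p, hs⟩
    obtain ⟨δ, c, h⟩ := exists_hasFlux_of_mem_RT0 hd hχ
    exact ⟨η, ⟨χ, hχ, ψ, p, hs⟩, (h.isLocalSolution_eq hd hk hs).2.1.symm⟩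
  · rintro ⟨η, ⟨χ, hχ, ψ', p, hs⟩, rfl⟩
    obtain ⟨δ, c, h⟩ := exists_hasFlux_of_mem_RT0 hd hχ
    refine ⟨χ, hχ, η, p, ?_⟩
    have := (h.isLocalSolution_eq hd hk hs).2.1
    rw [LinearMap.neg_apply]
    change IsLocalSolution k K.dom χ η (-coeffOp hk η) p
    rwa [← this]

/-- The map `χ ↦ η` is the linear operator `cellSolve`, and RT₀ is spanned by finitely many fields.
-/
theorem finiteDimensional_gradSpan (hd : 0 < d) (hk : IsCoeff k K.dom kmin kmax) :
    FiniteDimensional ℝ (gradSpan k K) := by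
  obtain ⟨ι, _, ℓ, X, hF, hX, hspan⟩ := K.exists_facetSystem hd
  choose δ c hflux using fun i => exists_hasFlux_of_mem_RT0 hd (hX i).1
  have hfin : FiniteDimensional ℝ (Submodule.span ℝ
      (range fun i => cellSolve hk ((hflux i).1.toLp))) :=
    FiniteDimensional.span_of_finite ℝ (finite_range _)
  refine Submodule.finiteDimensional_of_le (S₂ := Submodule.span ℝ
    (range fun i => cellSolve hk ((hflux i).1.toLp))) (Submodule.span_le.2 ?_)
  rintro η ⟨χ, hχ, ψ, p, hs⟩
  obtain ⟨δ', c', h⟩ := exists_hasFlux_of_mem_RT0 hd hχ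
  obtain ⟨w, hw⟩ := hspan χ hχ
  have e1 : h.1.toLp = ∑ i, w i • (hflux i).1.toLp := by
    apply Lp.ext
    have e2 : ∀ᵐ x ∂volume.restrict K.dom, ∀ i, ((hflux i).1.toLp : L2V K.dom) x = X i x :=
      ae_all_iff.2 fun i => (hflux i).1.coeFn_toLp
    have e3 : ∀ᵐ x ∂volume.restrict K.dom, ∀ i,
        (w i • ((hflux i).1.toLp : L2V K.dom) : L2V K.dom) x
          = w i • ((hflux i).1.toLp : L2V K.dom) x :=
      ae_all_iff.2 fun i => Lp.coeFn_smul _ _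
    filter_upwards [h.1.coeFn_toLp, e2, e3, Lp.coeFn_finsetSum Finset.univ
      (fun i => w i • ((hflux i).1.toLp : L2V K.dom))] with x h1 h2 h3 h4
    rw [h1, h4, hw, Finset.sum_apply]
    exact Finset.sum_congr rfl fun i _ => by rw [h3, h2]
  rw [(h.isLocalSolution_eq hd hk hs).1, e1, _root_.map_sum]
  refine Submodule.sum_mem _ fun i _ => ?_
  rw [map_smul]
  exact Submodule.smul_mem _ _ (Submodule.subset_span ⟨i, rfl⟩)

theorem exists_hasFlux_of_mem_velSpan (hd : 0 < d) (hk : IsCoeff k K.dom kmin kmax)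
    {w : L2V K.dom} (hw : w ∈ velSpan k K) : ∃ δ c, HasFlux K w δ c := by
  induction hw using Submodule.span_induction with
  | mem ψ h =>
    obtain ⟨χ, hχ, η, p, hs⟩ := h
    obtain ⟨δ, c, h⟩ := exists_hasFlux_of_mem_RT0 hd hχ
    exact ⟨δ, c, (h.isLocalSolution_eq hd hk hs).2.2⟩
  | zero =>
    exact ⟨_, _, hasFlux_zero.congr (Lp.coeFn_zero (Pt d) 2 (volume.restrict K.dom)).symm⟩
  | add u v _ _ hu hv =>
    obtain ⟨δ, c, h⟩ := hu
    obtain ⟨δ', c', h'⟩ := hv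
    refine ⟨_, _, (h.smul_add h' 1).congr ?_⟩
    filter_upwards [Lp.coeFn_add u v] with x hx
    rw [hx, Pi.add_apply, one_smul]
  | smul a u _ hu =>
    obtain ⟨δ, c, h⟩ := hu
    refine ⟨_, _, (h.smul a).congr ?_⟩
    filter_upwards [Lp.coeFn_smul a u] with x hx
    rw [hx, Pi.smul_apply]

theorem exists_mem_velSpan_hasFlux (hd : 0 < d) (hk : IsCoeff k K.dom kmin kmax)
    {χ : Pt d → Pt d} (hχ : χ ∈ K.RT0) {δ : ℝ} {c : Set (Pt d) → ℝ} (h : HasFlux K χ δ c) :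
    ∃ w ∈ velSpan k K, HasFlux K w δ c := by
  obtain ⟨η, ψ, p, hs⟩ := exists_isLocalSolution_of_mem_RT0 hd hk hχ
  exact ⟨ψ, Submodule.subset_span ⟨χ, hχ, η, p, hs⟩, (h.isLocalSolution_eq hd hk hs).2.2⟩

end CellSpaces

/-! ### Geometry of the mesh: interfaces and boundary faces -/

/-- Near a point of a face that lies on no other face, a cell looks like a half-space. -/
theorem Cell.exists_halfspace {d : ℕ} (hd : 0 < d) {K : Cell d} {e : Set (Pt d)}
    (he : e ∈ K.faces) {x : Pt d} (hx : x ∈ e) (hreg : ∀ e' ∈ K.faces, e' ≠ e → x ∉ e') :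
    ∃ ℓ : Pt d →ᵃ[ℝ] ℝ, ℓ x = 0 ∧ ∃ ε > 0, ∀ y ∈ Metric.ball x ε,
      (0 ≤ ℓ y → y ∈ K.carrier) ∧ (0 < ℓ y → y ∈ K.dom) := by
  obtain ⟨ι, _, ℓ, X, h, -⟩ := K.exists_facetSystem hd
  have he' := he
  rw [h.faces_eq] at he'
  obtain ⟨i, rfl⟩ := he'
  have hpos : ∀ j, j ≠ i → 0 < ℓ j x := by
    intro j hj
    have h0 : 0 ≤ ℓ j x := by
      have := hx.1
      rw [h.carrier_eq] at this
      exact this j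
    refine lt_of_le_of_ne h0 fun hj0 => ?_
    refine hreg {x | x ∈ K.carrier ∧ ℓ j x = 0} (by rw [h.faces_eq]; exact ⟨j, rfl⟩) ?_
      ⟨hx.1, hj0.symm⟩
    intro heq
    -- Distinct inequalities give distinct faces, because the regular point of one face satisfies
    -- the other inequality strictly.
    obtain ⟨y, hyi, hy⟩ := h.exists_regular i
    have hyK : y ∈ {x | x ∈ K.carrier ∧ ℓ i x = 0} := by
      refine ⟨?_, hyi⟩
      rw [h.carrier_eq]
      intro k
      by_cases hk : k = i
      · rw [hk]; exact hyi.ge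
      · exact (hy k hk).le
    have hyj : y ∈ {x | x ∈ K.carrier ∧ ℓ j x = 0} := by rw [heq]; exact hyK
    exact (hy j hj).ne' hyj.2
  have hopen : IsOpen (⋂ j, {y | j ≠ i → 0 < ℓ j y}) := by
    refine isOpen_iInter_of_finite fun j => ?_
    by_cases hj : j = i
    · simp [hj]
    · simpa [hj] using isOpen_lt continuous_const (ℓ j).continuous_of_finiteDimensional
  obtain ⟨ε, hε, hball⟩ := Metric.isOpen_iff.1 hopen x (mem_iInter.2 hpos)
  refine ⟨ℓ i, hx.2, ε, hε, fun y hy => ⟨fun hyi => ?_, fun hyi => ?_⟩⟩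
  · rw [h.carrier_eq]
    intro j
    by_cases hj : j = i
    · rw [hj]; exact hyi
    · exact (mem_iInter.1 (hball hy) j hj).le
  · rw [h.dom_eq]
    intro j
    by_cases hj : j = i
    · rw [hj]; exact hyi
    · exact mem_iInter.1 (hball hy) j hj

namespace Mesh

variable {d : ℕ} {Ω : Set (Pt d)}

theorem isBounded_domain (M : Mesh Ω) : Bornology.IsBounded Ω := by
  refine Bornology.IsBounded.subset ?_ subset_closure
  rw [M.cover]
  exact (M.cells.finite_toSet.isCompact_biUnion fun K _ => K.isCompact_carrier).isBounded

theorem volume_domain_lt_top (M : Mesh Ω) : volume Ω < ⊤ := M.isBounded_domain.measure_lt_top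

variable {M : Mesh Ω}

theorem carrier_subset {K : Cell d} (hK : K ∈ M.cells) : K.carrier ⊆ closure Ω := by
  rw [M.cover]
  exact subset_biUnion_of_mem (u := fun K : Cell d => K.carrier) hK

theorem dom_subset (hΩ : interior (closure Ω) = Ω) {K : Cell d} (hK : K ∈ M.cells) :
    K.dom ⊆ Ω := by
  rw [← hΩ]
  exact interior_mono (carrier_subset hK)

theorem domain_ae_eq (hΩ : interior (closure Ω) = Ω) :
    Ω =ᵐ[volume] ⋃ K ∈ M.cells, K.dom := by
  have h0 : (⋃ K ∈ M.cells, K.dom) ⊆ Ω := iUnion₂_subset fun K hK => dom_subset hΩ hK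
  refine Filter.EventuallyLE.antisymm ?_ h0.eventuallyLE
  have h1 : Ω ⊆ ⋃ K ∈ M.cells, K.carrier := by rw [← M.cover]; exact subset_closure
  refine h1.eventuallyLE.trans (Filter.EventuallyLE.countable_bUnion M.cells.countable_toSet ?_)
  exact fun K _ => K.carrier_ae_eq_dom.le

theorem ae_domain_of_forall (hΩ : interior (closure Ω) = Ω) {p : Pt d → Prop}
    (h : ∀ K ∈ M.cells, ∀ᵐ x ∂volume.restrict K.dom, p x) : ∀ᵐ x ∂volume.restrict Ω, p x := by
  rw [restrict_congr_set (M.domain_ae_eq hΩ), ae_restrict_biUnion_finset_iff]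
  exact h

theorem integral_domain (hΩ : interior (closure Ω) = Ω) {F : Type*} [NormedAddCommGroup F]
    [NormedSpace ℝ F] {f : Pt d → F} (hf : Integrable f (volume.restrict Ω)) :
    ∫ x in Ω, f x = ∑ K ∈ M.cells, ∫ x in K.dom, f x := by
  rw [setIntegral_congr_set (M.domain_ae_eq hΩ), integral_biUnion_finset]
  · exact fun K _ => K.isOpen_dom.measurableSet
  · exact fun K hK L hL hne => M.disjoint K hK L hL hne
  · exact fun K hK => hf.mono_measure (restrict_mono (dom_subset hΩ hK) le_rfl)

/-- Almost every point of a face lies on no other face. -/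
theorem ae_notMem_face (hd : 0 < d) {K : Cell d} (hK : K ∈ M.cells) {e : Set (Pt d)}
    (he : e ∈ K.faces) :
    ∀ᵐ x ∂surf e, ∀ L ∈ M.cells, ∀ e' ∈ L.faces, e' ≠ e → x ∉ e' := by
  refine (ae_ball_iff M.cells.countable_toSet).2 fun L hL => ?_
  rw [ae_ball_iff L.finite_faces.countable]
  intro e' he'
  by_cases hne : e' = e
  · simp [hne]
  · have h0 := M.conforming L hL K hK e' he' e he hne
    have : ∀ᵐ x ∂surf e, x ∉ e' := by
      rw [ae_iff, surf, restrict_apply' (Cell.isCompact_face hd he).isClosed.measurableSet]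
      simpa using h0
    filter_upwards [this] with x hx _
    exact hx

/-- Otherwise `x` would be interior to `L`; but the interior of `K` accumulates at `x`, so the two
interiors would meet. -/
theorem notMem_carrier_of_notMem_faces (hd : 0 < d) {K L : Cell d} (hK : K ∈ M.cells)
    (hL : L ∈ M.cells) (hKL : L ≠ K) {x : Pt d} (hx : x ∈ K.carrier)
    (h : ∀ e ∈ L.faces, x ∉ e) : x ∉ L.carrier := by
  intro hxL
  by_cases hxd : x ∈ L.dom
  · rw [← K.closure_dom hd, mem_closure_iff] at hx
    obtain ⟨y, hyL, hyK⟩ := hx _ L.isOpen_dom hxd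
    exact (M.disjoint L hL K hK hKL).le_bot ⟨hyL, hyK⟩
  · have hfr : x ∈ frontier L.dom := by
      rw [L.isOpen_dom.frontier_eq, L.closure_dom hd]
      exact ⟨hxL, hxd⟩
    rw [L.frontier_dom hd] at hfr
    simp only [mem_iUnion, Cell.mem_faceSet] at hfr
    obtain ⟨e, he, hxe⟩ := hfr
    exact h e he hxe

/-- A face that belongs to a single cell lies on the boundary of the domain. -/
theorem face_subset_frontier (hd : 0 < d) (hΩ : interior (closure Ω) = Ω) {K : Cell d}
    (hK : K ∈ M.cells) {e : Set (Pt d)} (he : e ∈ K.faces)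
    (hsingle : ∀ L ∈ M.cells, L ≠ K → e ∉ L.faces) : e ⊆ frontier Ω := by
  have hΩo : IsOpen Ω := by rw [← hΩ]; exact isOpen_interior
  -- A point of `Ω` on `e` and on no other face would have a neighbourhood covered by `K` alone,
  -- hence would be interior to `K`.
  have hout : ∀ᵐ x ∂surf e, x ∉ Ω := by
    filter_upwards [ae_notMem_face hd hK he,
      ae_restrict_mem (Cell.isCompact_face hd he).isClosed.measurableSet] with x hx hxe hxΩ
    have hxK : x ∈ K.carrier := Cell.face_subset_carrier hd he hxe
    have hopen : IsOpen (⋃ L ∈ (M.cells : Set (Cell d)) \ {K}, L.carrier)ᶜ := by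
      rw [isOpen_compl_iff]
      exact (M.cells.finite_toSet.subset sdiff_subset).isClosed_biUnion
        fun L _ => L.isCompact_carrier.isClosed
    have hxmem : x ∈ (⋃ L ∈ (M.cells : Set (Cell d)) \ {K}, L.carrier)ᶜ := by
      simp only [mem_compl_iff, mem_iUnion, not_exists]
      rintro L ⟨hL, hLK⟩
      refine notMem_carrier_of_notMem_faces hd hK hL hLK hxK fun e' he' => hx L hL e' he' ?_
      rintro rfl
      exact hsingle L hL hLK he'
    have hint : x ∈ K.dom := by
      refine mem_interior.2 ⟨Ω ∩ (⋃ L ∈ (M.cells : Set (Cell d)) \ {K}, L.carrier)ᶜ, ?_,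
        hΩo.inter hopen, hxΩ, hxmem⟩
      rintro y ⟨hyΩ, hy⟩
      have hyc : y ∈ closure Ω := subset_closure hyΩ
      rw [M.cover] at hyc
      simp only [mem_iUnion] at hyc
      obtain ⟨L, hL, hyL⟩ := hyc
      by_cases hLK : L = K
      · rwa [← hLK]
      · exact absurd (mem_biUnion (t := fun L : Cell d => L.carrier)
          (show L ∈ (M.cells : Set (Cell d)) \ {K} from ⟨hL, hLK⟩) hyL) hy
    have hfr := Cell.face_subset_frontier hd he hxe
    rw [K.isOpen_dom.frontier_eq] at hfr
    exact hfr.2 hint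
  intro x hx
  rw [hΩo.frontier_eq]
  refine ⟨carrier_subset hK (Cell.face_subset_carrier hd he hx), fun hxΩ => ?_⟩
  -- The exceptional null set is empty: a face that meets the open set `Ω` meets it in positive
  -- measure.
  have hpos := Cell.hausdorff_face_inter_pos hd he hx hΩo hxΩ
  rw [ae_iff, surf, restrict_apply' (Cell.isCompact_face hd he).isClosed.measurableSet] at hout
  simp only [not_not, ofPred_mem_eq] at hout
  rw [inter_comm, hout] at hpos
  exact lt_irrefl _ hpos

/-- Almost every point of an interface lies in the domain. -/
theorem ae_mem_domain_of_interface (hd : 0 < d) (hΩ : interior (closure Ω) = Ω) {K L : Cell d}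
    (hK : K ∈ M.cells) (hL : L ∈ M.cells) (hKL : K ≠ L) {e : Set (Pt d)} (he : e ∈ K.faces)
    (he' : e ∈ L.faces) : ∀ᵐ x ∂surf e, x ∈ Ω := by
  filter_upwards [ae_notMem_face hd hK he,
    ae_restrict_mem (Cell.isCompact_face hd he).isClosed.measurableSet] with x hx hxe
  obtain ⟨ℓ, hℓ, ε, hε, hK'⟩ := Cell.exists_halfspace hd he hxe (hx K hK)
  obtain ⟨ℓ', hℓ', ε', hε', hL'⟩ := Cell.exists_halfspace hd he' hxe (hx L hL)
  rw [← hΩ]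
  refine mem_interior.2 ⟨Metric.ball x (min ε ε'), fun y hy => ?_, Metric.isOpen_ball,
    Metric.mem_ball_self (lt_min hε hε')⟩
  have hyK : y ∈ Metric.ball x ε := Metric.ball_subset_ball (min_le_left _ _) hy
  have hyL : y ∈ Metric.ball x ε' := Metric.ball_subset_ball (min_le_right _ _) hy
  by_cases h1 : 0 ≤ ℓ y
  · exact carrier_subset hK ((hK' y hyK).1 h1)
  by_cases h2 : 0 ≤ ℓ' y
  · exact carrier_subset hL ((hL' y hyL).1 h2)
  -- A point on the wrong side of both hyperplanes has its reflection in `x` in the interior of both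
  -- cells.
  exfalso
  push Not at h1 h2
  have hdist : dist (x + (-1 : ℝ) • (y - x)) x = dist y x := by
    rw [dist_eq_norm, dist_eq_norm, add_sub_cancel_left, norm_smul]; simp
  have e1 : x + (-1 : ℝ) • (y - x) ∈ K.dom := by
    refine (hK' _ (by rw [Metric.mem_ball, hdist]; exact hyK)).2 ?_
    rw [affine_apply_line, hℓ]; linarith
  have e2 : x + (-1 : ℝ) • (y - x) ∈ L.dom := by
    refine (hL' _ (by rw [Metric.mem_ball, hdist]; exact hyL)).2 ?_
    rw [affine_apply_line, hℓ']; linarith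
  exact (M.disjoint K hK L hL hKL).le_bot ⟨e1, e2⟩

/-- Properties that hold almost everywhere on each face hold almost everywhere on the skeleton. -/
theorem ae_skeleton_iff (hd : 0 < d) {p : Pt d → Prop} :
    (∀ᵐ x ∂surf M.skeleton, p x) ↔ ∀ K ∈ M.cells, ∀ e ∈ K.faces, ∀ᵐ x ∂surf e, p x := by
  simp only [surf, skeleton]
  rw [ae_restrict_biUnion_finset_iff]
  refine forall₂_congr fun K _ => ?_
  rw [K.frontier_dom hd, ae_restrict_biUnion_finset_iff]
  simp only [Cell.mem_faceSet]

theorem isFiniteMeasure_surf_skeleton (hd : 0 < d) : IsFiniteMeasure (surf M.skeleton) :=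
  ⟨by
    rw [surf, restrict_apply_univ, skeleton]
    exact measure_biUnion_lt_top M.cells.finite_toSet fun K _ => K.hausdorff_frontier_lt_top hd⟩

theorem surf_frontier_le {K : Cell d} (hK : K ∈ M.cells) :
    surf (frontier K.dom) ≤ surf M.skeleton :=
  restrict_mono (subset_biUnion_of_mem (u := fun K : Cell d => frontier K.dom) hK) le_rfl

end Mesh

theorem Cell.surf_face_le {d : ℕ} (hd : 0 < d) {K : Cell d} {e : Set (Pt d)} (he : e ∈ K.faces) :
    surf e ≤ surf (frontier K.dom) :=
  restrict_mono (Cell.face_subset_frontier hd he) le_rfl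

/-! ### Broken fields, jumps, and membership in H(div) -/

section GlobalFields

variable {d : ℕ} {Ω : Set (Pt d)} {M : Mesh Ω}

namespace Mesh

/-- Square-integrable functions on the cells can be glued. -/
theorem exists_glue (hΩ : interior (closure Ω) = Ω) {F : Type*} [NormedAddCommGroup F]
    (w : Cell d → Pt d → F) (hw : ∀ K ∈ M.cells, MemLp (w K) 2 (volume.restrict K.dom)) :
    ∃ u : Lp F 2 ((volume : Measure (Pt d)).restrict Ω),
      ∀ K ∈ M.cells, u =ᵐ[volume.restrict K.dom] w K := by
  have hmem : MemLp (fun x => ∑ K ∈ M.cells, K.dom.indicator (w K) x) 2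
      ((volume : Measure (Pt d)).restrict Ω) := by
    refine memLp_finsetSum _ fun K hK => ?_
    exact ((memLp_indicator_iff_restrict K.isOpen_dom.measurableSet).2 (hw K hK)).restrict _
  refine ⟨hmem.toLp, fun K hK => ?_⟩
  filter_upwards [ae_mono (restrict_mono (dom_subset hΩ hK) le_rfl) hmem.coeFn_toLp,
    ae_restrict_mem K.isOpen_dom.measurableSet] with x hx hxK
  rw [hx, Finset.sum_eq_single K]
  · exact indicator_of_mem hxK _
  · intro L hL hne
    exact indicator_of_notMem (fun hxL => (M.disjoint L hL K hK hne).le_bot ⟨hxL, hxK⟩) _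
  · exact fun h => absurd hK h

theorem ext_of_cells (hΩ : interior (closure Ω) = Ω) {F : Type*} [NormedAddCommGroup F]
    {u v : Lp F 2 ((volume : Measure (Pt d)).restrict Ω)}
    (h : ∀ K ∈ M.cells, u =ᵐ[volume.restrict K.dom] v) : u = v :=
  Lp.ext (ae_domain_of_forall hΩ h)

theorem memLp_restrict_dom (hΩ : interior (closure Ω) = Ω) {F : Type*} [NormedAddCommGroup F]
    {K : Cell d} (hK : K ∈ M.cells) {v : Pt d → F} (hv : MemLp v 2 (volume.restrict Ω)) :
    MemLp v 2 (volume.restrict K.dom) :=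
  hv.mono_measure (restrict_mono (dom_subset hΩ hK) le_rfl)

/-- `v` has constant divergence `δ K` and constant face fluxes `c K` on each cell `K`. -/
def IsBrokenFlux (M : Mesh Ω) (v : Pt d → Pt d) (δ : Cell d → ℝ)
    (c : Cell d → Set (Pt d) → ℝ) : Prop :=
  ∀ K ∈ M.cells, HasFlux K v (δ K) (c K)

/-- The sum of the outward fluxes of all cells, as a function on the skeleton. -/
def jump (M : Mesh Ω) (c : Cell d → Set (Pt d) → ℝ) (x : Pt d) : ℝ :=
  ∑ K ∈ M.cells, faceFun K (c K) x

theorem memLp_jump (hd : 0 < d) (c : Cell d → Set (Pt d) → ℝ) :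
    MemLp (M.jump c) 2 (surf M.skeleton) := by
  have := M.isFiniteMeasure_surf_skeleton hd
  exact memLp_finsetSum _ fun K _ => memLp_faceFun hd (c K)

theorem integral_jump_mul (hd : 0 < d) (c : Cell d → Set (Pt d) → ℝ) {π : Pt d → ℝ}
    (hπ : MemLp π 2 (surf M.skeleton)) :
    ∫ x, M.jump c x * π x ∂surf M.skeleton
      = ∑ K ∈ M.cells, ∫ x, faceFun K (c K) x * π x ∂surf (frontier K.dom) := by
  have := M.isFiniteMeasure_surf_skeleton hd
  simp only [jump, Finset.sum_mul]
  rw [integral_finsetSum]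
  · refine Finset.sum_congr rfl fun K hK => ?_
    refine setIntegral_eq_of_subset_of_forall_sdiff_eq_zero ?_ ?_ ?_
    · exact (M.cells.finite_toSet.isClosed_biUnion
        fun K _ => isClosed_frontier).measurableSet
    · exact subset_biUnion_of_mem (u := fun K : Cell d => frontier K.dom) hK
    · rintro x ⟨-, hx⟩
      rw [K.frontier_dom hd] at hx
      simp only [mem_iUnion, not_exists] at hx
      rw [faceFun, Finset.sum_eq_zero, zero_mul]
      exact fun e he => indicator_of_notMem (hx e he) _
  · exact fun K _ => integrable_mul_of_memLp (memLp_faceFun hd (c K)) hπ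

theorem pairC_eq (hd : 0 < d) {τ : L2V Ω} {δ : Cell d → ℝ}
    {c : Cell d → Set (Pt d) → ℝ} (h : M.IsBrokenFlux τ δ c) (π : Lp ℝ 2 (surf M.skeleton)) :
    M.pairC τ π = ∫ x, M.jump c x * π x ∂surf M.skeleton := by
  rw [integral_jump_mul hd c (Lp.memLp π), pairC]
  refine Finset.sum_congr rfl fun K hK => integral_congr_ae ?_
  filter_upwards [(h K hK).normalTrace_ae hd] with x hx
  rw [hx]

/-- Summing Green's formula over the cells leaves the jump as the only obstruction to being in
H(div, Ω); the next results read this identity in both directions. -/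
theorem green_broken (hd : 0 < d) {v : Pt d → Pt d} {δ : Cell d → ℝ}
    {c : Cell d → Set (Pt d) → ℝ} (h : M.IsBrokenFlux v δ c) {φ : Pt d → ℝ}
    (hφ : ContDiff ℝ ∞ φ) (hc : HasCompactSupport φ) :
    ∑ K ∈ M.cells, ((∫ x in K.dom, inner ℝ (v x) (gradient φ x)) + δ K * ∫ x in K.dom, φ x)
      = ∫ x, M.jump c x * φ x ∂surf M.skeleton := by
  have := M.isFiniteMeasure_surf_skeleton hd
  rw [integral_jump_mul hd c (memLp_test hφ hc)]
  refine Finset.sum_congr rfl fun K hK => ?_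
  have := isFiniteMeasure_surf_frontier hd K
  rw [(h K hK).2 φ hφ hc, integral_faceFun_mul hd]
  exact (memLp_test hφ hc).integrable (by norm_num)

theorem sum_eq_of_ae_const (hΩ : interior (closure Ω) = Ω) {v : Pt d → Pt d}
    (hv : MemLp v 2 (volume.restrict Ω)) {δ : Cell d → ℝ} {g : L2 Ω}
    (hg : ∀ K ∈ M.cells, ∀ᵐ x ∂volume.restrict K.dom, g x = δ K) {φ : Pt d → ℝ}
    (hφ : ContDiff ℝ ∞ φ) (hc : HasCompactSupport φ) :
    ∑ K ∈ M.cells, ((∫ x in K.dom, inner ℝ (v x) (gradient φ x)) + δ K * ∫ x in K.dom, φ x)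
      = (∫ x in Ω, inner ℝ (v x) (gradient φ x)) + ∫ x in Ω, g x * φ x := by
  rw [integral_domain hΩ (integrable_inner_of_memLp hv (memLp_gradient hφ hc)),
    integral_domain hΩ (integrable_mul_of_memLp (Lp.memLp g) (memLp_test hφ hc)),
    ← Finset.sum_add_distrib]
  refine Finset.sum_congr rfl fun K hK => ?_
  congr 1
  rw [← integral_const_mul]
  refine integral_congr_ae ?_
  filter_upwards [hg K hK] with x hx
  rw [hx]

theorem IsBrokenFlux.weakDiv_ae (hd : 0 < d) (hΩ : interior (closure Ω) = Ω) {v : Pt d → Pt d}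
    {δ : Cell d → ℝ} {c : Cell d → Set (Pt d) → ℝ}
    (h : M.IsBrokenFlux v δ c) {g : L2 Ω} (hg : HasWeakDiv Ω v g) {K : Cell d}
    (hK : K ∈ M.cells) : ∀ᵐ x ∂volume.restrict K.dom, g x = δ K := by
  have hgK : MemLp g 2 (volume.restrict K.dom) := memLp_restrict_dom hΩ hK (Lp.memLp g)
  have hsub := dom_subset hΩ hK
  have hΩm : MeasurableSet Ω := by rw [← hΩ]; exact isOpen_interior.measurableSet
  have hdiv : HasWeakDiv K.dom v hgK.toLp := by
    intro φ hφ hc hs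
    have h1 := hg φ hφ hc (hs.trans hsub)
    have hzero : ∀ x ∈ Ω \ K.dom, x ∉ tsupport φ := fun x hx hx' => hx.2 (hs hx')
    have e1 : ∫ x in Ω, inner ℝ (v x) (gradient φ x)
        = ∫ x in K.dom, inner ℝ (v x) (gradient φ x) := by
      refine setIntegral_eq_of_subset_of_forall_sdiff_eq_zero hΩm hsub fun x hx => ?_
      rw [inner_gradient, fderiv_of_notMem_tsupport ℝ (hzero x hx)]; rfl
    have e2 : ∫ x in Ω, g x * φ x = ∫ x in K.dom, g x * φ x := by
      refine setIntegral_eq_of_subset_of_forall_sdiff_eq_zero hΩm hsub fun x hx => ?_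
      rw [image_eq_zero_of_notMem_tsupport (hzero x hx), mul_zero]
    rw [← e1, h1, e2, neg_inj]
    refine integral_congr_ae ?_
    filter_upwards [hgK.coeFn_toLp] with x hx
    rw [hx]
  have := ((h K hK).hasWeakDiv hd).unique K.isOpen_dom hdiv
  filter_upwards [(memLp_const (δ K) : MemLp (fun _ => δ K) 2 (volume.restrict K.dom)).coeFn_toLp,
    hgK.coeFn_toLp] with x h1 h2
  rw [← h2, ← this, h1]

/-- A broken field in `H(div, Ω)` has no jump in the interior of the domain. -/
theorem IsBrokenFlux.jump_ae_zero (hd : 0 < d) (hΩ : interior (closure Ω) = Ω) {v : Pt d → Pt d}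
    (hv : MemLp v 2 (volume.restrict Ω)) {δ : Cell d → ℝ} {c : Cell d → Set (Pt d) → ℝ}
    (h : M.IsBrokenFlux v δ c) {g : L2 Ω} (hg : HasWeakDiv Ω v g) :
    ∀ᵐ x ∂surf M.skeleton, x ∈ Ω → M.jump c x = 0 := by
  have := M.isFiniteMeasure_surf_skeleton hd
  have hΩo : IsOpen Ω := by rw [← hΩ]; exact isOpen_interior
  refine hΩo.ae_eq_zero_of_integral_contDiff_smul_eq_zero
    (((M.memLp_jump hd c).locallyIntegrable (by norm_num)).locallyIntegrableOn Ω)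
    fun φ hφ hc hs => ?_
  have h1 := hg φ hφ hc hs
  have h2 := sum_eq_of_ae_const hΩ hv (fun K hK => h.weakDiv_ae hd hΩ hg hK) hφ hc
  rw [green_broken hd h hφ hc, h1, neg_add_cancel] at h2
  rw [← h2]
  congr 1
  funext x
  rw [smul_eq_mul, mul_comm]

theorem exists_piecewise_const (hΩ : interior (closure Ω) = Ω) (δ : Cell d → ℝ) :
    ∃ g : L2 Ω, ∀ K ∈ M.cells, ∀ᵐ x ∂volume.restrict K.dom, g x = δ K :=
  exists_glue hΩ (fun K _ => δ K) fun _ _ => memLp_const _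

/-- A broken field without jumps in the interior of the domain is in `H(div, Ω)`. -/
theorem IsBrokenFlux.hasWeakDiv (hd : 0 < d) (hΩ : interior (closure Ω) = Ω) {v : Pt d → Pt d}
    (hv : MemLp v 2 (volume.restrict Ω)) {δ : Cell d → ℝ} {c : Cell d → Set (Pt d) → ℝ}
    (h : M.IsBrokenFlux v δ c) (hj : ∀ᵐ x ∂surf M.skeleton, x ∈ Ω → M.jump c x = 0) :
    ∃ g : L2 Ω, HasWeakDiv Ω v g := by
  obtain ⟨g, hg⟩ := M.exists_piecewise_const hΩ δ
  refine ⟨g, fun φ hφ hc hs => ?_⟩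
  have h2 := sum_eq_of_ae_const hΩ hv hg hφ hc
  rw [green_broken hd h hφ hc] at h2
  have h3 : ∫ x, M.jump c x * φ x ∂surf M.skeleton = 0 := by
    rw [integral_congr_ae (g := fun _ => 0), integral_zero]
    filter_upwards [hj] with x hx
    by_cases hxΩ : x ∈ Ω
    · rw [hx hxΩ, zero_mul]
    · rw [image_eq_zero_of_notMem_tsupport fun h => hxΩ (hs h), mul_zero]
  rw [h3] at h2
  linarith

end Mesh

/-- The position vector is in `H(div)`, with divergence `d`. -/
theorem integral_inner_id_gradient {U : Set (Pt d)} {φ : Pt d → ℝ}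
    (hφ : ContDiff ℝ ∞ φ) (hc : HasCompactSupport φ) (hs : tsupport φ ⊆ U) :
    ∫ x in U, inner ℝ x (gradient φ x) = - ((d : ℝ) * ∫ x in U, φ x) := by
  have e1 : ∫ x in U, inner ℝ x (gradient φ x) = ∫ x, inner ℝ x (gradient φ x) := by
    refine setIntegral_eq_integral_of_forall_compl_eq_zero fun x hx => ?_
    rw [inner_gradient, fderiv_of_notMem_tsupport ℝ fun h => hx (hs h)]; rfl
  have e2 : ∫ x in U, φ x = ∫ x, φ x :=
    setIntegral_eq_integral_of_forall_compl_eq_zero fun x hx =>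
      image_eq_zero_of_notMem_tsupport fun h => hx (hs h)
  have hfc : Continuous (fderiv ℝ φ) := hφ.continuous_fderiv (by simp)
  have hfs : HasCompactSupport (fderiv ℝ φ) := hc.fderiv ℝ
  have hint : ∀ i : Fin d, Integrable
      (fun x : Pt d => x i * fderiv ℝ φ x (EuclideanSpace.single i 1)) := fun i => by
    refine Continuous.integrable_of_hasCompactSupport (by fun_prop) ?_
    have : HasCompactSupport fun x : Pt d => fderiv ℝ φ x (EuclideanSpace.single i 1) :=
      hfs.comp_left (g := fun L : Pt d →L[ℝ] ℝ => L (EuclideanSpace.single i 1)) rfl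
    exact this.mul_left
  have e3 : ∀ x : Pt d, inner ℝ x (gradient φ x)
      = ∑ i, x i * fderiv ℝ φ x (EuclideanSpace.single i 1) := fun x => by
    rw [inner_gradient]
    have hx : x = ∑ i, x i • EuclideanSpace.single i (1 : ℝ) := by
      have := (EuclideanSpace.basisFun (Fin d) ℝ).sum_repr x
      simpa using this.symm
    rw [congrArg (fderiv ℝ φ x) hx, _root_.map_sum]
    simp only [map_smul, smul_eq_mul]
  have e4 : ∀ i : Fin d, ∫ x : Pt d, x i * fderiv ℝ φ x (EuclideanSpace.single i 1)
      = - ∫ x, φ x := fun i => by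
    have hproj : ∀ x : Pt d, HasFDerivAt (fun y : Pt d => y i)
        (EuclideanSpace.proj (𝕜 := ℝ) i : Pt d →L[ℝ] ℝ) x :=
      fun x => (EuclideanSpace.proj (𝕜 := ℝ) i : Pt d →L[ℝ] ℝ).hasFDerivAt
    have h1 : ∀ x : Pt d, fderiv ℝ (fun y : Pt d => y i) x (EuclideanSpace.single i 1) = 1 :=
      fun x => by rw [(hproj x).fderiv]; simp
    have := integral_mul_fderiv_eq_neg_fderiv_mul_of_integrable (μ := (volume : Measure (Pt d)))
      (f := fun y : Pt d => y i) (g := φ) (v := EuclideanSpace.single i 1)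
      (by simp only [h1, one_mul]; exact hφ.continuous.integrable_of_hasCompactSupport hc)
      (hint i)
      (by refine Continuous.integrable_of_hasCompactSupport ?_ hc.mul_left
          have := hφ.continuous
          fun_prop)
      (fun x _ => (hproj x).differentiableAt) (fun x _ => (hφ.differentiable (by simp)) x)
    simpa only [h1, one_mul] using this
  rw [e1, e2]
  simp only [e3]
  rw [integral_finsetSum _ fun i _ => hint i]
  simp only [e4, Finset.sum_const, Finset.card_univ, Fintype.card_fin, nsmul_eq_mul]
  ring

namespace Mesh

/-- By conformity almost every point of `e` lies on no other face of the mesh, so at most the term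
of `e` survives in the sum. -/
theorem faceFun_ae (hd : 0 < d) {K : Cell d} (hK : K ∈ M.cells) {e : Set (Pt d)}
    (he : e ∈ K.faces) {L : Cell d} (hL : L ∈ M.cells) (c : Set (Pt d) → ℝ) :
    ∀ᵐ x ∂surf e, (e ∈ L.faces → faceFun L c x = c e) ∧ (e ∉ L.faces → faceFun L c x = 0) := by
  filter_upwards [ae_notMem_face hd hK he,
    ae_restrict_mem (Cell.isCompact_face hd he).isClosed.measurableSet] with x hx hxe
  constructor
  · intro heL
    rw [faceFun, Finset.sum_eq_single e]
    · exact indicator_of_mem hxe _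
    · exact fun e' he' hne => indicator_of_notMem (hx L hL e' (Cell.mem_faceSet.1 he') hne) _
    · exact fun h => absurd (Cell.mem_faceSet.2 heL) h
  · intro heL
    refine Finset.sum_eq_zero fun e' he' => indicator_of_notMem ?_ _
    refine hx L hL e' (Cell.mem_faceSet.1 he') ?_
    rintro rfl
    exact heL (Cell.mem_faceSet.1 he')

theorem exists_jump_ae_const (hd : 0 < d) {K : Cell d} (hK : K ∈ M.cells) {e : Set (Pt d)}
    (he : e ∈ K.faces) (c : Cell d → Set (Pt d) → ℝ) :
    ∃ a : ℝ, ∀ᵐ x ∂surf e, M.jump c x = a := by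
  classical
  refine ⟨∑ L ∈ M.cells, if e ∈ L.faces then c L e else 0, ?_⟩
  have : ∀ᵐ x ∂surf e, ∀ L ∈ M.cells, faceFun L (c L) x = if e ∈ L.faces then c L e else 0 := by
    refine (ae_ball_iff M.cells.countable_toSet).2 fun L hL => ?_
    filter_upwards [faceFun_ae hd hK he hL (c L)] with x hx
    split_ifs with h
    · exact hx.1 h
    · exact hx.2 h
  filter_upwards [this] with x hx
  exact Finset.sum_congr rfl hx

end Mesh

end GlobalFields

/-! ### Abstract hybridization in finite dimension -/

section AbstractHybrid

open Module

/-- A saddle point operator is surjective as soon as it is injective. -/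
theorem exists_saddle {V W : Type*} [AddCommGroup V] [Module ℝ V] [AddCommGroup W] [Module ℝ W]
    [FiniteDimensional ℝ V] [FiniteDimensional ℝ W] (a : V →ₗ[ℝ] Dual ℝ V)
    (b : V →ₗ[ℝ] Dual ℝ W)
    (h : ∀ u w, (∀ τ, a u τ + b τ w = 0) → (∀ w', b u w' = 0) → u = 0 ∧ w = 0)
    (F : Dual ℝ W) : ∃ u w, (∀ τ, a u τ + b τ w = 0) ∧ b u = F := by
  let S : (V × W) →ₗ[ℝ] (Dual ℝ V × Dual ℝ W) :=
    ((a.comp (LinearMap.fst ℝ V W)) + (b.flip.comp (LinearMap.snd ℝ V W))).prod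
      (b.comp (LinearMap.fst ℝ V W))
  have hS : Function.Injective S := by
    rw [injective_iff_map_eq_zero]
    rintro ⟨u, w⟩ huw
    have h1 : a u + b.flip w = 0 := congrArg Prod.fst huw
    have h2 : b u = 0 := congrArg Prod.snd huw
    obtain ⟨rfl, rfl⟩ := h u w (fun τ => LinearMap.congr_fun h1 τ)
      (fun w' => LinearMap.congr_fun h2 w')
    rfl
  have hdim : finrank ℝ (V × W) = finrank ℝ (Dual ℝ V × Dual ℝ W) := by
    simp [Subspace.dual_finrank_eq]
  obtain ⟨⟨u, w⟩, huw⟩ := (LinearMap.injective_iff_surjective_of_finrank_eq_finrank hdim).1 hS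
    (0, F)
  have h1 : a u + b.flip w = 0 := congrArg Prod.fst huw
  exact ⟨u, w, fun τ => LinearMap.congr_fun h1 τ, congrArg Prod.snd huw⟩

/-- A functional vanishing on the common kernel of the functionals `B w` is one of them. -/
theorem exists_eq_of_vanishing {V W : Type*} [AddCommGroup V] [Module ℝ V] [AddCommGroup W]
    [Module ℝ W] [FiniteDimensional ℝ V] (B : W →ₗ[ℝ] Dual ℝ V) (ℓ : Dual ℝ V)
    (h : ∀ τ, (∀ w, B w τ = 0) → ℓ τ = 0) : ∃ w, B w = ℓ := by
  have : ℓ ∈ (LinearMap.range B).dualCoannihilator.dualAnnihilator := by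
    rw [Submodule.mem_dualAnnihilator]
    intro τ hτ
    rw [Submodule.mem_dualCoannihilator] at hτ
    exact h τ fun w => hτ _ ⟨w, rfl⟩
  rw [Subspace.dualCoannihilator_dualAnnihilator_eq] at this
  exact this

variable {E G H : Type*} [NormedAddCommGroup E] [InnerProductSpace ℝ E]
  [NormedAddCommGroup G] [InnerProductSpace ℝ G] [NormedAddCommGroup H] [InnerProductSpace ℝ H]

/-- The data of a hybridized expanded mixed method: a coefficient operator `A` mapping the gradients
`X` onto the broken velocities `V`, the broken divergence `D` and the jump `N`, and spaces of
scalars `Q` and multipliers `P` controlled by `D` and `N`. -/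
structure IsHybridData (X V : Submodule ℝ E) (Q : Submodule ℝ G) (P : Submodule ℝ H)
    (A : E →ₗ[ℝ] E) (D : V →ₗ[ℝ] G) (N : V →ₗ[ℝ] H) : Prop where
  finite : FiniteDimensional ℝ X
  eq_zero : ∀ u, inner ℝ (A u) u = 0 → u = 0
  map_eq : V = X.map (-A)
  inf_sup : ∀ p ∈ Q, ∀ l ∈ P, (∀ τ, inner ℝ p (D τ) = inner ℝ (N τ) l) → p = 0 ∧ l = 0

variable {X V : Submodule ℝ E} {Q : Submodule ℝ G} {P : Submodule ℝ H}
    {A : E →ₗ[ℝ] E} {D : V →ₗ[ℝ] G} {N : V →ₗ[ℝ] H}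

variable (Q P A D N) in
/-- The hybridized problem. -/
def IsHybrid (f : G) (θ : X) (u : V) (p : Q) (l : P) : Prop :=
  (∀ ξ : X, inner ℝ (A θ) (ξ : E) + inner ℝ (u : E) (ξ : E) = 0) ∧
  (∀ τ : V, inner ℝ (θ : E) (τ : E) + inner ℝ (p : G) (D τ) = inner ℝ (N τ) (l : H)) ∧
  (∀ q : Q, inner ℝ (D u) (q : G) = inner ℝ f (q : G)) ∧
  ∀ π : P, inner ℝ (N u) (π : H) = 0

variable (Q P A D N) in
/-- The mixed problem on the velocities without jumps. -/
def IsMixed (f : G) (θ : X) (u : V) (p : Q) : Prop :=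
  (∀ ξ : X, inner ℝ (A θ) (ξ : E) + inner ℝ (u : E) (ξ : E) = 0) ∧
  (∀ τ : V, (∀ π : P, inner ℝ (N τ) (π : H) = 0) →
    inner ℝ (θ : E) (τ : E) + inner ℝ (p : G) (D τ) = 0) ∧
  (∀ q : Q, inner ℝ (D u) (q : G) = inner ℝ f (q : G)) ∧
  ∀ π : P, inner ℝ (N u) (π : H) = 0

theorem IsHybrid.isMixed {f : G} {θ : X} {u : V} {p : Q} {l : P}
    (h : IsHybrid Q P A D N f θ u p l) :
    IsMixed Q P A D N f θ u p :=
  ⟨h.1, fun τ hτ => by rw [h.2.1 τ, hτ l], h.2.2.1, h.2.2.2⟩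

theorem IsHybridData.finite_vel (hX : IsHybridData X V Q P A D N) : FiniteDimensional ℝ V := by
  have := hX.finite
  rw [hX.map_eq]
  infer_instance

/-- Each mixed solution extends to a hybrid solution. -/
theorem IsMixed.exists_isHybrid (hX : IsHybridData X V Q P A D N) {f : G} {θ : X} {u : V} {p : Q}
    (h : IsMixed Q P A D N f θ u p) : ∃ l : P, IsHybrid Q P A D N f θ u p l := by
  have := hX.finite_vel
  -- The second mixed equation says that `τ ↦ (θ, τ) + (p, D τ)` vanishes wherever all functionals
  -- `τ ↦ (N τ, l)` do. The functional is therefore one of them, and its representative is the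
  -- multiplier.
  obtain ⟨l, hl⟩ := exists_eq_of_vanishing
    (((innerₗ H).flip.compl₂ N).comp P.subtype : P →ₗ[ℝ] Dual ℝ V)
    ((innerₗ E (θ : E)).comp V.subtype + (innerₗ G (p : G)).comp D) h.2.1
  exact ⟨l, h.1, fun τ => (LinearMap.congr_fun hl τ).symm, h.2.2.1, h.2.2.2⟩

/-- Since `u = -A η` for some `η` in `X`, the equation says that `A (θ - η)` is orthogonal to `X`;
it is tested with `θ - η`. -/
theorem IsHybridData.velocity_eq (hX : IsHybridData X V Q P A D N) {θ : X} {u : V}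
    (h : ∀ ξ : X, inner ℝ (A θ) (ξ : E) + inner ℝ (u : E) (ξ : E) = 0) : (u : E) = -A θ := by
  have hu : (u : E) ∈ X.map (-A) := hX.map_eq ▸ u.2
  obtain ⟨η, hη, hu⟩ := hu
  have h1 := h (θ - ⟨η, hη⟩)
  rw [← hu, LinearMap.neg_apply, inner_neg_left, ← sub_eq_add_neg, ← inner_sub_left,
    ← _root_.map_sub] at h1
  have h2 := hX.eq_zero _ h1
  rw [← hu, sub_eq_zero.1 h2]
  rfl

/-- The velocity `-A ξ` of a gradient `ξ`. -/
def IsHybridData.vel (hX : IsHybridData X V Q P A D N) : X →ₗ[ℝ] V :=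
  ((-A).comp X.subtype).codRestrict V fun ξ => by
    rw [hX.map_eq]
    exact ⟨ξ, ξ.2, rfl⟩

theorem IsHybridData.coe_vel (hX : IsHybridData X V Q P A D N) (ξ : X) :
    (hX.vel ξ : E) = -A ξ := rfl

theorem IsHybridData.vel_surjective (hX : IsHybridData X V Q P A D N) :
    Function.Surjective hX.vel := fun τ => by
  have hτ : (τ : E) ∈ X.map (-A) := hX.map_eq ▸ τ.2
  obtain ⟨ξ, hξ, h⟩ := hτ
  exact ⟨⟨ξ, hξ⟩, Subtype.ext h⟩

/-- The energy argument: testing the second equation with `u` removes the terms in `p` and `l` by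
the last two equations and leaves `(θ, A θ) = 0`. The inf-sup condition then disposes of `p` and
`l`. -/
theorem IsHybridData.eq_zero_of_isHybrid (hX : IsHybridData X V Q P A D N) {θ : X} {u : V} {p : Q}
    {l : P} (h : IsHybrid Q P A D N 0 θ u p l) : θ = 0 ∧ u = 0 ∧ p = 0 ∧ l = 0 := by
  have hu := hX.velocity_eq h.1
  have h1 := h.2.1 u
  rw [h.2.2.2 l, real_inner_comm _ (p : G), h.2.2.1 p, inner_zero_left, add_zero, hu,
    inner_neg_right, neg_eq_zero, real_inner_comm] at h1
  have hθ : θ = 0 := Subtype.ext (hX.eq_zero _ h1)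
  have hu0 : u = 0 := Subtype.ext (by rw [hu, hθ]; simp)
  have h2 := hX.inf_sup p p.2 l l.2 fun τ => by
    have := h.2.1 τ
    rwa [hθ, ZeroMemClass.coe_zero, inner_zero_left, zero_add] at this
  exact ⟨hθ, hu0, Subtype.ext h2.1, Subtype.ext h2.2⟩

theorem IsHybrid.sub {f g : G} {θ θ' : X} {u u' : V} {p p' : Q} {l l' : P}
    (h : IsHybrid Q P A D N f θ u p l) (h' : IsHybrid Q P A D N g θ' u' p' l') :
    IsHybrid Q P A D N (f - g) (θ - θ') (u - u') (p - p') (l - l') := by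
  obtain ⟨h1, h2, h3, h4⟩ := h
  obtain ⟨h1', h2', h3', h4'⟩ := h'
  refine ⟨fun ξ => ?_, fun τ => ?_, fun q => ?_, fun π => ?_⟩
  · have := h1 ξ
    have := h1' ξ
    simp only [AddSubgroupClass.coe_sub, _root_.map_sub, inner_sub_left]
    linarith
  · have := h2 τ
    have := h2' τ
    simp only [AddSubgroupClass.coe_sub, inner_sub_left, inner_sub_right]
    linarith
  · simp only [_root_.map_sub, inner_sub_left, h3, h3']
  · simp only [_root_.map_sub, inner_sub_left, h4, h4', sub_zero]

theorem IsHybridData.unique (hX : IsHybridData X V Q P A D N) {f : G} {θ θ' : X} {u u' : V}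
    {p p' : Q} {l l' : P} (h : IsHybrid Q P A D N f θ u p l)
    (h' : IsHybrid Q P A D N f θ' u' p' l') : θ = θ' ∧ u = u' ∧ p = p' ∧ l = l' := by
  have h0 := h.sub h'
  rw [sub_self] at h0
  obtain ⟨h1, h2, h3, h4⟩ := hX.eq_zero_of_isHybrid h0
  exact ⟨sub_eq_zero.1 h1, sub_eq_zero.1 h2, sub_eq_zero.1 h3, sub_eq_zero.1 h4⟩

/-- Eliminating `u = -A θ`, and replacing `τ` by `-A ξ`, leaves a square saddle point system on `X`
and `Q × P`, whose injectivity is the uniqueness already proved. -/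
theorem IsHybridData.exists_isHybrid (hX : IsHybridData X V Q P A D N) (f : G) :
    ∃ (θ : X) (u : V) (p : Q) (l : P), IsHybrid Q P A D N f θ u p l := by
  have := hX.finite
  have := hX.finite_vel
  let b₀ : V →ₗ[ℝ] Dual ℝ (Q × P) :=
    (((innerₗ G).comp D).compl₂ (Q.subtype.comp (LinearMap.fst ℝ Q P)))
      - (((innerₗ H).comp N).compl₂ (P.subtype.comp (LinearMap.snd ℝ Q P)))
  have hb₀ : ∀ τ (w : Q × P), b₀ τ w = inner ℝ (D τ) (w.1 : G) - inner ℝ (N τ) (w.2 : H) :=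
    fun _ _ => rfl
  -- Scalars and multipliers are not assumed finite-dimensional: the inf-sup condition embeds them
  -- in the dual of `V`.
  have hfin : FiniteDimensional ℝ (Q × P) := by
    refine Module.Finite.of_injective b₀.flip ?_
    rw [injective_iff_map_eq_zero]
    rintro ⟨p, l⟩ hpl
    have := hX.inf_sup p p.2 l l.2 fun τ => by
      have h1 : b₀ τ (p, l) = 0 := LinearMap.congr_fun hpl τ
      rw [hb₀, sub_eq_zero] at h1
      rw [real_inner_comm]
      exact h1
    exact Prod.ext (Subtype.ext this.1) (Subtype.ext this.2)
  let a : X →ₗ[ℝ] Dual ℝ X := ((innerₗ E).comp X.subtype).compl₂ (V.subtype.comp hX.vel)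
  have ha : ∀ θ ξ, a θ ξ = inner ℝ (θ : E) (hX.vel ξ : E) := fun _ _ => rfl
  have key : ∀ {θ : X} {p : Q} {l : P} {g : G}, (∀ ξ, a θ ξ + (b₀.comp hX.vel) ξ (p, l) = 0) →
      (∀ w : Q × P, (b₀.comp hX.vel) θ w = inner ℝ g (w.1 : G)) →
      IsHybrid Q P A D N g θ (hX.vel θ) p l := by
    intro θ p l g h1 h2
    refine ⟨fun ξ => ?_, fun τ => ?_, fun q => ?_, fun π => ?_⟩
    · rw [hX.coe_vel, inner_neg_left, add_neg_cancel]
    · obtain ⟨ξ, rfl⟩ := hX.vel_surjective τ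
      have := h1 ξ
      rw [ha, LinearMap.comp_apply, hb₀] at this
      rw [real_inner_comm _ (p : G)]
      linarith
    · have := h2 (q, 0)
      rwa [LinearMap.comp_apply, hb₀, ZeroMemClass.coe_zero, inner_zero_right, sub_zero] at this
    · have := h2 (0, π)
      rwa [LinearMap.comp_apply, hb₀, ZeroMemClass.coe_zero, inner_zero_right, inner_zero_right,
        zero_sub, neg_eq_zero] at this
  obtain ⟨θ, ⟨p, l⟩, h1, h2⟩ := exists_saddle a (b₀.comp hX.vel) (fun θ w h1 h2 => by
    obtain ⟨p, l⟩ := w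
    have := hX.eq_zero_of_isHybrid (key h1 fun w => by rw [h2, inner_zero_left])
    exact ⟨this.1, Prod.ext this.2.2.1 this.2.2.2⟩)
    ((innerₗ G f).comp (Q.subtype.comp (LinearMap.fst ℝ Q P)))
  exact ⟨θ, hX.vel θ, p, l, key h1 fun w => by rw [h2]; rfl⟩

end AbstractHybrid

/-! ### Broken spaces on the whole domain -/

section BrokenSpaces

variable {d : ℕ} {Ω : Set (Pt d)} {M : Mesh Ω} {k : Pt d → Pt d →L[ℝ] Pt d} {kmin kmax : ℝ}

namespace Mesh

theorem ae_dom_of_ae (hΩ : interior (closure Ω) = Ω) {K : Cell d} (hK : K ∈ M.cells)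
    {p : Pt d → Prop} (h : ∀ᵐ x ∂volume.restrict Ω, p x) : ∀ᵐ x ∂volume.restrict K.dom, p x :=
  ae_mono (restrict_mono (dom_subset hΩ hK) le_rfl) h

variable {F : Type*} [NormedAddCommGroup F] [NormedSpace ℝ F]

/-- The fields on `Ω` whose restriction to each cell `K` is in `W K`. -/
def brokenSpace (M : Mesh Ω) (hΩ : interior (closure Ω) = Ω)
    (W : ∀ K : Cell d, Submodule ℝ (Lp F 2 ((volume : Measure (Pt d)).restrict K.dom))) :
    Submodule ℝ (Lp F 2 ((volume : Measure (Pt d)).restrict Ω)) where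
  carrier := {u | ∀ K ∈ M.cells, ∃ w ∈ W K, ∀ᵐ x ∂(volume.restrict K.dom), u x = w x}
  add_mem' := fun {u v} hu hv K hK => by
    obtain ⟨w, hw, h⟩ := hu K hK
    obtain ⟨w', hw', h'⟩ := hv K hK
    refine ⟨w + w', (W K).add_mem hw hw', ?_⟩
    filter_upwards [h, h', ae_dom_of_ae hΩ hK (Lp.coeFn_add u v), Lp.coeFn_add w w']
      with x h1 h2 h3 h4
    rw [h3, h4, Pi.add_apply, Pi.add_apply, h1, h2]
  zero_mem' := fun K hK => by
    refine ⟨0, (W K).zero_mem, ?_⟩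
    filter_upwards [ae_dom_of_ae hΩ hK (Lp.coeFn_zero F 2 (volume.restrict Ω)),
      Lp.coeFn_zero F 2 (volume.restrict K.dom)] with x h1 h2
    rw [h1, h2]
  smul_mem' := fun a u hu K hK => by
    obtain ⟨w, hw, h⟩ := hu K hK
    refine ⟨a • w, (W K).smul_mem a hw, ?_⟩
    filter_upwards [h, ae_dom_of_ae hΩ hK (Lp.coeFn_smul a u), Lp.coeFn_smul a w]
      with x h1 h2 h3
    rw [h2, h3, Pi.smul_apply, Pi.smul_apply, h1]

/-- Restriction of square-integrable functions to a cell. -/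
def restrictCell (hΩ : interior (closure Ω) = Ω) {K : Cell d} (hK : K ∈ M.cells) :
    Lp F 2 ((volume : Measure (Pt d)).restrict Ω) →ₗ[ℝ]
      Lp F 2 ((volume : Measure (Pt d)).restrict K.dom) where
  toFun u := (memLp_restrict_dom hΩ hK (Lp.memLp u)).toLp
  map_add' u v := by
    rw [← MemLp.toLp_add]
    exact (MemLp.toLp_eq_toLp_iff _ _).2 (ae_dom_of_ae hΩ hK (Lp.coeFn_add u v))
  map_smul' a u := by
    rw [RingHom.id_apply, ← MemLp.toLp_const_smul]
    exact (MemLp.toLp_eq_toLp_iff _ _).2 (ae_dom_of_ae hΩ hK (Lp.coeFn_smul a u))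

theorem restrictCell_ae (hΩ : interior (closure Ω) = Ω) {K : Cell d} (hK : K ∈ M.cells)
    (u : Lp F 2 ((volume : Measure (Pt d)).restrict Ω)) :
    restrictCell hΩ hK u =ᵐ[volume.restrict K.dom] u :=
  (memLp_restrict_dom hΩ hK (Lp.memLp u)).coeFn_toLp

theorem finiteDimensional_brokenSpace (hΩ : interior (closure Ω) = Ω)
    (W : ∀ K : Cell d, Submodule ℝ (Lp F 2 ((volume : Measure (Pt d)).restrict K.dom)))
    (hW : ∀ K ∈ M.cells, FiniteDimensional ℝ (W K)) :
    FiniteDimensional ℝ (M.brokenSpace hΩ W) := by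
  have (K : M.cells) : FiniteDimensional ℝ (W K) := hW K K.2
  have hmem : ∀ (K : M.cells) (u : M.brokenSpace hΩ W),
      (restrictCell hΩ K.2 ∘ₗ (M.brokenSpace hΩ W).subtype) u ∈ W K := fun K u => by
    obtain ⟨w, hw, h⟩ := u.2 K K.2
    have : restrictCell hΩ K.2 (u : Lp F 2 ((volume : Measure (Pt d)).restrict Ω)) = w :=
      Lp.ext ((restrictCell_ae hΩ K.2 _).trans h)
    rw [LinearMap.comp_apply, Submodule.subtype_apply, this]
    exact hw
  refine Module.Finite.of_injective (LinearMap.pi fun K : M.cells =>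
    LinearMap.codRestrict (W K) _ (hmem K)) ?_
  intro u v huv
  refine Subtype.ext (ext_of_cells (M := M) hΩ fun K hK => ?_)
  have h1 : restrictCell hΩ hK (u : Lp F 2 ((volume : Measure (Pt d)).restrict Ω))
      = restrictCell hΩ hK (v : Lp F 2 ((volume : Measure (Pt d)).restrict Ω)) :=
    congrArg Subtype.val (congrFun huv ⟨K, hK⟩)
  have h2 := restrictCell_ae hΩ hK (u : Lp F 2 ((volume : Measure (Pt d)).restrict Ω))
  rw [h1] at h2
  exact h2.symm.trans (restrictCell_ae hΩ hK _)

theorem isCoeff_dom (hΩ : interior (closure Ω) = Ω) (hk : IsCoeff k Ω kmin kmax) {K : Cell d}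
    (hK : K ∈ M.cells) : IsCoeff k K.dom kmin kmax :=
  hk.mono K.isOpen_dom.measurableSet (dom_subset hΩ hK)

/-- The coefficient acts pointwise and the broken spaces impose no coupling between cells, so the
identity on each cell glues. -/
theorem brokenSpace_velSpan_eq_map (hd : 0 < d) (hΩ : interior (closure Ω) = Ω)
    (hk : IsCoeff k Ω kmin kmax) :
    M.brokenSpace hΩ (velSpan k)
      = (M.brokenSpace hΩ (gradSpan k)).map (-(coeffOp hk).toLinearMap) := by
  have hneg : ∀ {U : Set (Pt d)} (hU : IsCoeff k U kmin kmax) (η : L2V U),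
      (-(coeffOp hU).toLinearMap) η =ᵐ[volume.restrict U] fun x => -k x (η x) := fun hU η => by
    filter_upwards [Lp.coeFn_neg (coeffOp hU η), coeffOp_ae hU η] with x h1 h2
    change (-(coeffOp hU η) : L2V _) x = _
    rw [h1, Pi.neg_apply, h2]
  ext u
  constructor
  · intro hu
    have : ∀ K : Cell d, ∃ η : L2V K.dom, K ∈ M.cells → η ∈ gradSpan k K ∧
        ∀ᵐ x ∂volume.restrict K.dom, u x = -k x (η x) := fun K => by
      by_cases hK : K ∈ M.cells
      · obtain ⟨w, hw, h⟩ := hu K hK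
        rw [velSpan_eq_map hd (isCoeff_dom hΩ hk hK)] at hw
        obtain ⟨η, hη, rfl⟩ := hw
        exact ⟨η, fun _ => ⟨hη, Filter.EventuallyEq.trans h (hneg (isCoeff_dom hΩ hk hK) η)⟩⟩
      · exact ⟨0, fun h => absurd h hK⟩
    choose η hη using this
    obtain ⟨θ, hθ⟩ := M.exists_glue hΩ (fun K => η K) fun K _ => Lp.memLp (η K)
    refine ⟨θ, fun K hK => ⟨η K, (hη K hK).1, hθ K hK⟩, ?_⟩
    refine ext_of_cells (M := M) hΩ fun K hK => ?_
    filter_upwards [(hη K hK).2, hθ K hK, ae_dom_of_ae hΩ hK (hneg hk θ)] with x h1 h2 h3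
    rw [h3, h2, h1]
  · rintro ⟨θ, hθ, rfl⟩ K hK
    obtain ⟨η, hη, h⟩ := hθ K hK
    refine ⟨(-(coeffOp (isCoeff_dom hΩ hk hK)).toLinearMap) η, ?_, ?_⟩
    · rw [velSpan_eq_map hd (isCoeff_dom hΩ hk hK)]
      exact ⟨η, hη, rfl⟩
    · filter_upwards [h, hneg (isCoeff_dom hΩ hk hK) η, ae_dom_of_ae hΩ hK (hneg hk θ)]
        with x h1 h2 h3
      rw [h3, h2, h1]

theorem exists_isBrokenFlux (hd : 0 < d) (hΩ : interior (closure Ω) = Ω)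
    (hk : IsCoeff k Ω kmin kmax) {u : L2V Ω} (hu : u ∈ M.brokenSpace hΩ (velSpan k)) :
    ∃ δ c, M.IsBrokenFlux u δ c := by
  have : ∀ K : Cell d, ∃ δ c, K ∈ M.cells → HasFlux K u δ c := fun K => by
    by_cases hK : K ∈ M.cells
    · obtain ⟨w, hw, h⟩ := hu K hK
      obtain ⟨δ, c, hw⟩ := exists_hasFlux_of_mem_velSpan hd (isCoeff_dom hΩ hk hK) hw
      exact ⟨δ, c, fun _ => hw.congr (Filter.EventuallyEq.symm h)⟩
    · exact ⟨0, 0, fun h => absurd h hK⟩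
  choose δ c h using this
  exact ⟨δ, c, fun K hK => h K hK⟩

end Mesh

variable {K : Cell d}

theorem HasFlux.congr_flux {v : Pt d → Pt d} {δ : ℝ} {c c' : Set (Pt d) → ℝ} (h : HasFlux K v δ c)
    (hc : ∀ e ∈ K.faces, c e = c' e) : HasFlux K v δ c' := by
  refine ⟨h.1, fun φ hφ hs => ?_⟩
  rw [h.2 φ hφ hs]
  exact Finset.sum_congr rfl fun e he => by rw [hc e (Cell.mem_faceSet.1 he)]

/-- The local velocity space contains a field with any prescribed constant face fluxes. -/
theorem exists_mem_velSpan_of_flux (hd : 0 < d) (hk : IsCoeff k K.dom kmin kmax)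
    (a : Set (Pt d) → ℝ) : ∃ w ∈ velSpan k K, ∃ δ, HasFlux K w δ a := by
  classical
  have hbasis : ∀ e : K.faceSet, ∃ w ∈ velSpan k K, ∃ δ,
      HasFlux K w δ (Pi.single (e : Set (Pt d)) 1) :=
    fun e => by
      obtain ⟨χ, hχ, δ, h⟩ := exists_RT0_hasFlux hd (Cell.mem_faceSet.1 e.2)
      obtain ⟨w, hw, h⟩ := exists_mem_velSpan_hasFlux hd hk hχ h
      exact ⟨w, hw, δ, by convert h⟩
  choose w hw δ h using hbasis
  refine ⟨∑ e : K.faceSet, a e • w e, Submodule.sum_mem _ fun e _ => Submodule.smul_mem _ _ (hw e),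
    _, ((HasFlux.sum Finset.univ h fun e => a e).congr ?_).congr_flux ?_⟩
  · have h1 : ∀ᵐ x ∂volume.restrict K.dom, ∀ e : K.faceSet,
        (a e • w e : L2V K.dom) x = a e • w e x :=
      ae_all_iff.2 fun e => Lp.coeFn_smul (a e) (w e)
    filter_upwards [h1, Lp.coeFn_finsetSum Finset.univ fun e : K.faceSet => a e • w e] with x hx hx'
    rw [hx', Finset.sum_apply]
    exact Finset.sum_congr rfl fun e _ => (hx e).symm
  · intro e he
    rw [Finset.sum_eq_single ⟨e, Cell.mem_faceSet.2 he⟩]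
    · simp
    · intro e' _ hne
      rw [Pi.single_eq_of_ne, mul_zero]
      exact fun h => hne (Subtype.ext h.symm)
    · exact fun h => absurd (Finset.mem_univ _) h

theorem Cell.hausdorff_face_pos (hd : 0 < d) {e : Set (Pt d)} (he : e ∈ K.faces) :
    0 < (μHE[d - 1] : Measure (Pt d)).real e := by
  obtain ⟨x, hx⟩ := Cell.face_nonempty hd he
  have := Cell.hausdorff_face_inter_pos hd he hx isOpen_univ (mem_univ x)
  rw [inter_univ] at this
  exact ENNReal.toReal_pos this.ne' (Cell.hausdorff_face_lt_top hd he).ne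

/-- The divergence theorem. -/
theorem HasFlux.sum_flux {v : Pt d → Pt d} {δ : ℝ} {c : Set (Pt d) → ℝ} (hd : 0 < d)
    (h : HasFlux K v δ c) :
    δ * volume.real K.dom = ∑ e ∈ K.faceSet, c e * (μHE[d - 1] : Measure (Pt d)).real e := by
  -- Green's formula with a test function equal to one on the cell.
  obtain ⟨φ, hφ, hc, h1⟩ := exists_cutoff K.isCompact_carrier
  have h2 := h.2 φ hφ hc
  have e1 : ∫ x in K.dom, inner ℝ (v x) (gradient φ x) = 0 := by
    rw [setIntegral_congr_fun K.isOpen_dom.measurableSet (g := fun _ => 0), integral_zero]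
    intro x hx
    simp only [(h1 x (K.dom_subset hx)).2, inner_zero_right]
  have e2 : ∫ x in K.dom, φ x = volume.real K.dom := by
    rw [setIntegral_congr_fun K.isOpen_dom.measurableSet (g := fun _ => 1)]
    · simp
    · exact fun x hx => (h1 x (K.dom_subset hx)).1
  rw [e1, e2, zero_add] at h2
  rw [h2]
  refine Finset.sum_congr rfl fun e he => ?_
  rw [setIntegral_congr_fun (Cell.isCompact_face hd (Cell.mem_faceSet.1 he)).isClosed.measurableSet
    (g := fun _ => 1)]
  · simp
  · exact fun x hx => (h1 x (Cell.face_subset_carrier hd (Cell.mem_faceSet.1 he) hx)).1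

namespace Mesh

theorem exists_velocity_of_flux (hd : 0 < d) (hΩ : interior (closure Ω) = Ω)
    (hk : IsCoeff k Ω kmin kmax) (a : Cell d → Set (Pt d) → ℝ) :
    ∃ u ∈ M.brokenSpace hΩ (velSpan k), ∃ δ, M.IsBrokenFlux u δ a := by
  have : ∀ K : Cell d, ∃ w : L2V K.dom, ∃ δ, K ∈ M.cells → w ∈ velSpan k K ∧
      HasFlux K w δ (a K) := fun K => by
    by_cases hK : K ∈ M.cells
    · obtain ⟨w, hw, δ, h⟩ := exists_mem_velSpan_of_flux hd (isCoeff_dom hΩ hk hK) (a K)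
      exact ⟨w, δ, fun _ => ⟨hw, h⟩⟩
    · exact ⟨0, 0, fun h => absurd h hK⟩
  choose w δ h using this
  obtain ⟨u, hu⟩ := M.exists_glue hΩ (fun K => w K) fun K _ => Lp.memLp (w K)
  exact ⟨u, fun K hK => ⟨w K, (h K hK).1, hu K hK⟩, δ,
    fun K hK => (h K hK).2.congr (Filter.EventuallyEq.symm (hu K hK))⟩

end Mesh

end BrokenSpaces

/-! ### The multiplier space and its duality with jumps -/

section MultiplierSpace

variable {d : ℕ} {Ω : Set (Pt d)} {M : Mesh Ω} {k : Pt d → Pt d →L[ℝ] Pt d} {kmin kmax : ℝ}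

open Classical in
theorem faceFun_single {K : Cell d} {e : Set (Pt d)} (he : e ∈ K.faces) (a : ℝ) (x : Pt d) :
    faceFun K (Pi.single e a) x = e.indicator (fun _ => a) x := by
  rw [faceFun, Finset.sum_eq_single e]
  · rw [Pi.single_eq_same]
  · intro e' _ hne
    rw [Pi.single_eq_of_ne hne]
    simp
  · exact fun h => absurd (Cell.mem_faceSet.2 he) h

theorem faceFun_zero (K : Cell d) (x : Pt d) : faceFun K 0 x = 0 :=
  Finset.sum_eq_zero fun e _ => by simp

namespace Mesh

theorem ae_face_of_ae_skeleton {p : Pt d → Prop} (hd : 0 < d) (h : ∀ᵐ x ∂surf M.skeleton, p x)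
    {K : Cell d} (hK : K ∈ M.cells) {e : Set (Pt d)} (he : e ∈ K.faces) :
    ∀ᵐ x ∂surf e, p x :=
  (ae_skeleton_iff hd).1 h K hK e he

theorem interface_or_boundary (hd : 0 < d) (hΩ : interior (closure Ω) = Ω) {K : Cell d}
    (hK : K ∈ M.cells) {e : Set (Pt d)} (he : e ∈ K.faces) :
    (∃ L ∈ M.cells, K ≠ L ∧ e ∈ L.faces) ∨ e ⊆ frontier Ω := by
  by_cases h : ∃ L ∈ M.cells, K ≠ L ∧ e ∈ L.faces
  · exact Or.inl h
  · push Not at h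
    exact Or.inr (face_subset_frontier hd hΩ hK he fun L hL hne => h L hL hne.symm)

/-- `v` is in `X_{2,h}` as soon as it is a broken velocity field without interior jumps. -/
theorem mem_X2_iff_jump (hd : 0 < d) (hΩ : interior (closure Ω) = Ω) {v : L2V Ω}
    (hv : v ∈ M.X2broken k) {δ : Cell d → ℝ} {c : Cell d → Set (Pt d) → ℝ}
    (h : M.IsBrokenFlux v δ c) :
    v ∈ M.X2 k ↔ ∀ᵐ x ∂surf M.skeleton, x ∈ Ω → M.jump c x = 0 :=
  ⟨fun hX => h.jump_ae_zero hd hΩ (Lp.memLp v) hX.1.hasWeakDiv,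
    fun hj => ⟨⟨Lp.memLp v, h.hasWeakDiv hd hΩ (Lp.memLp v) hj⟩, hv⟩⟩

open Classical in
/-- There is a velocity field in `X_{2,h}` with prescribed constant flux through one interface. -/
theorem exists_mem_X2_normalTrace (hd : 0 < d) (hΩ : interior (closure Ω) = Ω)
    (hk : IsCoeff k Ω kmin kmax) {K L : Cell d} (hK : K ∈ M.cells) (hL : L ∈ M.cells)
    (hKL : K ≠ L) {e : Set (Pt d)} (he : e ∈ K.faces) (he' : e ∈ L.faces) (a : ℝ) :
    ∃ v ∈ M.X2 k, ∀ᵐ x ∂surf e, normalTrace K.dom v x = a := by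
  -- Outward flux `a` from one side and `-a` from the other: the two cancel, so there is no jump
  -- anywhere.
  let c : Cell d → Set (Pt d) → ℝ :=
    fun J => if J = K then Pi.single e a else if J = L then Pi.single e (-a) else 0
  have hcK : c K = Pi.single e a := if_pos rfl
  have hcL : c L = Pi.single e (-a) := by
    simp only [c, if_neg hKL.symm, if_true]
  obtain ⟨v, hv, δ, h⟩ := exists_velocity_of_flux (M := M) hd hΩ hk c
  refine ⟨v, (mem_X2_iff_jump hd hΩ hv h).2 (ae_of_all _ fun x _ => ?_), ?_⟩
  · rw [jump, Finset.sum_eq_add K L hKL]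
    · rw [hcK, hcL, faceFun_single he, faceFun_single he']
      by_cases hx : x ∈ e
      · simp [hx]
      · simp [hx]
    · rintro J - ⟨hJK, hJL⟩
      have : c J = 0 := by simp only [c, if_neg hJK, if_neg hJL]
      rw [this, faceFun_zero]
    · exact fun h => absurd hK h
    · exact fun h => absurd hL h
  · filter_upwards [ae_mono (Cell.surf_face_le hd he) ((h K hK).normalTrace_ae hd),
      faceFun_ae hd hK he hK (c K)] with x h1 h2
    rw [h1, h2.1 he, hcK, Pi.single_eq_same]

/-- The multipliers are the functions that are constant on the interfaces and vanish on the boundary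
faces. -/
theorem mem_multipliers_iff (hd : 0 < d) (hΩ : interior (closure Ω) = Ω)
    (hk : IsCoeff k Ω kmin kmax) {π : Lp ℝ 2 (surf M.skeleton)} :
    π ∈ M.Multipliers k ↔
      (∀ K ∈ M.cells, ∀ L ∈ M.cells, K ≠ L → ∀ e ∈ K.faces, e ∈ L.faces →
        ∃ a : ℝ, ∀ᵐ x ∂surf e, π x = a) ∧
      (∀ K ∈ M.cells, ∀ e ∈ K.faces, e ⊆ frontier Ω → ∀ᵐ x ∂surf e, π x = 0) := by
  refine and_congr_left fun _ => ?_
  constructor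
  · intro h K hK L hL hKL e he he'
    obtain ⟨v, hv, hπ⟩ := h K hK L hL hKL e he he'
    obtain ⟨δ, c, hc⟩ := exists_isBrokenFlux (M := M) hd hΩ hk hv.2
    refine ⟨c K e, ?_⟩
    filter_upwards [hπ, ae_mono (Cell.surf_face_le hd he) ((hc K hK).normalTrace_ae hd),
      faceFun_ae hd hK he hK (c K)] with x h1 h2 h3
    rw [h1, h2, h3.1 he]
  · intro h K hK L hL hKL e he he'
    obtain ⟨a, ha⟩ := h K hK L hL hKL e he he'
    obtain ⟨v, hv, hva⟩ := exists_mem_X2_normalTrace hd hΩ hk hK hL hKL he he' a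
    refine ⟨v, hv, ?_⟩
    filter_upwards [ha, hva] with x h1 h2
    rw [h1, h2]

/-- The space of multipliers. -/
def multiplierSpace (M : Mesh Ω) (hd : 0 < d) (hΩ : interior (closure Ω) = Ω)
    (hk : IsCoeff k Ω kmin kmax) : Submodule ℝ (Lp ℝ 2 (surf M.skeleton)) where
  carrier := M.Multipliers k
  add_mem' := fun {π π'} h h' => by
    rw [mem_multipliers_iff hd hΩ hk] at *
    have key : ∀ K ∈ M.cells, ∀ e ∈ K.faces, ∀ᵐ x ∂surf e, (π + π') x = π x + π' x :=
      fun K hK e he => ae_face_of_ae_skeleton hd (Lp.coeFn_add π π') hK he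
    refine ⟨fun K hK L hL hKL e he he' => ?_, fun K hK e he hb => ?_⟩
    · obtain ⟨a, ha⟩ := h.1 K hK L hL hKL e he he'
      obtain ⟨b, hb⟩ := h'.1 K hK L hL hKL e he he'
      refine ⟨a + b, ?_⟩
      filter_upwards [ha, hb, key K hK e he] with x h1 h2 h3
      rw [h3, h1, h2]
    · filter_upwards [h.2 K hK e he hb, h'.2 K hK e he hb, key K hK e he] with x h1 h2 h3
      rw [h3, h1, h2, add_zero]
  zero_mem' := by
    rw [mem_multipliers_iff hd hΩ hk]
    have key : ∀ K ∈ M.cells, ∀ e ∈ K.faces, ∀ᵐ x ∂surf e, (0 : Lp ℝ 2 (surf M.skeleton)) x = 0 :=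
      fun K hK e he => ae_face_of_ae_skeleton hd (Lp.coeFn_zero ℝ 2 _) hK he
    exact ⟨fun K hK L hL hKL e he he' => ⟨0, key K hK e he⟩, fun K hK e he hb => key K hK e he⟩
  smul_mem' := fun s π h => by
    rw [mem_multipliers_iff hd hΩ hk] at *
    have key : ∀ K ∈ M.cells, ∀ e ∈ K.faces, ∀ᵐ x ∂surf e, (s • π) x = s * π x :=
      fun K hK e he => ae_face_of_ae_skeleton hd (Lp.coeFn_smul s π) hK he
    refine ⟨fun K hK L hL hKL e he he' => ?_, fun K hK e he hb => ?_⟩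
    · obtain ⟨a, ha⟩ := h.1 K hK L hL hKL e he he'
      refine ⟨s * a, ?_⟩
      filter_upwards [ha, key K hK e he] with x h1 h3
      rw [h3, h1]
    · filter_upwards [h.2 K hK e he hb, key K hK e he] with x h1 h3
      rw [h3, h1, mul_zero]

/-- The jumps of the broken velocities are controlled by the multipliers. -/
theorem mem_X2_iff_forall_integral (hd : 0 < d) (hΩ : interior (closure Ω) = Ω)
    (hk : IsCoeff k Ω kmin kmax) {v : L2V Ω} (hv : v ∈ M.X2broken k) {δ : Cell d → ℝ}
    {c : Cell d → Set (Pt d) → ℝ} (h : M.IsBrokenFlux v δ c) :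
    v ∈ M.X2 k ↔ ∀ π ∈ M.Multipliers k, ∫ x, M.jump c x * π x ∂surf M.skeleton = 0 := by
  rw [mem_X2_iff_jump hd hΩ hv h]
  have hΩo : IsOpen Ω := by rw [← hΩ]; exact isOpen_interior
  constructor
  · intro hj π hπ
    rw [integral_congr_ae (g := fun _ => 0), integral_zero]
    refine (ae_skeleton_iff hd).2 fun K hK e he => ?_
    rcases interface_or_boundary hd hΩ hK he with ⟨L, hL, hKL, he'⟩ | hb
    · filter_upwards [ae_face_of_ae_skeleton hd hj hK he,
        ae_mem_domain_of_interface hd hΩ hK hL hKL he he'] with x h1 h2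
      rw [h1 h2, zero_mul]
    · filter_upwards [hπ.2 K hK e he hb] with x h1
      rw [h1, mul_zero]
  · intro hπ
    -- The jump cut off to `Ω` is constant on interfaces and zero on boundary faces, hence a
    -- multiplier. Testing with it gives the square of its norm.
    have hm : MemLp (Ω.indicator (M.jump c)) 2 (surf M.skeleton) :=
      (M.memLp_jump hd c).indicator hΩo.measurableSet
    have hmem : hm.toLp ∈ M.Multipliers k := by
      rw [mem_multipliers_iff hd hΩ hk]
      refine ⟨fun K hK L hL hKL e he he' => ?_, fun K hK e he hb => ?_⟩
      · obtain ⟨a, ha⟩ := exists_jump_ae_const hd hK he c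
        refine ⟨a, ?_⟩
        filter_upwards [ha, ae_mem_domain_of_interface hd hΩ hK hL hKL he he',
          ae_face_of_ae_skeleton hd hm.coeFn_toLp hK he] with x h1 h2 h3
        rw [h3, indicator_of_mem h2, h1]
      · filter_upwards [ae_face_of_ae_skeleton hd hm.coeFn_toLp hK he,
          ae_restrict_mem (Cell.isCompact_face hd he).isClosed.measurableSet] with x h1 h2
        rw [h1, indicator_of_notMem]
        have := hb h2
        rw [hΩo.frontier_eq] at this
        exact this.2
    have h0 := hπ _ hmem
    have h1 : ∫ x, Ω.indicator (M.jump c) x ^ 2 ∂surf M.skeleton = 0 := by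
      rw [← h0]
      refine integral_congr_ae ?_
      filter_upwards [hm.coeFn_toLp] with x hx
      rw [hx]
      by_cases hxΩ : x ∈ Ω
      · simp only [indicator_of_mem hxΩ, sq]
      · simp only [indicator_of_notMem hxΩ]; ring
    rw [integral_eq_zero_iff_of_nonneg (fun x => sq_nonneg _) hm.integrable_sq] at h1
    filter_upwards [h1] with x hx hxΩ
    simpa [hxΩ] using hx

end Mesh

end MultiplierSpace

/-! ### Broken divergence, jump operator and the inf-sup condition -/

section Traces

variable {d : ℕ} {Ω : Set (Pt d)} {M : Mesh Ω} {k : Pt d → Pt d →L[ℝ] Pt d} {kmin kmax : ℝ}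

namespace Mesh

/-- `g` is the broken divergence of `v`, and `j` is the sum of its outward normal traces. -/
def HasTraces (M : Mesh Ω) (v : L2V Ω) (g : L2 Ω) (j : Lp ℝ 2 (surf M.skeleton)) : Prop :=
  ∃ δ c, M.IsBrokenFlux v δ c ∧ (∀ K ∈ M.cells, ∀ᵐ x ∂volume.restrict K.dom, g x = δ K) ∧
    j =ᵐ[surf M.skeleton] M.jump c

theorem IsBrokenFlux.exists_hasTraces (hd : 0 < d) (hΩ : interior (closure Ω) = Ω) {v : L2V Ω}
    {δ : Cell d → ℝ} {c : Cell d → Set (Pt d) → ℝ} (h : M.IsBrokenFlux v δ c) :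
    ∃ g j, M.HasTraces v g j ∧ (∀ K ∈ M.cells, ∀ᵐ x ∂volume.restrict K.dom, g x = δ K) ∧
      j =ᵐ[surf M.skeleton] M.jump c := by
  obtain ⟨g, hg⟩ := M.exists_piecewise_const hΩ δ
  have hj := (M.memLp_jump hd c).coeFn_toLp
  exact ⟨g, _, ⟨δ, c, h, hg, hj⟩, hg, hj⟩

theorem HasTraces.weakDiv_ae (hd : 0 < d) {v : L2V Ω} {g : L2 Ω} {j : Lp ℝ 2 (surf M.skeleton)}
    (h : M.HasTraces v g j) {K : Cell d} (hK : K ∈ M.cells) :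
    g =ᵐ[volume.restrict K.dom] weakDiv K.dom v := by
  obtain ⟨δ, c, h, hg, -⟩ := h
  filter_upwards [hg K hK, (h K hK).weakDiv_ae hd] with x h1 h2
  rw [h1, h2]

/-- The fluxes are recovered from the field as its normal traces on the cells. -/
theorem IsBrokenFlux.jump_ae_eq (hd : 0 < d) {v : Pt d → Pt d} {δ δ' : Cell d → ℝ}
    {c c' : Cell d → Set (Pt d) → ℝ} (h : M.IsBrokenFlux v δ c) (h' : M.IsBrokenFlux v δ' c') :
    M.jump c =ᵐ[surf M.skeleton] M.jump c' := by
  refine (ae_skeleton_iff hd).2 fun K hK e he => ?_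
  have : ∀ᵐ x ∂surf e, ∀ L ∈ M.cells, faceFun L (c L) x = faceFun L (c' L) x := by
    refine (ae_ball_iff M.cells.countable_toSet).2 fun L hL => ?_
    by_cases he' : e ∈ L.faces
    · filter_upwards [ae_mono (Cell.surf_face_le hd he') ((h L hL).normalTrace_ae hd),
        ae_mono (Cell.surf_face_le hd he') ((h' L hL).normalTrace_ae hd)] with x h1 h2
      rw [← h1, h2]
    · filter_upwards [faceFun_ae hd hK he hL (c L), faceFun_ae hd hK he hL (c' L)] with x h1 h2
      rw [h1.2 he', h2.2 he']
  filter_upwards [this] with x hx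
  exact Finset.sum_congr rfl hx

theorem HasTraces.unique (hd : 0 < d) (hΩ : interior (closure Ω) = Ω) {v : L2V Ω} {g g' : L2 Ω}
    {j j' : Lp ℝ 2 (surf M.skeleton)} (h : M.HasTraces v g j) (h' : M.HasTraces v g' j') :
    g = g' ∧ j = j' := by
  constructor
  · exact ext_of_cells (M := M) hΩ fun K hK => (h.weakDiv_ae hd hK).trans (h'.weakDiv_ae hd hK).symm
  · obtain ⟨δ, c, hv, -, hj⟩ := h
    obtain ⟨δ', c', hv', -, hj'⟩ := h'
    exact Lp.ext (hj.trans ((hv.jump_ae_eq hd hv').trans hj'.symm))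

theorem HasTraces.smul_add (hΩ : interior (closure Ω) = Ω) {v v' : L2V Ω} {g g' : L2 Ω}
    {j j' : Lp ℝ 2 (surf M.skeleton)} (h : M.HasTraces v g j) (h' : M.HasTraces v' g' j') (a : ℝ) :
    M.HasTraces (a • v + v') (a • g + g') (a • j + j') := by
  obtain ⟨δ, c, hv, hg, hj⟩ := h
  obtain ⟨δ', c', hv', hg', hj'⟩ := h'
  refine ⟨fun K => a * δ K + δ' K, fun K e => a * c K e + c' K e, fun K hK => ?_,
    fun K hK => ?_, ?_⟩
  · refine ((hv K hK).smul_add (hv' K hK) a).congr ?_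
    filter_upwards [ae_dom_of_ae hΩ hK (Lp.coeFn_add (a • v) v'),
      ae_dom_of_ae hΩ hK (Lp.coeFn_smul a v)] with x h1 h2
    rw [h1, Pi.add_apply, h2, Pi.smul_apply]
  · filter_upwards [ae_dom_of_ae hΩ hK (Lp.coeFn_add (a • g) g'),
      ae_dom_of_ae hΩ hK (Lp.coeFn_smul a g), hg K hK, hg' K hK] with x h1 h2 h3 h4
    rw [h1, Pi.add_apply, h2, Pi.smul_apply, h3, h4, smul_eq_mul]
  · filter_upwards [Lp.coeFn_add (a • j) j', Lp.coeFn_smul a j, hj, hj'] with x h1 h2 h3 h4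
    rw [h1, Pi.add_apply, h2, Pi.smul_apply, h3, h4, smul_eq_mul]
    simp only [jump, faceFun, Finset.mul_sum, ← Finset.sum_add_distrib]
    refine Finset.sum_congr rfl fun K _ => Finset.sum_congr rfl fun e _ => ?_
    by_cases hx : x ∈ e
    · simp [hx]
    · simp [hx]

/-- `HasTraces` is a linear relation, total on the broken velocities and single-valued, hence the
graph of linear maps. Choice gives the values and uniqueness gives the linearity. -/
theorem exists_traceMaps (hd : 0 < d) (hΩ : interior (closure Ω) = Ω)
    (hk : IsCoeff k Ω kmin kmax) :
    ∃ (D : M.brokenSpace hΩ (velSpan k) →ₗ[ℝ] L2 Ω)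
      (N : M.brokenSpace hΩ (velSpan k) →ₗ[ℝ] Lp ℝ 2 (surf M.skeleton)),
      ∀ v : M.brokenSpace hΩ (velSpan k), M.HasTraces (v : L2V Ω) (D v) (N v) := by
  have hex : ∀ v : M.brokenSpace hΩ (velSpan k), ∃ g j, M.HasTraces v g j := fun v => by
    obtain ⟨δ, c, h⟩ := exists_isBrokenFlux hd hΩ hk v.2
    obtain ⟨g, j, h, -⟩ := h.exists_hasTraces hd hΩ
    exact ⟨g, j, h⟩
  choose D N h using hex
  have key : ∀ (a : ℝ) v w, D (a • v + w) = a • D v + D w ∧ N (a • v + w) = a • N v + N w :=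
    fun a v w => (h (a • v + w)).unique hd hΩ ((h v).smul_add hΩ (h w) a)
  have h0 : D 0 = 0 ∧ N 0 = 0 := by
    have := key 1 0 0
    simp only [one_smul, add_zero, left_eq_add] at this
    exact this
  refine ⟨⟨⟨D, fun v w => ?_⟩, fun a v => ?_⟩, ⟨⟨N, fun v w => ?_⟩, fun a v => ?_⟩, h⟩
  · have := (key 1 v w).1
    rwa [one_smul, one_smul] at this
  · have := (key a v 0).1
    rwa [add_zero, h0.1, add_zero] at this
  · have := (key 1 v w).2
    rwa [one_smul, one_smul] at this
  · have := (key a v 0).2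
    rwa [add_zero, h0.2, add_zero] at this

theorem inner_eq_sum (hΩ : interior (closure Ω) = Ω) {p g : L2 Ω} {P δ : Cell d → ℝ}
    (hp : ∀ K ∈ M.cells, ∀ᵐ x ∂volume.restrict K.dom, p x = P K)
    (hg : ∀ K ∈ M.cells, ∀ᵐ x ∂volume.restrict K.dom, g x = δ K) :
    inner ℝ p g = ∑ K ∈ M.cells, P K * (δ K * volume.real K.dom) := by
  rw [L2.inner_def, integral_domain hΩ (L2.integrable_inner p g)]
  refine Finset.sum_congr rfl fun K hK => ?_
  rw [integral_congr_ae (g := fun _ => P K * δ K)]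
  · simp; ring
  · filter_upwards [hp K hK, hg K hK] with x h1 h2
    rw [h1, h2, inner_real_eq_mul]

theorem integral_jump_mul_eq_sum (hd : 0 < d) (c : Cell d → Set (Pt d) → ℝ)
    (l : Lp ℝ 2 (surf M.skeleton)) :
    ∫ x, M.jump c x * l x ∂surf M.skeleton
      = ∑ K ∈ M.cells, ∑ e ∈ K.faceSet, c K e * ∫ x in e, l x ∂μHE[d - 1] := by
  rw [integral_jump_mul hd c (Lp.memLp l)]
  refine Finset.sum_congr rfl fun K hK => ?_
  have := isFiniteMeasure_surf_frontier hd K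
  exact integral_faceFun_mul hd _
    (((Lp.memLp l).mono_measure (surf_frontier_le hK)).integrable (by norm_num))

/-- The position vector has constant divergence `d`, constant face fluxes and no interior jumps. -/
theorem exists_flux_id (hd : 0 < d) (hΩ : interior (closure Ω) = Ω) :
    ∃ c, M.IsBrokenFlux (fun x => x) (fun _ => d) c ∧
      ∀ᵐ x ∂surf M.skeleton, x ∈ Ω → M.jump c x = 0 := by
  have hΩo : IsOpen Ω := by rw [← hΩ]; exact isOpen_interior
  have hfin : IsFiniteMeasure ((volume : Measure (Pt d)).restrict Ω) :=
    ⟨by rw [restrict_apply_univ]; exact M.volume_domain_lt_top⟩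
  choose δ c h using fun K : Cell d => exists_hasFlux_of_mem_RT0 hd K.id_mem_RT0
  have hv : MemLp (fun x : Pt d => x) 2 (volume.restrict Ω) := by
    obtain ⟨C, hC⟩ := M.isBounded_domain.exists_norm_le
    exact MemLp.of_bound aestronglyMeasurable_id C
      ((ae_restrict_mem hΩo.measurableSet).mono fun x hx => hC x hx)
  have hc : MemLp (fun _ : Pt d => (d : ℝ)) 2 (volume.restrict Ω) := memLp_const _
  have hB : M.IsBrokenFlux (fun x => x) δ c := fun K _ => h K
  have hdiv : HasWeakDiv Ω (fun x => x) hc.toLp := fun φ hφ hφc hs => by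
    rw [integral_inner_id_gradient hφ hφc hs, ← integral_const_mul, neg_inj]
    refine integral_congr_ae ?_
    filter_upwards [hc.coeFn_toLp] with x hx
    rw [hx]
  -- The divergence found on each cell agrees with the global one, because a cell has positive
  -- volume.
  have hδ : ∀ K ∈ M.cells, δ K = d := fun K hK => by
    have : NeZero ((volume : Measure (Pt d)).restrict K.dom) :=
      ⟨fun h0 => (K.volume_dom_pos hd).ne' (restrict_eq_zero.1 h0)⟩
    obtain ⟨x, h1, h2⟩ := ((hB.weakDiv_ae hd hΩ hdiv hK).and
      (ae_dom_of_ae hΩ hK hc.coeFn_toLp)).exists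
    rw [← h1, h2]
  exact ⟨c, fun K hK => hδ K hK ▸ h K, hB.jump_ae_zero hd hΩ hv hdiv⟩

theorem exists_multiplier_ae_const (hd : 0 < d) (hΩ : interior (closure Ω) = Ω)
    (hk : IsCoeff k Ω kmin kmax) {l : Lp ℝ 2 (surf M.skeleton)} (hl : l ∈ M.Multipliers k)
    {K : Cell d} (hK : K ∈ M.cells) {e : Set (Pt d)} (he : e ∈ K.faces) :
    ∃ b : ℝ, ∀ᵐ x ∂surf e, l x = b := by
  rcases interface_or_boundary hd hΩ hK he with ⟨L, hL, hKL, he'⟩ | hb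
  · exact ((mem_multipliers_iff hd hΩ hk).1 hl).1 K hK L hL hKL e he he'
  · exact ⟨0, hl.2 K hK e he hb⟩

open Classical in
/-- The inf-sup condition of the hybridized method, in qualitative form. -/
theorem eq_zero_of_forall_traces (hd : 0 < d) (hΩ : interior (closure Ω) = Ω)
    (hk : IsCoeff k Ω kmin kmax) {p : L2 Ω} (hp : p ∈ M.Q) {l : Lp ℝ 2 (surf M.skeleton)}
    (hl : l ∈ M.Multipliers k)
    (h : ∀ v ∈ M.brokenSpace hΩ (velSpan k), ∀ g j, M.HasTraces v g j →
      inner ℝ p g = inner ℝ j l) : p = 0 ∧ l = 0 := by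
  choose! P hP using hp
  -- Every choice of face fluxes is attained, and the divergence theorem expresses the divergences
  -- by them, so the hypothesis becomes an identity about arbitrary face data.
  have hflux : ∀ a : Cell d → Set (Pt d) → ℝ,
      ∑ K ∈ M.cells, P K * ∑ e ∈ K.faceSet, a K e * (μHE[d - 1] : Measure (Pt d)).real e
        = ∫ x, M.jump a x * l x ∂surf M.skeleton := by
    intro a
    obtain ⟨v, hv, δ, hB⟩ := exists_velocity_of_flux (M := M) hd hΩ hk a
    obtain ⟨g, j, hT, hg, hj⟩ := hB.exists_hasTraces hd hΩ
    have h1 := h v hv g j hT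
    rw [inner_eq_sum hΩ hP hg, L2.inner_def] at h1
    rw [integral_congr_ae (g := fun x => inner ℝ (j x) (l x)), ← h1]
    · exact Finset.sum_congr rfl fun K hK => by rw [(hB K hK).sum_flux hd]
    · filter_upwards [hj] with x hx
      rw [hx, inner_real_eq_mul]
  have hPl : ∀ K ∈ M.cells, ∀ e ∈ K.faces, ∀ᵐ x ∂surf e, l x = P K := by
    intro K hK e he
    have he' := Cell.mem_faceSet.2 he
    obtain ⟨b, hb⟩ := exists_multiplier_ae_const hd hΩ hk hl hK he
    -- Unit flux through a single face of a single cell isolates the value of `l` on that face and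
    -- equates it with `P K`.
    have h1 := hflux (Pi.single K (Pi.single e 1))
    have hint : ∫ x in e, l x ∂μHE[d - 1] = (μHE[d - 1] : Measure (Pt d)).real e * b := by
      rw [integral_congr_ae (μ := μHE[d - 1].restrict e) (g := fun _ => b) hb]
      simp
    rw [integral_jump_mul_eq_sum hd, Finset.sum_eq_single K, Finset.sum_eq_single e,
      Finset.sum_eq_single K, Finset.sum_eq_single e, Pi.single_eq_same, Pi.single_eq_same, one_mul,
      one_mul, hint, mul_comm] at h1
    · have := mul_left_cancel₀ (Cell.hausdorff_face_pos hd he).ne' h1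
      rwa [this]
    · intro e'' _ hne
      rw [Pi.single_eq_same, Pi.single_eq_of_ne hne, zero_mul]
    · exact fun h => absurd he' h
    · intro J _ hne
      simp [Pi.single_eq_of_ne hne]
    · exact fun h => absurd hK h
    · intro e'' _ hne
      rw [Pi.single_eq_same, Pi.single_eq_of_ne hne, zero_mul]
    · exact fun h => absurd he' h
    · intro J _ hne
      simp [Pi.single_eq_of_ne hne]
    · exact fun h => absurd hK h
  -- The next test uses the fluxes of the position vector scaled by `P K` on each cell. As `P K`
  -- equals `l` on the faces, the jump becomes `l` times the jump of the position vector, which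
  -- vanishes on interfaces; on boundary faces `l` itself vanishes.
  obtain ⟨c, hc, hj⟩ := exists_flux_id (M := M) hd hΩ
  have h0 : ∫ x, M.jump (fun K e => P K * c K e) x * l x ∂surf M.skeleton = 0 := by
    rw [integral_congr_ae (g := fun _ => 0), integral_zero]
    refine (ae_skeleton_iff hd).2 fun K hK e he => ?_
    have hterm : ∀ᵐ x ∂surf e, ∀ L ∈ M.cells,
        faceFun L (fun e => P L * c L e) x = l x * faceFun L (c L) x := by
      refine (ae_ball_iff M.cells.countable_toSet).2 fun L hL => ?_
      by_cases he' : e ∈ L.faces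
      · filter_upwards [faceFun_ae hd hK he hL (c L), hPl L hL e he',
          faceFun_ae hd hK he hL (fun e => P L * c L e)] with x h1 h2 h3
        rw [h1.1 he', h3.1 he', h2]
      · filter_upwards [faceFun_ae hd hK he hL (c L),
          faceFun_ae hd hK he hL (fun e => P L * c L e)] with x h1 h3
        rw [h1.2 he', h3.2 he', mul_zero]
    have hsum : ∀ᵐ x ∂surf e, M.jump (fun K e => P K * c K e) x = l x * M.jump c x := by
      filter_upwards [hterm] with x hx
      rw [jump, jump, Finset.mul_sum]
      exact Finset.sum_congr rfl hx
    rcases interface_or_boundary hd hΩ hK he with ⟨L, hL, hKL, he'⟩ | hb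
    · filter_upwards [hsum, ae_face_of_ae_skeleton hd hj hK he,
        ae_mem_domain_of_interface hd hΩ hK hL hKL he he'] with x h1 h2 h3
      rw [h1, h2 h3, mul_zero, zero_mul]
    · filter_upwards [hl.2 K hK e he hb] with x h1
      rw [h1, mul_zero]
  rw [← hflux] at h0
  have hP0 : ∀ K ∈ M.cells, P K = 0 := by
    -- The left side of the flux identity is now a weighted sum of the squares of `P K` with
    -- positive weights.
    have hterm : ∀ K ∈ M.cells, P K * ∑ e ∈ K.faceSet,
        P K * c K e * (μHE[d - 1] : Measure (Pt d)).real e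
        = P K ^ 2 * (d * volume.real K.dom) := fun K hK => by
      rw [(hc K hK).sum_flux hd, Finset.mul_sum, Finset.mul_sum]
      exact Finset.sum_congr rfl fun e _ => by ring
    have hpos : ∀ K : Cell d, 0 < (d : ℝ) * volume.real K.dom := fun K =>
      mul_pos (by exact_mod_cast hd)
        (ENNReal.toReal_pos (K.volume_dom_pos hd).ne' K.volume_dom_lt_top.ne)
    rw [Finset.sum_congr rfl hterm, Finset.sum_eq_zero_iff_of_nonneg
      fun K _ => mul_nonneg (sq_nonneg _) (hpos K).le] at h0
    intro K hK
    exact pow_eq_zero_iff two_ne_zero |>.1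
      ((mul_eq_zero.1 (h0 K hK)).resolve_right (hpos K).ne')
  constructor
  · refine ext_of_cells (M := M) hΩ fun K hK => ?_
    filter_upwards [hP K hK, ae_dom_of_ae hΩ hK (Lp.coeFn_zero ℝ 2 (volume.restrict Ω))]
      with x h1 h2
    rw [h1, h2, hP0 K hK, Pi.zero_apply]
  · refine Lp.ext ((ae_skeleton_iff hd).2 fun K hK e he => ?_)
    filter_upwards [hPl K hK e he, ae_face_of_ae_skeleton hd (Lp.coeFn_zero ℝ 2 _) hK he]
      with x h1 h2
    rw [h1, h2, hP0 K hK, Pi.zero_apply]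

end Mesh

end Traces

/-! ### The two discrete problems as instances of the abstract ones -/

section Discrete

variable {d : ℕ} {Ω : Set (Pt d)} {M : Mesh Ω} {k : Pt d → Pt d →L[ℝ] Pt d} {kmin kmax : ℝ}

namespace Mesh

/-- The space of piecewise constant functions. -/
def constSpace (M : Mesh Ω) (hΩ : interior (closure Ω) = Ω) : Submodule ℝ (L2 Ω) where
  carrier := M.Q
  add_mem' := fun {p q} hp hq K hK => by
    obtain ⟨a, ha⟩ := hp K hK
    obtain ⟨b, hb⟩ := hq K hK
    refine ⟨a + b, ?_⟩
    filter_upwards [ha, hb, ae_dom_of_ae hΩ hK (Lp.coeFn_add p q)] with x h1 h2 h3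
    rw [h3, Pi.add_apply, h1, h2]
  zero_mem' := fun K hK => ⟨0, ae_dom_of_ae hΩ hK (Lp.coeFn_zero ℝ 2 (volume.restrict Ω))⟩
  smul_mem' := fun s p hp K hK => by
    obtain ⟨a, ha⟩ := hp K hK
    refine ⟨s * a, ?_⟩
    filter_upwards [ha, ae_dom_of_ae hΩ hK (Lp.coeFn_smul s p)] with x h1 h3
    rw [h3, Pi.smul_apply, h1, smul_eq_mul]

theorem inner_eq_integral_mul {α : Type*} [MeasurableSpace α] {μ : Measure α} (p q : Lp ℝ 2 μ) :
    inner ℝ p q = ∫ x, p x * q x ∂μ := by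
  rw [L2.inner_def]
  exact integral_congr_ae (ae_of_all _ fun x => inner_real_eq_mul _ _)

theorem HasTraces.pairC_eq (hd : 0 < d) {v : L2V Ω} {g : L2 Ω} {j : Lp ℝ 2 (surf M.skeleton)}
    (h : M.HasTraces v g j) (π : Lp ℝ 2 (surf M.skeleton)) : M.pairC v π = inner ℝ j π := by
  obtain ⟨δ, c, hv, -, hj⟩ := h
  rw [Mesh.pairC_eq hd hv, inner_eq_integral_mul]
  refine integral_congr_ae ?_
  filter_upwards [hj] with x hx
  rw [hx]

theorem HasTraces.mem_X2_iff (hd : 0 < d) (hΩ : interior (closure Ω) = Ω)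
    (hk : IsCoeff k Ω kmin kmax) {v : L2V Ω} (hv : v ∈ M.X2broken k) {g : L2 Ω}
    {j : Lp ℝ 2 (surf M.skeleton)} (h : M.HasTraces v g j) :
    v ∈ M.X2 k ↔ ∀ π ∈ M.Multipliers k, inner ℝ j π = 0 := by
  have h' := h.pairC_eq hd
  obtain ⟨δ, c, hB, -, -⟩ := h
  rw [mem_X2_iff_forall_integral hd hΩ hk hv hB]
  exact forall₂_congr fun π _ => by rw [← h', Mesh.pairC_eq hd hB]

theorem HasTraces.weakDiv_eq (hd : 0 < d) (hΩ : interior (closure Ω) = Ω) {v : L2V Ω} {g : L2 Ω}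
    {j : Lp ℝ 2 (surf M.skeleton)} (h : M.HasTraces v g j) (hv : MemHDiv Ω v) :
    weakDiv Ω v = g := by
  obtain ⟨δ, c, hB, hg, -⟩ := h
  refine ext_of_cells (M := M) hΩ fun K hK => ?_
  filter_upwards [hg K hK, hB.weakDiv_ae hd hΩ hv.hasWeakDiv hK] with x h1 h2
  rw [h1, h2]

theorem HasTraces.sum_integral (hd : 0 < d) (hΩ : interior (closure Ω) = Ω) {v : L2V Ω} {g : L2 Ω}
    {j : Lp ℝ 2 (surf M.skeleton)} (h : M.HasTraces v g j) (q : L2 Ω) :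
    ∑ K ∈ M.cells, ∫ x in K.dom, weakDiv K.dom v x * q x = inner ℝ g q := by
  rw [inner_eq_integral_mul,
    integral_domain hΩ (integrable_mul_of_memLp (Lp.memLp g) (Lp.memLp q))]
  refine Finset.sum_congr rfl fun K hK => integral_congr_ae ?_
  filter_upwards [h.weakDiv_ae hd hK] with x hx
  rw [hx]

section

variable {hd : 0 < d} {hΩ : interior (closure Ω) = Ω} {hk : IsCoeff k Ω kmin kmax}
  {D : M.brokenSpace hΩ (velSpan k) →ₗ[ℝ] L2 Ω}
  {N : M.brokenSpace hΩ (velSpan k) →ₗ[ℝ] Lp ℝ 2 (surf M.skeleton)}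

theorem isHybridData
    (hDN : ∀ v : M.brokenSpace hΩ (velSpan k), M.HasTraces (v : L2V Ω) (D v) (N v)) :
    IsHybridData (M.brokenSpace hΩ (gradSpan k)) (M.brokenSpace hΩ (velSpan k)) (M.constSpace hΩ)
      (M.multiplierSpace hd hΩ hk) (coeffOp hk).toLinearMap D N where
  finite := finiteDimensional_brokenSpace hΩ _ fun K hK =>
    finiteDimensional_gradSpan hd (isCoeff_dom hΩ hk hK)
  eq_zero _ h := eq_zero_of_inner_coeffOp hk h
  map_eq := brokenSpace_velSpan_eq_map hd hΩ hk
  inf_sup p hp l hl h := eq_zero_of_forall_traces hd hΩ hk hp hl fun v hv g j hT => by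
    obtain ⟨rfl, rfl⟩ := hT.unique hd hΩ (hDN ⟨v, hv⟩)
    exact h ⟨v, hv⟩

theorem isHybridSolution_iff
    (hDN : ∀ v : M.brokenSpace hΩ (velSpan k), M.HasTraces (v : L2V Ω) (D v) (N v)) {f : L2 Ω}
    (θ : M.brokenSpace hΩ (gradSpan k)) (u : M.brokenSpace hΩ (velSpan k)) (p : M.constSpace hΩ)
    (l : M.multiplierSpace hd hΩ hk) :
    M.IsHybridSolution k f θ u p l ↔
      IsHybrid (M.constSpace hΩ) (M.multiplierSpace hd hΩ hk) (coeffOp hk).toLinearMap D N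
        f θ u p l := by
  have hiff : M.IsHybridSolution k f θ u p l ↔ _ :=
    ⟨fun h => h.2.2.2.2, fun h => ⟨θ.2, u.2, p.2, l.2, h⟩⟩
  rw [hiff]
  refine and_congr ?_ (and_congr ?_ (and_congr ?_ ?_))
  · refine ⟨fun h ξ => ?_, fun h ξ hξ => ?_⟩
    · have := h ξ ξ.2
      rwa [← inner_coeffOp hk, ← L2.inner_def] at this
    · rw [← inner_coeffOp hk, ← L2.inner_def]
      exact h ⟨ξ, hξ⟩
  · have key : ∀ τ : M.brokenSpace hΩ (velSpan k),
        ((∫ x in Ω, inner ℝ ((θ : L2V Ω) x) ((τ : L2V Ω) x))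
          + ∑ K ∈ M.cells, ∫ x in K.dom, (p : L2 Ω) x * weakDiv K.dom (τ : L2V Ω) x
            = M.pairC (τ : L2V Ω) l) ↔
        inner ℝ (θ : L2V Ω) (τ : L2V Ω) + inner ℝ (p : L2 Ω) (D τ)
          = inner ℝ (N τ) (l : Lp ℝ 2 (surf M.skeleton)) := fun τ => by
      rw [(hDN τ).pairC_eq hd, ← L2.inner_def, real_inner_comm _ (p : L2 Ω),
        ← (hDN τ).sum_integral hd hΩ]
      simp only [mul_comm]
    exact ⟨fun h τ => (key τ).1 (h τ τ.2), fun h τ hτ => (key ⟨τ, hτ⟩).2 (h ⟨τ, hτ⟩)⟩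
  · refine ⟨fun h q => ?_, fun h q hq => ?_⟩
    · have := h q q.2
      rwa [(hDN u).sum_integral hd hΩ, ← inner_eq_integral_mul] at this
    · rw [(hDN u).sum_integral hd hΩ, ← inner_eq_integral_mul]
      exact h ⟨q, hq⟩
  · refine ⟨fun h π => ?_, fun h π hπ => ?_⟩
    · have := h π π.2
      rwa [(hDN u).pairC_eq hd] at this
    · rw [(hDN u).pairC_eq hd]
      exact h ⟨π, hπ⟩

/-- The space X_{2,h} is the common kernel of the jump functionals, and on it the global weak
divergence coincides with the broken one, so the velocities without jumps of the abstract problem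
are the right ones. -/
theorem isMsFEMSolution_iff
    (hDN : ∀ v : M.brokenSpace hΩ (velSpan k), M.HasTraces (v : L2V Ω) (D v) (N v)) {f : L2 Ω}
    (θ : M.brokenSpace hΩ (gradSpan k)) (u : M.brokenSpace hΩ (velSpan k)) (p : M.constSpace hΩ) :
    M.IsMsFEMSolution k f θ u p ↔
      IsMixed (M.constSpace hΩ) (M.multiplierSpace hd hΩ hk) (coeffOp hk).toLinearMap D N
        f θ u p := by
  have hX2 : ∀ v : M.brokenSpace hΩ (velSpan k), (v : L2V Ω) ∈ M.X2 k ↔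
      ∀ π : M.multiplierSpace hd hΩ hk,
        inner ℝ (N v) (π : Lp ℝ 2 (surf M.skeleton)) = 0 := fun v =>
    ((hDN v).mem_X2_iff hd hΩ hk v.2).trans ⟨fun h π => h π π.2, fun h π hπ => h ⟨π, hπ⟩⟩
  have hfirst : (∀ ξ ∈ M.X1 k, (∫ x in Ω, inner ℝ (k x ((θ : L2V Ω) x)) (ξ x))
        + (∫ x in Ω, inner ℝ ((u : L2V Ω) x) (ξ x)) = 0) ↔
      ∀ ξ : M.brokenSpace hΩ (gradSpan k),
        inner ℝ ((coeffOp hk).toLinearMap (θ : L2V Ω)) (ξ : L2V Ω)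
          + inner ℝ (u : L2V Ω) (ξ : L2V Ω) = 0 := by
    refine ⟨fun h ξ => ?_, fun h ξ hξ => ?_⟩
    · have := h ξ ξ.2
      rwa [← inner_coeffOp hk, ← L2.inner_def] at this
    · rw [← inner_coeffOp hk, ← L2.inner_def]
      exact h ⟨ξ, hξ⟩
  have hsecond : ∀ τ : M.brokenSpace hΩ (velSpan k), (τ : L2V Ω) ∈ M.X2 k →
      (((∫ x in Ω, inner ℝ ((θ : L2V Ω) x) ((τ : L2V Ω) x))
          + ∫ x in Ω, (p : L2 Ω) x * weakDiv Ω (τ : L2V Ω) x = 0) ↔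
        inner ℝ (θ : L2V Ω) (τ : L2V Ω) + inner ℝ (p : L2 Ω) (D τ) = 0) := fun τ hτ => by
    rw [(hDN τ).weakDiv_eq hd hΩ hτ.1, ← inner_eq_integral_mul, ← L2.inner_def]
  have hthird : (u : L2V Ω) ∈ M.X2 k →
      ((∀ q ∈ M.Q, ∫ x in Ω, weakDiv Ω (u : L2V Ω) x * q x = ∫ x in Ω, f x * q x) ↔
        ∀ q : M.constSpace hΩ, inner ℝ (D u) (q : L2 Ω) = inner ℝ f (q : L2 Ω)) := fun hu => by
    rw [(hDN u).weakDiv_eq hd hΩ hu.1]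
    simp only [← inner_eq_integral_mul]
    exact ⟨fun h q => h q q.2, fun h q hq => h ⟨q, hq⟩⟩
  constructor
  · rintro ⟨-, hu, -, h1, h2, h3⟩
    exact ⟨hfirst.1 h1, fun τ hτ => (hsecond τ ((hX2 τ).2 hτ)).1 (h2 τ ((hX2 τ).2 hτ)),
      (hthird hu).1 h3, (hX2 u).1 hu⟩
  · rintro ⟨h1, h2, h3, h4⟩
    have hu := (hX2 u).2 h4
    exact ⟨θ.2, hu, p.2, hfirst.2 h1,
      fun τ hτ => (hsecond ⟨τ, hτ.2⟩ hτ).2 (h2 ⟨τ, hτ.2⟩ ((hX2 ⟨τ, hτ.2⟩).1 hτ)),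
      (hthird hu).2 h3⟩

end

/-- Existence for the hybridized method. -/
theorem exists_isHybridSolution (hd : 0 < d) (hΩ : interior (closure Ω) = Ω)
    (hk : IsCoeff k Ω kmin kmax) (f : L2 Ω) : ∃ θ u p l, M.IsHybridSolution k f θ u p l := by
  obtain ⟨D, N, hDN⟩ := exists_traceMaps (M := M) hd hΩ hk
  obtain ⟨θ, u, p, l, h⟩ := (isHybridData (hd := hd) (hk := hk) hDN).exists_isHybrid f
  exact ⟨θ, u, p, l, (isHybridSolution_iff hDN θ u p l).2 h⟩

/-- Uniqueness for the hybridized method. -/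
theorem IsHybridSolution.unique (hd : 0 < d) (hΩ : interior (closure Ω) = Ω)
    (hk : IsCoeff k Ω kmin kmax) {f : L2 Ω} {θ θ' u u' : L2V Ω} {p p' : L2 Ω}
    {l l' : Lp ℝ 2 (surf M.skeleton)} (h : M.IsHybridSolution k f θ u p l)
    (h' : M.IsHybridSolution k f θ' u' p' l') : θ = θ' ∧ u = u' ∧ p = p' ∧ l = l' := by
  obtain ⟨D, N, hDN⟩ := exists_traceMaps (M := M) hd hΩ hk
  obtain ⟨h1, h2, h3, h4⟩ := (isHybridData (hd := hd) (hk := hk) hDN).unique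
    ((isHybridSolution_iff hDN ⟨θ, h.1⟩ ⟨u, h.2.1⟩ ⟨p, h.2.2.1⟩ ⟨l, h.2.2.2.1⟩).1 h)
    ((isHybridSolution_iff hDN ⟨θ', h'.1⟩ ⟨u', h'.2.1⟩ ⟨p', h'.2.2.1⟩ ⟨l', h'.2.2.2.1⟩).1 h')
  exact ⟨congrArg Subtype.val h1, congrArg Subtype.val h2, congrArg Subtype.val h3,
    congrArg Subtype.val h4⟩

theorem IsHybridSolution.isMsFEMSolution (hd : 0 < d) (hΩ : interior (closure Ω) = Ω)
    (hk : IsCoeff k Ω kmin kmax) {f : L2 Ω} {θ u : L2V Ω} {p : L2 Ω}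
    {l : Lp ℝ 2 (surf M.skeleton)} (h : M.IsHybridSolution k f θ u p l) :
    M.IsMsFEMSolution k f θ u p := by
  obtain ⟨D, N, hDN⟩ := exists_traceMaps (M := M) hd hΩ hk
  exact (isMsFEMSolution_iff (hd := hd) (hk := hk) hDN ⟨θ, h.1⟩ ⟨u, h.2.1⟩ ⟨p, h.2.2.1⟩).2
    ((isHybridSolution_iff hDN ⟨θ, h.1⟩ ⟨u, h.2.1⟩ ⟨p, h.2.2.1⟩ ⟨l, h.2.2.2.1⟩).1 h).isMixed

theorem IsMsFEMSolution.exists_isHybridSolution (hd : 0 < d) (hΩ : interior (closure Ω) = Ω)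
    (hk : IsCoeff k Ω kmin kmax) {f : L2 Ω} {θ u : L2V Ω} {p : L2 Ω}
    (h : M.IsMsFEMSolution k f θ u p) : ∃ l, M.IsHybridSolution k f θ u p l := by
  obtain ⟨D, N, hDN⟩ := exists_traceMaps (M := M) hd hΩ hk
  obtain ⟨l, hl⟩ := ((isMsFEMSolution_iff (hd := hd) (hk := hk) hDN ⟨θ, h.1⟩ ⟨u, h.2.1.2⟩
    ⟨p, h.2.2.1⟩).1 h).exists_isHybrid (isHybridData hDN)
  exact ⟨l, (isHybridSolution_iff hDN ⟨θ, h.1⟩ ⟨u, h.2.1.2⟩ ⟨p, h.2.2.1⟩ l).2 hl⟩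

end Mesh

end Discrete

end ExpMsFEM

end

/-! ### The main theorem -/

theorem theorem4p3 {d : ℕ} (hd : d = 2 ∨ d = 3)
    (Ω : Set (ExpMsFEM.Pt d)) (hΩ : interior (closure Ω) = Ω) (M : ExpMsFEM.Mesh Ω)
    (k : ExpMsFEM.Pt d → ExpMsFEM.Pt d →L[ℝ] ExpMsFEM.Pt d) (hk : Measurable k)
    (hsymm : ∀ x ∈ Ω, ∀ ζ ζ' : ExpMsFEM.Pt d, inner ℝ (k x ζ) ζ' = inner ℝ ζ (k x ζ'))
    (kmin kmax : ℝ) (hkmin : 0 < kmin)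
    (hbound : ∀ x ∈ Ω, ∀ ζ : ExpMsFEM.Pt d,
      kmin * ‖ζ‖ ^ 2 ≤ inner ℝ ζ (k x ζ) ∧ inner ℝ ζ (k x ζ) ≤ kmax * ‖ζ‖ ^ 2)
    (f : ExpMsFEM.L2 Ω) :
    (∃! s : ExpMsFEM.L2V Ω × ExpMsFEM.L2V Ω × ExpMsFEM.L2 Ω,
      M.IsMsFEMSolution k f s.1 s.2.1 s.2.2) ∧
    (∃! s : ExpMsFEM.L2V Ω × ExpMsFEM.L2V Ω × ExpMsFEM.L2 Ω × Lp ℝ 2 (ExpMsFEM.surf M.skeleton),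
      M.IsHybridSolution k f s.1 s.2.1 s.2.2.1 s.2.2.2) ∧
    (∀ (θ u θ' u' : ExpMsFEM.L2V Ω) (p p' : ExpMsFEM.L2 Ω)
      (lam : Lp ℝ 2 (ExpMsFEM.surf M.skeleton)),
      M.IsMsFEMSolution k f θ u p → M.IsHybridSolution k f θ' u' p' lam →
        θ' = θ ∧ u' = u ∧ p' = p) := by
  have hd0 : 0 < d := by omega
  have hΩm : MeasurableSet Ω := by rw [← hΩ]; exact isOpen_interior.measurableSet
  have hK : ExpMsFEM.IsCoeff k Ω kmin kmax := ⟨hΩm, hk, hsymm, hkmin, hbound⟩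
  have hcompare : ∀ (θ u θ' u' : ExpMsFEM.L2V Ω) (p p' : ExpMsFEM.L2 Ω)
      (lam : Lp ℝ 2 (ExpMsFEM.surf M.skeleton)),
      M.IsMsFEMSolution k f θ u p → M.IsHybridSolution k f θ' u' p' lam →
        θ' = θ ∧ u' = u ∧ p' = p := by
    intro θ u θ' u' p p' lam h h'
    -- The mixed solution is completed by a multiplier to a hybrid solution, and uniqueness of
    -- hybrid solutions compares the two. This also yields uniqueness for the mixed problem.
    obtain ⟨l, hl⟩ := h.exists_isHybridSolution hd0 hΩ hK
    obtain ⟨h1, h2, h3, -⟩ := h'.unique hd0 hΩ hK hl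
    exact ⟨h1, h2, h3⟩
  obtain ⟨θ, u, p, l, h⟩ := ExpMsFEM.Mesh.exists_isHybridSolution (M := M) hd0 hΩ hK f
  refine ⟨⟨(θ, u, p), h.isMsFEMSolution hd0 hΩ hK, ?_⟩, ⟨(θ, u, p, l), h, ?_⟩, hcompare⟩
  · rintro ⟨θ', u', p'⟩ h'
    obtain ⟨rfl, rfl, rfl⟩ := hcompare θ' u' θ u p' p l h' h
    rfl
  · rintro ⟨θ', u', p', l'⟩ h'
    obtain ⟨rfl, rfl, rfl, rfl⟩ := h.unique hd0 hΩ hK h'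
    rfl
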